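/- Let $n\ge 1$. For $z=(z',z_n)\in\mathbb C^n$ write $z=x+iy$, let $$T_B=\{z=x+iy\in\mathbb C^n : |y'|^2<y_n\},\qquad \rho(z,w)=\tfrac14\big((z'-\overline{w'})^2-2i(z_n-\overline{w_n})\big),\qquad \rho(z)=\rho(z,z)=y_n-|y'|^2,$$ where $u^2=u_1^2+\dots+u_{n-1}^2$ for $u\in\mathbb C^{n-1}$, and put $\mathbf i=(0',i)$. For $\alpha>-1$ let $dV_\alpha(z)=\rho(z)^\alpha\,dV(z)$ on $T_B$, with $V$ the Lebesgue measure. For $0<p<\infty$ let $A^p_\alpha(T_B)$ be the space of holomorphic functions $f$ on $T_B$ with $\|f\|_{p,\alpha}=\big(\int_{T_B}|f|^p\,dV_\alpha\big)^{1/p}<\infty$. Let $$K_\alpha(z,w)=\frac{\Gamma(n+\alpha+1)}{2^{n+1}\pi^n\,\Gamma(\alpha+1)\,\rho(z,w)^{n+\alpha+1}}$$ (principal branch; $\operatorname{Re}\rho(z,w)>0$ on $T_B\times T_B$) be the weighted Bergman kernel of $T_B$. Let $\beta(z,w)$ be the Bergman distance on $T_B$, i.e. the infimum of $\int_0^1\langle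 \mathbf B(\gamma)\gamma',\gamma'\rangle^{1/2}dt$ over the smooth curves $\gamma:[0,1]\to T_B$ from $z$ to $w$, where $\mathbf B(z)=\frac1{n+1}\big(\partial^2\ln K_0(z,z)/\partial\bar z_i\partial z_j\big)_{i,j}$, and let $D(z,r)=\{w\in T_B:\beta(z,w)<r\}$. For a positive Borel measure $\mu$ on $T_B$ and $z\in T_B$ put $$\tilde\mu(z)=\int_{T_B}\frac{|K_\alpha(z,w)|^2}{K_\alpha(z,z)}\,d\mu(w),\qquad \hat\mu_r(z)=\frac{\mu(D(z,r))}{V_\alpha(D(z,r))},\qquad T_\mu f(z)=\int_{T_B}K_\alpha(z,w)f(w)\,d\mu(w).$$ The Toeplitz operator $T_\mu$ has as its domain in $A^p_\alpha(T_B)$ the set of all $f\in A^p_\alpha(T_B)$ for which the last integral converges absolutely for every $z\in T_B$. We say that $T_\mu$ is bounded on $A^p_\alpha(T_B)$ if this domain is dense in $A^p_\alpha(T_B)$ and there is a constant $C>0$ such that $T_\mu f\in A^p_\alpha(T_B)$ and $\|T_\mu f\|_{p,\alpha}\le C\|f\|_{p,\alpha}$ for all $f$ in the domain. We say that $\mu$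 is a Carleson measure for $A^q_\alpha(T_B)$ if there is $C>0$ with $\int_{T_B}|f|^q\,d\mu\le C\|f\|_{q,\alpha}^q$ for all $f\in A^q_\alpha(T_B)$. **Theorem.** Let $r>0$, $1<p<\infty$, $0<q<\infty$, $\alpha>-1$, and let $\mu$ be a positive Borel measure on $T_B$ with $\int_{T_B}|\rho(z,\mathbf i)|^{-t}\,d\mu(z)<\infty$ for some $t>0$. Then the following conditions are equivalent: 1. $T_\mu$ is bounded on $A^p_\alpha(T_B)$; 2. $\tilde\mu$ is a bounded function on $T_B$; 3. $\hat\mu_r$ is a bounded function on $T_B$; 4. $\mu$ is a Carleson measure for $A^q_\alpha(T_B)$. -/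

import Mathlib

open MeasureTheory
open scoped ENNReal Matrix

noncomputable section

namespace TubeBergman

/-- The space `ℂⁿ` with `n = d + 1`. A point is `z = (z', zₙ)`, where `z' = (z (castSucc i))_i` has
`d = n - 1` coordinates and `zₙ = z (last d)`. -/
abbrev CSpace (d : ℕ) : Type := Fin (d + 1) → ℂ

/-- The paraboloid base `B = {(y', yₙ) ∈ ℝⁿ : |y'|² < yₙ}`. -/
def base (d : ℕ) : Set (Fin (d + 1) → ℝ) :=
  {y | ∑ i : Fin d, y i.castSucc ^ 2 < y (Fin.last d)}

/-- The tube domain `T_B = ℝⁿ + i B`. -/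
def tube (d : ℕ) : Set (CSpace d) :=
  {z | (fun i => (z i).im) ∈ base d}

/-- `ρ(z) = yₙ - |y'|²`, where `y = Im z`. -/
def rho {d : ℕ} (z : CSpace d) : ℝ :=
  (z (Fin.last d)).im - ∑ i : Fin d, (z i.castSucc).im ^ 2

/-- `ρ(z, w) = ((z' - conj w')² - 2i (zₙ - conj wₙ)) / 4`. Its real part is positive on
`T_B × T_B`. -/
def rhoPair {d : ℕ} (z w : CSpace d) : ℂ :=
  (1 / 4) * (∑ i : Fin d, (z i.castSucc - star (w i.castSucc)) ^ 2
    - 2 * Complex.I * (z (Fin.last d) - star (w (Fin.last d))))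

/-- The base point `𝐢 = (0', i)`. -/
def basePoint (d : ℕ) : CSpace d :=
  Pi.single (Fin.last d) Complex.I

/-- The weighted Bergman kernel
`K_α(z, w) = Γ(n + α + 1) / (2ⁿ⁺¹ πⁿ Γ(α + 1) ρ(z, w)^(n + α + 1))` with `n = d + 1`
(principal branch of the power). -/
def bergmanKernel {d : ℕ} (α : ℝ) (z w : CSpace d) : ℂ :=
  ((Real.Gamma ((d + 1 : ℕ) + α + 1) /
      (2 ^ (d + 2) * Real.pi ^ (d + 1) * Real.Gamma (α + 1)) : ℝ) : ℂ) /
    rhoPair z w ^ ((((d + 1 : ℕ) + α + 1 : ℝ)) : ℂ)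

/-- The measure `dV_α(z) = ρ(z)^α dV(z)` on `T_B`, with `V` the Lebesgue measure of `ℂⁿ`. -/
def weightedVolume (d : ℕ) (α : ℝ) : Measure (CSpace d) :=
  (volume.restrict (tube d)).withDensity fun z => ENNReal.ofReal (rho z ^ α)

/-- The (quasi-)norm `‖f‖_{p,α} = (∫_{T_B} |f|^p dV_α)^{1/p}`. -/
def bergmanNorm {d : ℕ} (α p : ℝ) (f : CSpace d → ℂ) : ℝ≥0∞ :=
  eLpNorm f (ENNReal.ofReal p) (weightedVolume d α)

/-- The weighted Bergman space `A^p_α(T_B)`: functions holomorphic in `T_B` and in `L^p(V_α)`.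
Values outside `T_B` are irrelevant. -/
def bergmanSpace (d : ℕ) (α p : ℝ) : Set (CSpace d → ℂ) :=
  {f | DifferentiableOn ℂ f (tube d) ∧ MemLp f (ENNReal.ofReal p) (weightedVolume d α)}

/-! Bergman metric -/

/-- The Wirtinger derivative `∂g/∂z_j`. -/
def dz {d : ℕ} (j : Fin (d + 1)) (g : CSpace d → ℂ) (z : CSpace d) : ℂ :=
  (1 / 2) * (fderiv ℝ g z (Pi.single j 1) - Complex.I * fderiv ℝ g z (Pi.single j Complex.I))

/-- The Wirtinger derivative `∂g/∂(conj z_j)`. -/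
def dzbar {d : ℕ} (j : Fin (d + 1)) (g : CSpace d → ℂ) (z : CSpace d) : ℂ :=
  (1 / 2) * (fderiv ℝ g z (Pi.single j 1) + Complex.I * fderiv ℝ g z (Pi.single j Complex.I))

/-- The Bergman matrix `b_{ij}(z) = (n + 1)⁻¹ ∂²/∂(conj z_i)∂z_j log K(z, z)`, where `K` is the
unweighted Bergman kernel of `T_B` (which is positive on the diagonal) and `n = d + 1`. -/
def bergmanMatrix {d : ℕ} (z : CSpace d) : Matrix (Fin (d + 1)) (Fin (d + 1)) ℂ :=
  Matrix.of fun i j =>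
    (1 / ((d : ℂ) + 2)) *
      dzbar i (dz j fun ζ => ((Real.log (bergmanKernel 0 ζ ζ).re : ℝ) : ℂ)) z

/-- The Bergman length `∫₀¹ ⟨B(γ) γ', γ'⟩^{1/2} dt` of a curve. -/
def curveLength {d : ℕ} (γ : ℝ → CSpace d) : ℝ :=
  ∫ t in (0 : ℝ)..1,
    Real.sqrt (star (derivWithin γ (Set.Icc 0 1) t) ⬝ᵥ
      (bergmanMatrix (γ t) *ᵥ derivWithin γ (Set.Icc 0 1) t)).re

/-- The Bergman distance `β(z, w)`: the infimum of the lengths of the smooth curves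
`γ : [0, 1] → T_B` from `z` to `w`. -/
def bergmanDist {d : ℕ} (z w : CSpace d) : ℝ :=
  sInf {l | ∃ γ : ℝ → CSpace d, ContDiffOn ℝ (⊤ : ℕ∞) γ (Set.Icc 0 1) ∧
    (∀ t ∈ Set.Icc (0 : ℝ) 1, γ t ∈ tube d) ∧ γ 0 = z ∧ γ 1 = w ∧ l = curveLength γ}

/-- The Bergman ball `D(z, r)`. -/
def bergmanBall {d : ℕ} (z : CSpace d) (r : ℝ) : Set (CSpace d) :=
  {w | w ∈ tube d ∧ bergmanDist z w < r}

/-! Measures on `T_B` and Toeplitz operators. A positive Borel measure on `T_B` is given as the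
restriction to `T_B` of a measure `μ` on `ℂⁿ`. -/

/-- The class `M₊`: `∫_{T_B} |ρ(z, 𝐢)|^{-t} dμ(z) < ∞` for some `t > 0`. -/
def MPlus {d : ℕ} (μ : Measure (CSpace d)) : Prop :=
  ∃ t : ℝ, 0 < t ∧
    ∫⁻ z in tube d, ENNReal.ofReal (‖rhoPair z (basePoint d)‖ ^ (-t)) ∂μ < ∞

/-- The normalized kernel `k_z(w) = K_α(z, w) / √K_α(z, z)`. -/
def normalizedKernel {d : ℕ} (α : ℝ) (z w : CSpace d) : ℂ :=
  bergmanKernel α z w / (Real.sqrt (bergmanKernel α z z).re : ℂ)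

/-- The Berezin transform `μ̃(z) = ∫_{T_B} |k_z(w)|² dμ(w)`, a priori with values in `[0, ∞]`. -/
def berezin {d : ℕ} (α : ℝ) (μ : Measure (CSpace d)) (z : CSpace d) : ℝ≥0∞ :=
  ∫⁻ w in tube d, ‖normalizedKernel α z w‖ₑ ^ 2 ∂μ

/-- The averaging function `μ̂_r(z) = μ(D(z, r)) / V_α(D(z, r))`, a priori with values
in `[0, ∞]`. -/
def averaging {d : ℕ} (α r : ℝ) (μ : Measure (CSpace d)) (z : CSpace d) : ℝ≥0∞ :=
  μ (bergmanBall z r) / weightedVolume d α (bergmanBall z r)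

/-- A `[0, ∞]`-valued function is bounded on `T_B`: it has a finite upper bound there. -/
def BoundedOnTube {d : ℕ} (g : CSpace d → ℝ≥0∞) : Prop :=
  ∃ C : ℝ, 0 < C ∧ ∀ z ∈ tube d, g z ≤ ENNReal.ofReal C

/-- `μ` is a Carleson measure for `A^q_α(T_B)`:
`∫_{T_B} |f|^q dμ ≤ C ‖f‖_{q,α}^q` for all `f` in this space. -/
def IsCarleson {d : ℕ} (α q : ℝ) (μ : Measure (CSpace d)) : Prop :=
  ∃ C : ℝ, 0 < C ∧ ∀ f ∈ bergmanSpace d α q,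
    ∫⁻ z in tube d, ‖f z‖ₑ ^ q ∂μ ≤ ENNReal.ofReal C * bergmanNorm α q f ^ q

/-- The Toeplitz operator `T_μ f(z) = ∫_{T_B} K_α(z, w) f(w) dμ(w)`. -/
def toeplitz {d : ℕ} (α : ℝ) (μ : Measure (CSpace d)) (f : CSpace d → ℂ) (z : CSpace d) : ℂ :=
  ∫ w in tube d, bergmanKernel α z w * f w ∂μ

/-- The domain of `T_μ` in `A^p_α(T_B)`: those `f` for which the integral defining `T_μ f(z)`
converges absolutely for every `z ∈ T_B`. -/
def toeplitzDomain {d : ℕ} (α p : ℝ) (μ : Measure (CSpace d)) : Set (CSpace d → ℂ) :=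
  {f | f ∈ bergmanSpace d α p ∧
    ∀ z ∈ tube d, IntegrableOn (fun w => bergmanKernel α z w * f w) (tube d) μ}

/-- `T_μ` is bounded on `A^p_α(T_B)`: it is densely defined, maps its domain into `A^p_α(T_B)`, and
`‖T_μ f‖_{p,α} ≤ C ‖f‖_{p,α}` there. (Hence it has a unique extension to a bounded operator on
the whole space.) -/
def ToeplitzBounded {d : ℕ} (α p : ℝ) (μ : Measure (CSpace d)) : Prop :=
  (∀ f ∈ bergmanSpace d α p, ∀ ε : ℝ, 0 < ε →
    ∃ g ∈ toeplitzDomain α p μ, bergmanNorm α p (f - g) < ENNReal.ofReal ε) ∧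
  ∃ C : ℝ, 0 < C ∧ ∀ f ∈ toeplitzDomain α p μ,
    toeplitz α μ f ∈ bergmanSpace d α p ∧
    bergmanNorm α p (toeplitz α μ f) ≤ ENNReal.ofReal C * bergmanNorm α p f

end TubeBergman

end

namespace TubeBergman

variable {d : ℕ}

/-! Put `L = n + α + 1`, that is `α + d + 2`. All quantities are powers of |ρ(z,w)|: |K_α(z,w)| is a
constant times |ρ(z,w)|^(-L), and V_α(D(z,r)) is comparable to ρ(z)^L. So condition 3 means
μ(D(z,r)) ≲ ρ(z)^L, uniformly in z.

Three tools carry the proof. The Forelli–Rudin estimate `exists_lintegral_rho_rpow_mul_le`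
integrates powers of ρ(w) and |ρ(z,w)|. The Bergman ball is sandwiched between an explicit affine
polydisc `cell z ε` and the set where |ρ(z,w)| ≤ e^(3r) ρ(z) (`exists_cell_subset_bergmanBall`,
`norm_rhoPair_le_of_mem_bergmanBall`); no finer knowledge of the metric is needed. Finally |f|^q has
the sub-mean value property over cells, for every q > 0 (`exists_enorm_rpow_le_lintegral_cell`).

For 3 → 4, integrate the sub-mean value inequality against μ and exchange the integrals: no covering
by a lattice is needed. For 4 → 2, test on ρ(·,z)^(-2L/q), whose q-th power has the size of the
Berezin integrand. For 2 → 3, apply Chebyshev's inequality on the ball. For 3 → 1, use the Carleson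
property with exponent 1 on K_α(z,w) f(w), up to conjugations a product of holomorphic functions: it
replaces μ by V_α, and the positive Bergman operator is bounded on L^p by Schur's test.

In 1 → 3 the reproducing kernel itself may fail to be μ-integrable, because `MPlus` gives only some
decay exponent t. The test function is therefore ρ(·,z)^(-m) with m = L + k and k ≥ t. The exponent
mismatch with the kernel is repaired by a k-fold derivative of T_μ f in the last coordinate at z,
taken as a Cauchy integral: it turns ρ(z,w)^(-L) into a multiple of ρ(z,w)^(-m), so that ∫
|ρ(z,w)|^(-2m) dμ(w) appears and is bounded by point evaluation in A^p_α. -/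

/-! ### The function ρ(z,w) and the geometry of the tube. -/

theorem mem_tube_iff {z : CSpace d} : z ∈ tube d ↔ 0 < rho z := by
  simp [tube, base, rho, sub_pos]

theorem continuous_rho : Continuous (rho : CSpace d → ℝ) := by
  unfold rho
  fun_prop

theorem isOpen_tube : IsOpen (tube d) := by
  have : tube d = rho ⁻¹' Set.Ioi 0 := by
    ext z
    simp [mem_tube_iff]
  rw [this]
  exact isOpen_Ioi.preimage continuous_rho

theorem measurableSet_tube : MeasurableSet (tube d) := isOpen_tube.measurableSet

theorem continuous_rhoPair :
    Continuous (fun p : CSpace d × CSpace d => rhoPair p.1 p.2) := by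
  unfold rhoPair
  fun_prop

theorem continuous_rhoPair_left (w : CSpace d) : Continuous fun z => rhoPair z w := by
  unfold rhoPair
  fun_prop

theorem continuous_rhoPair_right (z : CSpace d) : Continuous fun w => rhoPair z w := by
  unfold rhoPair
  fun_prop

/-- Source of every lower bound for |ρ(z,w)|: three nonnegative terms on the tube. It rests on Re (a
- b̄)² = |a - b|² - 2 (Im a)² - 2 (Im b)². -/
theorem rhoPair_re (z w : CSpace d) :
    (rhoPair z w).re =
      (∑ i : Fin d, ‖z i.castSucc - w i.castSucc‖ ^ 2 + 2 * rho z + 2 * rho w) / 4 := by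
  have key : (∑ i : Fin d, (z i.castSucc - star (w i.castSucc)) ^ 2).re =
      ∑ i : Fin d, ‖z i.castSucc - w i.castSucc‖ ^ 2 - 2 * ∑ i : Fin d, (z i.castSucc).im ^ 2
        - 2 * ∑ i : Fin d, (w i.castSucc).im ^ 2 := by
    rw [Complex.re_sum, Finset.mul_sum, Finset.mul_sum, ← Finset.sum_sub_distrib,
      ← Finset.sum_sub_distrib]
    refine Finset.sum_congr rfl fun i _ => ?_
    rw [← Complex.normSq_eq_norm_sq, Complex.normSq_apply]
    simp [pow_two]
    ring
  have h4 : (1 / 4 : ℂ) = ((1 / 4 : ℝ) : ℂ) := by norm_num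
  rw [rhoPair, h4, Complex.re_ofReal_mul, Complex.sub_re, key]
  simp [rho]
  ring

theorem rhoPair_im (z w : CSpace d) :
    (rhoPair z w).im =
      ((∑ i : Fin d, (z i.castSucc - star (w i.castSucc)) ^ 2).im -
        2 * ((z (Fin.last d)).re - (w (Fin.last d)).re)) / 4 := by
  have h4 : (1 / 4 : ℂ) = ((1 / 4 : ℝ) : ℂ) := by norm_num
  rw [rhoPair, h4, Complex.im_ofReal_mul, Complex.sub_im]
  simp
  ring

theorem conj_rhoPair (z w : CSpace d) : (starRingEnd ℂ) (rhoPair z w) = rhoPair w z := by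
  simp only [rhoPair, map_mul, map_sub, map_sum, map_pow]
  congr 1
  · simp [map_ofNat]
  · congr 1
    · refine Finset.sum_congr rfl fun i _ => ?_
      simp
      ring
    · simp [map_ofNat]
      ring

theorem norm_rhoPair_comm (z w : CSpace d) : ‖rhoPair z w‖ = ‖rhoPair w z‖ := by
  rw [← conj_rhoPair, Complex.norm_conj]

theorem rhoPair_self (z : CSpace d) : rhoPair z z = (rho z : ℂ) := by
  apply Complex.ext
  · rw [rhoPair_re]
    simp
    ring
  · have h := congrArg Complex.im (conj_rhoPair z z)
    simp only [Complex.conj_im] at h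
    rw [Complex.ofReal_im]
    linarith

theorem rhoPair_re_pos {z w : CSpace d} (hz : z ∈ tube d) (hw : w ∈ tube d) :
    0 < (rhoPair z w).re := by
  rw [rhoPair_re]
  rw [mem_tube_iff] at hz hw
  have : 0 ≤ ∑ i : Fin d, ‖z i.castSucc - w i.castSucc‖ ^ 2 :=
    Finset.sum_nonneg fun _ _ => by positivity
  linarith

theorem rhoPair_ne_zero {z w : CSpace d} (hz : z ∈ tube d) (hw : w ∈ tube d) :
    rhoPair z w ≠ 0 := fun h => by
  simpa [h] using rhoPair_re_pos hz hw

theorem norm_rhoPair_pos {z w : CSpace d} (hz : z ∈ tube d) (hw : w ∈ tube d) :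
    0 < ‖rhoPair z w‖ := norm_pos_iff.2 (rhoPair_ne_zero hz hw)

theorem rhoPair_mem_slitPlane {z w : CSpace d} (hz : z ∈ tube d) (hw : w ∈ tube d) :
    rhoPair z w ∈ Complex.slitPlane := Or.inl (rhoPair_re_pos hz hw)

theorem rho_add_rho_le (z w : CSpace d) : rho z + rho w ≤ 2 * ‖rhoPair z w‖ := by
  have h := Complex.re_le_norm (rhoPair z w)
  rw [rhoPair_re] at h
  have : 0 ≤ ∑ i : Fin d, ‖z i.castSucc - w i.castSucc‖ ^ 2 :=
    Finset.sum_nonneg fun _ _ => by positivity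
  linarith

theorem rho_le_left {z w : CSpace d} (hw : w ∈ tube d) : rho z ≤ 2 * ‖rhoPair z w‖ := by
  have := rho_add_rho_le z w
  rw [mem_tube_iff] at hw
  linarith

theorem sum_add_rho_le {z w : CSpace d} (hw : w ∈ tube d) :
    ∑ i : Fin d, ‖z i.castSucc - w i.castSucc‖ ^ 2 + 2 * rho z ≤ 4 * ‖rhoPair z w‖ := by
  have h := Complex.re_le_norm (rhoPair z w)
  rw [rhoPair_re] at h
  rw [mem_tube_iff] at hw
  linarith

theorem sq_add_rho_le {z w : CSpace d} (hw : w ∈ tube d) (i : Fin d) :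
    ‖z i.castSucc - w i.castSucc‖ ^ 2 + 2 * rho z ≤ 4 * ‖rhoPair z w‖ := by
  have h := sum_add_rho_le (z := z) hw
  have := Finset.single_le_sum (f := fun i : Fin d => ‖z i.castSucc - w i.castSucc‖ ^ 2)
    (fun _ _ => by positivity) (Finset.mem_univ i)
  linarith

/-- The base is the strict epigraph of a convex function. Convexity makes segments admissible curves
for the Bergman distance. -/
theorem convex_tube : Convex ℝ (tube d) := by
  intro z hz w hw a b ha hb hab
  simp only [tube, base, Set.mem_ofPred_eq] at *
  simp only [Pi.add_apply, Pi.smul_apply, Complex.add_im, Complex.smul_im, smul_eq_mul]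
  have h1 : ∑ i : Fin d, (a * (z i.castSucc).im + b * (w i.castSucc).im) ^ 2 ≤
      a * ∑ i : Fin d, (z i.castSucc).im ^ 2 + b * ∑ i : Fin d, (w i.castSucc).im ^ 2 := by
    rw [Finset.mul_sum, Finset.mul_sum, ← Finset.sum_add_distrib]
    refine Finset.sum_le_sum fun i _ => ?_
    obtain rfl : b = 1 - a := by linarith
    nlinarith [mul_nonneg (mul_nonneg ha hb) (sq_nonneg ((z i.castSucc).im - (w i.castSucc).im))]
  rcases ha.eq_or_lt with rfl | ha'
  · have : b = 1 := by linarith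
    subst this
    simpa using hw
  · nlinarith [mul_lt_mul_of_pos_left hz ha', mul_le_mul_of_nonneg_left hw.le hb]

theorem basePoint_mem : basePoint d ∈ tube d := by
  rw [mem_tube_iff]
  simp [rho, basePoint, Fin.castSucc_ne_last]

/-- Near a fixed point the function `ρ(·, w)` varies slowly compared with its size, uniformly in
`w`. -/
theorem exists_norm_rhoPair_sub_le {z₀ : CSpace d} (hz₀ : z₀ ∈ tube d) :
    ∃ C : ℝ, 0 < C ∧ ∀ z : CSpace d, ∀ w ∈ tube d,
      1 ≤ C * ‖rhoPair z₀ w‖ ∧ ∀ i : Fin d, ‖z i.castSucc - star (w i.castSucc)‖ ≤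
        ‖z - z₀‖ + C * ‖rhoPair z₀ w‖ := by
  have hr : 0 < rho z₀ := mem_tube_iff.1 hz₀
  -- `c` collects the bounded terms. Since ρ(z₀) ≤ 2 |ρ(z₀,w)|, a constant is at most a multiple of
  -- |ρ(z₀,w)|, which gives the second summand of `C`.
  set c : ℝ := 1 + 2 * ‖z₀‖ with hc
  have hc1 : 1 ≤ c := by
    have := norm_nonneg z₀
    linarith
  set C : ℝ := 6 + 2 * (2 + c) / rho z₀ with hC
  refine ⟨C, by positivity, fun z w hw => ?_⟩
  have h2 := rho_le_left (z := z₀) hw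
  set N := ‖rhoPair z₀ w‖
  have hN : 0 ≤ N := norm_nonneg _
  have h3 : 2 + c ≤ 2 * (2 + c) / rho z₀ * N := by
    rw [div_mul_eq_mul_div, le_div_iff₀ hr]
    nlinarith
  have h10 : C * N = 6 * N + 2 * (2 + c) / rho z₀ * N := by rw [hC]; ring
  rw [h10]
  refine ⟨by linarith, fun i => ?_⟩
  have h1 := sq_add_rho_le (z := z₀) hw i
  have h4 : z i.castSucc - star (w i.castSucc) = (z i.castSucc - z₀ i.castSucc)
      + (z₀ i.castSucc - star (z₀ i.castSucc)) + star (z₀ i.castSucc - w i.castSucc) := by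
    simp
  have h5 : ‖z i.castSucc - z₀ i.castSucc‖ ≤ ‖z - z₀‖ := norm_le_pi_norm (z - z₀) i.castSucc
  have h6 : ‖z₀ i.castSucc‖ ≤ ‖z₀‖ := norm_le_pi_norm z₀ i.castSucc
  have h7 : ‖z₀ i.castSucc - star (z₀ i.castSucc)‖ ≤ 2 * ‖z₀‖ := by
    refine (norm_sub_le _ _).trans ?_
    rw [norm_star]
    linarith
  have h8 : ‖z i.castSucc - star (w i.castSucc)‖ ≤
      ‖z - z₀‖ + 2 * ‖z₀‖ + ‖z₀ i.castSucc - w i.castSucc‖ := by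
    rw [h4]
    refine (norm_add₃_le).trans ?_
    rw [norm_star]
    linarith
  have h9 : ‖z₀ i.castSucc - w i.castSucc‖ ≤ 1 + 4 * N := by
    nlinarith [sq_nonneg (‖z₀ i.castSucc - w i.castSucc‖ - 1)]
  linarith

/-! ### One-variable integrals and the Forelli–Rudin estimate. -/

theorem lintegral_fin_prod_eq_prod {n : ℕ} (g : Fin n → ℂ → ℝ≥0∞) (hg : ∀ i, Measurable (g i)) :
    ∫⁻ x : Fin n → ℂ, ∏ i, g i (x i) = ∏ i, ∫⁻ ζ, g i ζ := by
  induction n with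
  | zero => simp [volume_pi]
  | succ n ih =>
    have hm := (volume_preserving_piFinSuccAbove (fun _ : Fin (n + 1) => ℂ) 0).symm
    have hmeas : Measurable fun x : Fin (n + 1) → ℂ => ∏ i, g i (x i) :=
      Finset.measurable_prod _ fun i _ => (hg i).comp (measurable_pi_apply i)
    have hmeas' : Measurable fun x : Fin n → ℂ => ∏ i, g (Fin.succ i) (x i) :=
      Finset.measurable_prod _ fun i _ => (hg _).comp (measurable_pi_apply i)
    rw [← hm.lintegral_comp hmeas, Fin.prod_univ_succ, ← ih _ fun i => hg _,
      ← lintegral_prod_mul (hg 0).aemeasurable hmeas'.aemeasurable]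
    refine lintegral_congr fun p => ?_
    simp [MeasurableEquiv.piFinSuccAbove_symm_apply, Fin.insertNthEquiv, Fin.prod_univ_succ]

/-- Tonelli's theorem on `ℂᵈ⁺¹` for a product whose last factor is sheared by a function of the
first `d` coordinates. -/
theorem lintegral_shear_prod {d : ℕ} (g : Fin d → ℂ → ℝ≥0∞) (hg : ∀ i, Measurable (g i))
    (g' : ℂ → ℝ≥0∞) (hg' : Measurable g') (h : (Fin d → ℂ) → ℂ) (hh : Measurable h) :
    ∫⁻ w : CSpace d, (∏ i : Fin d, g i (w i.castSucc)) *
        g' (w (Fin.last d) + h fun i => w i.castSucc) =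
      (∏ i, ∫⁻ ζ, g i ζ) * ∫⁻ ζ, g' ζ := by
  have hm := (volume_preserving_piFinSuccAbove (fun _ : Fin (d + 1) => ℂ) (Fin.last d)).symm
  have hmeas' : Measurable fun x : Fin d → ℂ => ∏ i, g i (x i) :=
    Finset.measurable_prod _ fun i _ => (hg _).comp (measurable_pi_apply i)
  have hmeas : Measurable fun w : CSpace d => (∏ i : Fin d, g i (w i.castSucc)) *
      g' (w (Fin.last d) + h fun i => w i.castSucc) := by
    refine Measurable.mul ?_ ?_
    · exact Finset.measurable_prod _ fun i _ => (hg _).comp (measurable_pi_apply _)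
    · fun_prop
  rw [← hm.lintegral_comp hmeas]
  have : ∀ p : ℂ × (Fin d → ℂ),
      (∏ i : Fin d, g i ((MeasurableEquiv.piFinSuccAbove (fun _ : Fin (d + 1) => ℂ)
        (Fin.last d)).symm p i.castSucc)) *
      g' ((MeasurableEquiv.piFinSuccAbove (fun _ : Fin (d + 1) => ℂ)
        (Fin.last d)).symm p (Fin.last d) + h fun i =>
        (MeasurableEquiv.piFinSuccAbove (fun _ : Fin (d + 1) => ℂ)
        (Fin.last d)).symm p i.castSucc) = (∏ i, g i (p.2 i)) * g' (p.1 + h p.2) := by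
    intro p
    simp [MeasurableEquiv.piFinSuccAbove_symm_apply, Fin.insertNthEquiv]
  simp_rw [this]
  change ∫⁻ p, _ ∂((volume : Measure ℂ).prod (volume : Measure (Fin d → ℂ))) = _
  rw [lintegral_prod_symm _ (by fun_prop), ← lintegral_fin_prod_eq_prod g hg,
    ← lintegral_mul_const _ hmeas']
  refine lintegral_congr fun x => ?_
  dsimp only
  rw [lintegral_const_mul _ (by fun_prop)]
  congr 1
  -- With the first `d` coordinates frozen, the shear is a translation of the last one.
  exact lintegral_add_right_eq_self (fun ζ => g' ζ) (h x)

theorem lintegral_comp_inv_smul {E : Type*} [NormedAddCommGroup E] [NormedSpace ℝ E]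
    [MeasurableSpace E] [BorelSpace E] [FiniteDimensional ℝ E] (μ : Measure E)
    [μ.IsAddHaarMeasure] (f : E → ℝ≥0∞) (hf : Measurable f) {R : ℝ} (hR : 0 < R) :
    ∫⁻ x, f (R⁻¹ • x) ∂μ = ENNReal.ofReal (R ^ Module.finrank ℝ E) * ∫⁻ x, f x ∂μ := by
  have h := Measure.map_addHaar_smul μ (inv_ne_zero hR.ne')
  have h2 : ∫⁻ x, f (R⁻¹ • x) ∂μ = ∫⁻ x, f x ∂(μ.map (R⁻¹ • ·)) :=
    (lintegral_map hf (measurable_const_smul _)).symm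
  rw [h2, h, lintegral_smul_measure, smul_eq_mul]
  congr 2
  rw [inv_pow, inv_inv, abs_of_pos (by positivity)]

/-- Homogeneity: the substitution x ↦ A x extracts the power of `A` and leaves the convergent
integral with `A = 1`, whose value is the constant. The two scaling lemmas below work alike, with √A
in place of `A` on ℂ. -/
theorem exists_lintegral_add_abs_rpow_le {a : ℝ} (ha : 1 < a) :
    ∃ C : ℝ, 0 ≤ C ∧ ∀ A : ℝ, 0 < A →
      ∫⁻ x : ℝ, ENNReal.ofReal ((A + |x|) ^ (-a)) ≤ ENNReal.ofReal (C * A ^ (1 - a)) := by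
  have hfin : ∫⁻ x : ℝ, ENNReal.ofReal ((1 + |x|) ^ (-a)) < ∞ :=
    finite_integral_one_add_norm (by simpa using ha)
  refine ⟨(∫⁻ x : ℝ, ENNReal.ofReal ((1 + |x|) ^ (-a))).toReal, ENNReal.toReal_nonneg,
    fun A hA => le_of_eq ?_⟩
  have h1 : ∀ x : ℝ, ENNReal.ofReal ((A + |x|) ^ (-a)) =
      ENNReal.ofReal (A ^ (-a)) * ENNReal.ofReal ((1 + |A⁻¹ • x|) ^ (-a)) := by
    intro x
    rw [← ENNReal.ofReal_mul (by positivity), ← Real.mul_rpow hA.le (by positivity)]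
    congr 2
    rw [smul_eq_mul, abs_mul, abs_of_pos (inv_pos.2 hA)]
    field_simp
  simp_rw [h1]
  rw [lintegral_const_mul _ (by fun_prop),
    lintegral_comp_inv_smul volume (fun x : ℝ => ENNReal.ofReal ((1 + |x|) ^ (-a)))
      (by fun_prop) hA]
  conv_lhs => rw [← ENNReal.ofReal_toReal hfin.ne]
  rw [← ENNReal.ofReal_mul (by positivity), ← ENNReal.ofReal_mul (by positivity)]
  congr 1
  rw [sub_eq_add_neg, Real.rpow_add hA, Real.rpow_one]
  simp
  ring

theorem exists_lintegral_add_norm_sq_rpow_le {c : ℝ} (hc : 1 < c) :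
    ∃ C : ℝ, 0 ≤ C ∧ ∀ A : ℝ, 0 < A → ∀ z : ℂ,
      ∫⁻ ζ : ℂ, ENNReal.ofReal ((A + ‖z - ζ‖ ^ 2) ^ (-c)) ≤ ENNReal.ofReal (C * A ^ (1 - c)) := by
  have hfin : ∫⁻ ζ : ℂ, ENNReal.ofReal ((1 + ‖ζ‖ ^ 2) ^ (-c)) < ∞ := by
    have h := integrable_rpow_neg_one_add_norm_sq (E := ℂ) (μ := volume) (r := 2 * c)
      (by simp [Complex.finrank_real_complex]; linarith)
    have h2 := h.lintegral_lt_top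
    refine lt_of_le_of_lt (le_of_eq ?_) h2
    refine lintegral_congr fun ζ => ?_
    congr 2
    ring
  refine ⟨(∫⁻ ζ : ℂ, ENNReal.ofReal ((1 + ‖ζ‖ ^ 2) ^ (-c))).toReal, ENNReal.toReal_nonneg,
    fun A hA z => le_of_eq ?_⟩
  have h0 : ∫⁻ ζ : ℂ, ENNReal.ofReal ((A + ‖z - ζ‖ ^ 2) ^ (-c)) =
      ∫⁻ ζ : ℂ, ENNReal.ofReal ((A + ‖ζ‖ ^ 2) ^ (-c)) :=
    lintegral_sub_left_eq_self (fun ζ : ℂ => ENNReal.ofReal ((A + ‖ζ‖ ^ 2) ^ (-c))) z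
  have h1 : ∀ ζ : ℂ, ENNReal.ofReal ((A + ‖ζ‖ ^ 2) ^ (-c)) =
      ENNReal.ofReal (A ^ (-c)) * ENNReal.ofReal ((1 + ‖(√A)⁻¹ • ζ‖ ^ 2) ^ (-c)) := by
    intro ζ
    rw [← ENNReal.ofReal_mul (by positivity), ← Real.mul_rpow hA.le (by positivity)]
    congr 2
    rw [norm_smul, mul_pow, norm_inv, inv_pow, Real.norm_of_nonneg (Real.sqrt_nonneg _),
      Real.sq_sqrt hA.le]
    field_simp
  rw [h0]
  simp_rw [h1]
  rw [lintegral_const_mul _ (by fun_prop),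
    lintegral_comp_inv_smul volume (fun x : ℂ => ENNReal.ofReal ((1 + ‖x‖ ^ 2) ^ (-c)))
      (by fun_prop) (Real.sqrt_pos.2 hA)]
  conv_lhs => rw [← ENNReal.ofReal_toReal hfin.ne]
  rw [← ENNReal.ofReal_mul (by positivity), ← ENNReal.ofReal_mul (by positivity)]
  congr 1
  rw [sub_eq_add_neg, Real.rpow_add hA, Real.rpow_one, Complex.finrank_real_complex,
    Real.sq_sqrt hA.le]
  ring

/-- Near 0 the integrand is of order y^t with t > -1; near infinity it is at most y^(t-b) with t - b
< -1. -/
theorem integrableOn_rpow_mul_one_add_rpow {t b : ℝ} (ht : -1 < t) (hb : t + 1 < b) :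
    IntegrableOn (fun y : ℝ => y ^ t * (1 + y) ^ (-b)) (Set.Ioi 0) := by
  rw [← Set.Ioc_union_Ioi_eq_Ioi zero_le_one]
  have hmeas : Measurable fun y : ℝ => y ^ t * (1 + y) ^ (-b) := by fun_prop
  refine IntegrableOn.union ?_ ?_
  · have h1 : IntegrableOn (fun y : ℝ => y ^ t) (Set.Ioc 0 1) :=
      (intervalIntegrable_iff_integrableOn_Ioc_of_le zero_le_one).1
        (intervalIntegral.intervalIntegrable_rpow' ht)
    refine (h1.const_mul ((2 : ℝ) ^ |b|)).mono' hmeas.aestronglyMeasurable ?_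
    refine (ae_restrict_iff' measurableSet_Ioc).2 (ae_of_all _ fun y hy => ?_)
    have hy0 : 0 < y := hy.1
    rw [Real.norm_of_nonneg (by positivity), mul_comm]
    refine mul_le_mul_of_nonneg_right ?_ (by positivity)
    calc (1 + y) ^ (-b) ≤ (1 + y) ^ |b| :=
          Real.rpow_le_rpow_of_exponent_le (by linarith) (neg_le_abs b)
      _ ≤ 2 ^ |b| := Real.rpow_le_rpow (by positivity) (by linarith [hy.2]) (abs_nonneg b)
  · have h1 : IntegrableOn (fun y : ℝ => y ^ (t - b)) (Set.Ioi 1) :=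
      integrableOn_Ioi_rpow_of_lt (by linarith) one_pos
    refine h1.mono' hmeas.aestronglyMeasurable ?_
    refine (ae_restrict_iff' measurableSet_Ioi).2 (ae_of_all _ fun y hy => ?_)
    have hy0 : 0 < y := zero_lt_one.trans hy
    rw [Real.norm_of_nonneg (by positivity), sub_eq_add_neg, Real.rpow_add hy0]
    refine mul_le_mul_of_nonneg_left ?_ (by positivity)
    exact Real.rpow_le_rpow_of_nonpos hy0 (by linarith) (by linarith)

theorem exists_lintegral_Ioi_rpow_mul_add_rpow_le {t b : ℝ} (ht : -1 < t) (hb : t + 1 < b) :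
    ∃ C : ℝ, 0 ≤ C ∧ ∀ A : ℝ, 0 < A →
      ∫⁻ y : ℝ, (Set.Ioi (0 : ℝ)).indicator
          (fun y => ENNReal.ofReal (y ^ t * (A + y) ^ (-b))) y ≤
        ENNReal.ofReal (C * A ^ (t + 1 - b)) := by
  set F : ℝ → ℝ≥0∞ := (Set.Ioi (0 : ℝ)).indicator
    (fun y => ENNReal.ofReal (y ^ t * (1 + y) ^ (-b))) with hF
  have hFm : Measurable F := Measurable.indicator (by fun_prop) measurableSet_Ioi
  have hfin : ∫⁻ y, F y < ∞ := by
    rw [hF, lintegral_indicator measurableSet_Ioi]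
    exact (integrableOn_rpow_mul_one_add_rpow ht hb).lintegral_lt_top
  refine ⟨(∫⁻ y, F y).toReal, ENNReal.toReal_nonneg, fun A hA => le_of_eq ?_⟩
  have h1 : ∀ y : ℝ, (Set.Ioi (0 : ℝ)).indicator
      (fun y => ENNReal.ofReal (y ^ t * (A + y) ^ (-b))) y =
      ENNReal.ofReal (A ^ (t - b)) * F (A⁻¹ • y) := by
    intro y
    by_cases hy : 0 < y
    · have hy' : A⁻¹ * y ∈ Set.Ioi (0 : ℝ) := by
        simp only [Set.mem_Ioi]
        positivity
      rw [hF, smul_eq_mul, Set.indicator_of_mem (by exact hy), Set.indicator_of_mem hy',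
        ← ENNReal.ofReal_mul (by positivity)]
      congr 1
      have e1 : A + y = A * (1 + A⁻¹ * y) := by field_simp
      have e2 : (y : ℝ) ^ t = A ^ t * (A⁻¹ * y) ^ t := by
        rw [← Real.mul_rpow hA.le (by positivity)]
        congr 1
        field_simp
      rw [e1, Real.mul_rpow hA.le (by positivity), e2, sub_eq_add_neg, Real.rpow_add hA]
      ring
    · have hy' : A⁻¹ * y ∉ Set.Ioi (0 : ℝ) := by
        simp only [Set.mem_Ioi, not_lt] at hy ⊢
        exact mul_nonpos_of_nonneg_of_nonpos (by positivity) hy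
      rw [hF, smul_eq_mul, Set.indicator_of_notMem hy', Set.indicator_of_notMem (by exact hy),
        mul_zero]
  simp_rw [h1]
  rw [lintegral_const_mul _ (by fun_prop), lintegral_comp_inv_smul volume F hFm hA]
  conv_lhs => rw [← ENNReal.ofReal_toReal hfin.ne]
  rw [← ENNReal.ofReal_mul (by positivity), ← ENNReal.ofReal_mul (by positivity)]
  congr 1
  have : t + 1 - b = t - b + 1 := by ring
  rw [this, Real.rpow_add hA, Real.rpow_one]
  simp
  ring

/-- The contribution of the last coordinate to the Forelli–Rudin integral. -/
theorem exists_lintegral_complex_rpow_le {t a b : ℝ} (ht : -1 < t) (ha : 1 < a)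
    (hb : t + 1 < b) :
    ∃ C : ℝ, 0 ≤ C ∧ ∀ A : ℝ, 0 < A →
      ∫⁻ ζ : ℂ, ENNReal.ofReal ((A + |ζ.re|) ^ (-a)) * (Set.Ioi (0 : ℝ)).indicator
          (fun y => ENNReal.ofReal (y ^ t * (A + y) ^ (-b))) ζ.im ≤
        ENNReal.ofReal (C * A ^ (t + 2 - a - b)) := by
  obtain ⟨C₁, hC₁, h₁⟩ := exists_lintegral_add_abs_rpow_le ha
  obtain ⟨C₂, hC₂, h₂⟩ := exists_lintegral_Ioi_rpow_mul_add_rpow_le ht hb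
  refine ⟨C₁ * C₂, by positivity, fun A hA => ?_⟩
  have hm2 : Measurable ((Set.Ioi (0 : ℝ)).indicator
      (fun y => ENNReal.ofReal (y ^ t * (A + y) ^ (-b)))) :=
    Measurable.indicator (by fun_prop) measurableSet_Ioi
  have hm1 : Measurable fun x : ℝ => ENNReal.ofReal ((A + |x|) ^ (-a)) := by fun_prop
  have hm : Measurable fun p : ℝ × ℝ => ENNReal.ofReal ((A + |p.1|) ^ (-a)) *
      (Set.Ioi (0 : ℝ)).indicator (fun y => ENNReal.ofReal (y ^ t * (A + y) ^ (-b))) p.2 :=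
    (hm1.comp measurable_fst).mul (hm2.comp measurable_snd)
  have h := Complex.volume_preserving_equiv_real_prod.lintegral_comp hm
  have e : ∀ ζ : ℂ, Complex.measurableEquivRealProd ζ = (ζ.re, ζ.im) := fun _ => rfl
  simp_rw [e] at h
  rw [h]
  change ∫⁻ p, _ ∂((volume : Measure ℝ).prod (volume : Measure ℝ)) ≤ _
  rw [lintegral_prod_mul hm1.aemeasurable hm2.aemeasurable]
  refine (mul_le_mul' (h₁ A hA) (h₂ A hA)).trans (le_of_eq ?_)
  rw [← ENNReal.ofReal_mul (by positivity)]
  congr 1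
  have : t + 2 - a - b = (1 - a) + (t + 1 - b) := by ring
  rw [this, Real.rpow_add hA]
  ring

/-- Each base on the right is a lower bound for 4 |ρ(z,w)|. Distributing the exponent over these
bounds separates the variables: after a shear of the last coordinate the right side is a product of
one-variable functions. -/
theorem norm_rhoPair_rpow_le {z w : CSpace d} (hz : z ∈ tube d) (hw : w ∈ tube d) {a b c : ℝ}
    (ha : 0 ≤ a) (hb : 0 ≤ b) (hc : 0 ≤ c) :
    ‖rhoPair z w‖ ^ (-(a + b + d * c)) ≤ 4 ^ (a + b + d * c) *
      ((∏ i : Fin d, (rho z + ‖z i.castSucc - w i.castSucc‖ ^ 2) ^ (-c)) *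
        ((rho z + |2 * (rhoPair z w).im|) ^ (-a) * (rho z + rho w) ^ (-b))) := by
  have hρz := mem_tube_iff.1 hz
  have hρw := mem_tube_iff.1 hw
  have hN := norm_rhoPair_pos hz hw
  set N := ‖rhoPair z w‖ with hNdef
  have h0 : (4 * N) ^ (-(a + b + d * c)) =
      (∏ _i : Fin d, (4 * N) ^ (-c)) * ((4 * N) ^ (-a) * (4 * N) ^ (-b)) := by
    rw [Finset.prod_const, Finset.card_univ, Fintype.card_fin, ← Real.rpow_mul_natCast (by positivity),
      ← Real.rpow_add (by positivity), ← Real.rpow_add (by positivity)]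
    congr 1
    ring
  have h1 : N ^ (-(a + b + d * c)) = 4 ^ (a + b + d * c) * (4 * N) ^ (-(a + b + d * c)) := by
    rw [Real.mul_rpow (by norm_num) hN.le, ← mul_assoc, ← Real.rpow_add (by norm_num)]
    simp
  rw [h1, h0]
  have him : |2 * (rhoPair z w).im| ≤ 2 * N := by
    rw [abs_mul, abs_two]
    exact mul_le_mul_of_nonneg_left (Complex.abs_im_le_norm _) zero_le_two
  have hl := rho_le_left (z := z) hw
  have hs := rho_add_rho_le z w
  refine mul_le_mul_of_nonneg_left ?_ (by positivity)
  refine mul_le_mul (Finset.prod_le_prod (fun _ _ => by positivity) fun i _ => ?_)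
    (mul_le_mul ?_ ?_ (by positivity) (by positivity)) (by positivity)
    (Finset.prod_nonneg fun _ _ => by positivity)
  · refine Real.rpow_le_rpow_of_nonpos (by positivity) ?_ (by linarith)
    have := sq_add_rho_le (z := z) hw i
    linarith
  · exact Real.rpow_le_rpow_of_nonpos (by positivity) (by linarith) (by linarith)
  · exact Real.rpow_le_rpow_of_nonpos (by positivity) (by linarith) (by linarith)

/-- **Forelli–Rudin estimate** on the tube. -/
theorem exists_lintegral_rho_rpow_mul_le {t s : ℝ} (ht : -1 < t) (hs : t + d + 2 < s) :
    ∃ C : ℝ, 0 ≤ C ∧ ∀ z ∈ tube d,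
      ∫⁻ w in tube d, ENNReal.ofReal (rho w ^ t * ‖rhoPair z w‖ ^ (-s)) ≤
        ENNReal.ofReal (C * rho z ^ (t + d + 2 - s)) := by
  -- The excess of `s` over the critical exponent is shared equally by the `d` complex integrals and
  -- the two real integrals of the last coordinate, so that each converges.
  set δ : ℝ := (s - (t + d + 2)) / (d + 2) with hδ
  have hδ0 : 0 < δ := div_pos (by linarith) (by positivity)
  have hsum : (1 + δ) + (t + 1 + δ) + d * (1 + δ) = s := by
    rw [hδ]
    field_simp
    ring
  obtain ⟨C₁, hC₁, h₁⟩ := exists_lintegral_add_norm_sq_rpow_le (c := 1 + δ) (by linarith)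
  obtain ⟨C₂, hC₂, h₂⟩ := exists_lintegral_complex_rpow_le (t := t) (a := 1 + δ) (b := t + 1 + δ)
    ht (by linarith) (by linarith)
  refine ⟨4 ^ s * (C₁ ^ d * C₂), by positivity, fun z hz => ?_⟩
  have hA : 0 < rho z := mem_tube_iff.1 hz
  set A := rho z with hAdef
  set g : Fin d → ℂ → ℝ≥0∞ := fun i ζ =>
    ENNReal.ofReal ((A + ‖z i.castSucc - ζ‖ ^ 2) ^ (-(1 + δ))) with hg
  set g' : ℂ → ℝ≥0∞ := fun ζ => ENNReal.ofReal ((A + |ζ.re|) ^ (-(1 + δ))) *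
    (Set.Ioi (0 : ℝ)).indicator
      (fun y => ENNReal.ofReal (y ^ t * (A + y) ^ (-(t + 1 + δ)))) ζ.im with hg'
  -- The shear is chosen so that the shifted last coordinate has imaginary part ρ(w) and real part 2
  -- Im ρ(z,w).
  set h : (Fin d → ℂ) → ℂ := fun x =>
    (((∑ i : Fin d, (z i.castSucc - star (x i)) ^ 2).im / 2 - (z (Fin.last d)).re : ℝ) : ℂ) -
      ((∑ i : Fin d, (x i).im ^ 2 : ℝ) : ℂ) * Complex.I with hh
  have hgm : ∀ i, Measurable (g i) := fun i => by rw [hg]; fun_prop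
  have hgm' : Measurable g' := by
    refine Measurable.mul (by fun_prop) ?_
    exact (Measurable.indicator (by fun_prop) measurableSet_Ioi).comp Complex.measurable_im
  have hhm : Measurable h := by
    have : Continuous h := by
      rw [hh]
      have : Continuous fun x : Fin d → ℂ => (∑ i : Fin d, (z i.castSucc - star (x i)) ^ 2).im :=
        Complex.continuous_im.comp (by fun_prop)
      fun_prop
    exact this.measurable
  have key : ∀ w ∈ tube d, ENNReal.ofReal (rho w ^ t * ‖rhoPair z w‖ ^ (-s)) ≤
      ENNReal.ofReal (4 ^ s) * ((∏ i : Fin d, g i (w i.castSucc)) *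
        g' (w (Fin.last d) + h fun i => w i.castSucc)) := by
    intro w hw
    have hρw := mem_tube_iff.1 hw
    have him : (w (Fin.last d) + h fun i => w i.castSucc).im = rho w := by
      simp only [hh, rho, Complex.add_im, Complex.sub_im, Complex.ofReal_im, Complex.mul_im,
        Complex.ofReal_re, Complex.I_im, Complex.I_re]
      ring
    have hre : (w (Fin.last d) + h fun i => w i.castSucc).re = 2 * (rhoPair z w).im := by
      rw [rhoPair_im]
      simp only [hh, Complex.add_re, Complex.sub_re, Complex.ofReal_im, Complex.mul_re,
        Complex.ofReal_re, Complex.I_im, Complex.I_re]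
      ring
    have hpt := norm_rhoPair_rpow_le hz hw (a := 1 + δ) (b := t + 1 + δ) (c := 1 + δ)
      (by linarith) (by linarith) (by linarith)
    rw [hsum] at hpt
    simp only [hg, hg']
    rw [him, hre, Set.indicator_of_mem (by exact hρw), ← ENNReal.ofReal_prod_of_nonneg
      (fun _ _ => by positivity), ← ENNReal.ofReal_mul (by positivity),
      ← ENNReal.ofReal_mul (Finset.prod_nonneg fun _ _ => by positivity),
      ← ENNReal.ofReal_mul (by positivity)]
    refine ENNReal.ofReal_le_ofReal ?_
    calc rho w ^ t * ‖rhoPair z w‖ ^ (-s) ≤ rho w ^ t * _ :=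
          mul_le_mul_of_nonneg_left hpt (by positivity)
      _ = _ := by ring
  calc ∫⁻ w in tube d, ENNReal.ofReal (rho w ^ t * ‖rhoPair z w‖ ^ (-s))
      ≤ ∫⁻ w in tube d, ENNReal.ofReal (4 ^ s) * ((∏ i : Fin d, g i (w i.castSucc)) *
        g' (w (Fin.last d) + h fun i => w i.castSucc)) :=
        setLIntegral_mono' measurableSet_tube key
    _ ≤ ∫⁻ w : CSpace d, ENNReal.ofReal (4 ^ s) * ((∏ i : Fin d, g i (w i.castSucc)) *
        g' (w (Fin.last d) + h fun i => w i.castSucc)) := setLIntegral_le_lintegral _ _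
    _ = ENNReal.ofReal (4 ^ s) * ((∏ i, ∫⁻ ζ, g i ζ) * ∫⁻ ζ, g' ζ) := by
        rw [lintegral_const_mul, lintegral_shear_prod g hgm g' hgm' h hhm]
        refine Measurable.mul ?_ ?_
        · exact Finset.measurable_prod _ fun i _ => (hgm _).comp (measurable_pi_apply _)
        · fun_prop
    _ ≤ ENNReal.ofReal (4 ^ s) * ((∏ _i : Fin d, ENNReal.ofReal (C₁ * A ^ (1 - (1 + δ)))) *
          ENNReal.ofReal (C₂ * A ^ (t + 2 - (1 + δ) - (t + 1 + δ)))) := by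
        gcongr with i _
        · exact h₁ A hA _
        · exact h₂ A hA
    _ = ENNReal.ofReal (4 ^ s * (C₁ ^ d * C₂) * A ^ (t + d + 2 - s)) := by
        rw [Finset.prod_const, Finset.card_univ, Fintype.card_fin,
          ← ENNReal.ofReal_pow (by positivity), ← ENNReal.ofReal_mul (by positivity),
          ← ENNReal.ofReal_mul (by positivity)]
        congr 1
        have : t + d + 2 - s = (1 - (1 + δ)) * d + (t + 2 - (1 + δ) - (t + 1 + δ)) := by
          rw [← hsum]
          ring
        rw [this, Real.rpow_add hA, mul_pow, Real.rpow_mul_natCast hA.le]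
        ring

theorem lintegral_weightedVolume (α : ℝ) (f : CSpace d → ℝ≥0∞) :
    ∫⁻ w, f w ∂weightedVolume d α = ∫⁻ w in tube d, ENNReal.ofReal (rho w ^ α) * f w := by
  have hm : Measurable fun w : CSpace d => ENNReal.ofReal (rho w ^ α) :=
    ((continuous_rho.measurable).pow_const α).ennreal_ofReal
  rw [weightedVolume, lintegral_withDensity_eq_lintegral_mul_non_measurable _ hm
    (ae_of_all _ fun _ => ENNReal.ofReal_lt_top)]
  rfl

theorem weightedVolume_absolutelyContinuous (α : ℝ) :
    weightedVolume d α ≪ volume.restrict (tube d) := withDensity_absolutelyContinuous _ _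

instance (α : ℝ) : SFinite (weightedVolume d α) := by
  unfold weightedVolume
  infer_instance

theorem ae_mem_tube (α : ℝ) : ∀ᵐ w ∂weightedVolume d α, w ∈ tube d :=
  (weightedVolume_absolutelyContinuous α).ae_le (ae_restrict_mem measurableSet_tube)

theorem exists_lintegral_weightedVolume_le {α β s : ℝ} (ht : -1 < α + β)
    (hs : α + β + d + 2 < s) :
    ∃ C : ℝ, 0 ≤ C ∧ ∀ z ∈ tube d,
      ∫⁻ w, ENNReal.ofReal (rho w ^ β * ‖rhoPair z w‖ ^ (-s)) ∂weightedVolume d α ≤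
        ENNReal.ofReal (C * rho z ^ (α + β + d + 2 - s)) := by
  obtain ⟨C, hC, h⟩ := exists_lintegral_rho_rpow_mul_le (d := d) ht hs
  refine ⟨C, hC, fun z hz => ?_⟩
  rw [lintegral_weightedVolume]
  refine le_trans (le_of_eq (setLIntegral_congr_fun measurableSet_tube fun w hw => ?_)) (h z hz)
  have hw' := mem_tube_iff.1 hw
  rw [← ENNReal.ofReal_mul (by positivity), Real.rpow_add hw']
  congr 1
  ring

/-! ### The sub-mean value property of |f|^q. -/

/-- Jensen's formula: a zero u in the disc contributes its multiplicity times log(1/|u|), which is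
nonnegative. -/
theorem log_norm_le_circleAverage {f : ℂ → ℂ} (hf : AnalyticOnNhd ℂ f (Metric.closedBall 0 1))
    (h0 : f 0 ≠ 0) :
    Real.log ‖f 0‖ ≤ Real.circleAverage (fun z => Real.log ‖f z‖) 0 1 := by
  have hf' : AnalyticOnNhd ℂ f (Metric.closedBall 0 |(1 : ℝ)|) := by simpa using hf
  have h := hf'.circleAverage_log_norm one_ne_zero h0
  rw [h]
  refine le_add_of_nonneg_left (finsum_nonneg fun u => ?_)
  by_cases hu : u ∈ Metric.closedBall (0 : ℂ) |(1 : ℝ)|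
  · refine mul_nonneg (mod_cast MeromorphicOn.AnalyticOnNhd.divisor_nonneg hf' u) ?_
    rcases eq_or_ne u 0 with rfl | hu0
    · simp
    · apply Real.log_nonneg
      rw [one_mul, zero_sub, norm_neg]
      rw [abs_one, mem_closedBall_zero_iff] at hu
      exact (one_le_inv₀ (norm_pos_iff.2 hu0)).2 hu
  · rw [Function.locallyFinsuppWithin.apply_eq_zero_of_notMem _ hu]
    simp

/-- Subharmonicity of `|f|^q` on the unit circle. -/
theorem norm_rpow_le_circleAverage {f : ℂ → ℂ} (hf : AnalyticOnNhd ℂ f (Metric.closedBall 0 1))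
    {q : ℝ} (hq : 0 < q) :
    ‖f 0‖ ^ q ≤ Real.circleAverage (fun z => ‖f z‖ ^ q) 0 1 := by
  rcases eq_or_ne (f 0) 0 with h0 | h0
  · rw [h0, norm_zero, Real.zero_rpow hq.ne']
    exact Real.circleAverage_nonneg_of_nonneg fun _ _ => by positivity
  have hs : Metric.sphere (0 : ℂ) |(1 : ℝ)| ⊆ Metric.closedBall 0 1 := by
    rw [abs_one]
    exact Metric.sphere_subset_closedBall
  set a := ‖f 0‖ with ha
  have ha0 : 0 < a := norm_pos_iff.2 h0
  -- At a zero of `f` the default `Real.log 0 = 0` would violate the pointwise bound below, so the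
  -- value there is replaced by that of the bound at |f| = 0. Zeros are isolated, hence the average
  -- is unchanged.
  set L : ℂ → ℝ := fun z => if f z = 0 then Real.log a - 1 / q else Real.log ‖f z‖ with hL
  have hcod : (fun z => Real.log ‖f z‖) =ᶠ[Filter.codiscreteWithin
      (Metric.sphere (0 : ℂ) |(1 : ℝ)|)] L := by
    have h1 := AnalyticOnNhd.preimage_zero_mem_codiscreteWithin hf h0
      (Metric.mem_closedBall_self zero_le_one)
      ((convex_closedBall (0 : ℂ) 1).isConnected (Metric.nonempty_closedBall.2 zero_le_one))
    filter_upwards [Filter.codiscreteWithin_mono hs h1] with z hz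
    have hz' : f z ≠ 0 := hz
    simp [hL, hz']
  have hlog : CircleIntegrable (fun z => Real.log ‖f z‖) 0 1 :=
    (hf.mono hs).meromorphicOn.circleIntegrable_log_norm
  have hLi : CircleIntegrable L 0 1 := hlog.congr_codiscreteWithin hcod
  have hcont : ContinuousOn (fun z => ‖f z‖ ^ q) (Metric.sphere 0 1) :=
    ((hf.continuousOn.mono Metric.sphere_subset_closedBall).norm).rpow_const
      fun _ _ => Or.inr hq.le
  have hqi : CircleIntegrable (fun z => ‖f z‖ ^ q) 0 1 := hcont.circleIntegrable zero_le_one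
  -- From log x ≤ x - 1 at x = (|f|/a)^q. Averaging this linear bound in |f|^q and comparing with
  -- `log_norm_le_circleAverage` gives the claim, for all q > 0 at once.
  have hle : ∀ z ∈ Metric.sphere (0 : ℂ) |(1 : ℝ)|,
      L z ≤ (Real.log a - 1 / q) + (a ^ q * q)⁻¹ • ‖f z‖ ^ q := by
    intro z _
    by_cases hz : f z = 0
    · simp only [hL, hz, if_true]
      exact le_add_of_nonneg_right (by positivity)
    · simp only [hL, hz, if_false]
      have hx : 0 < ‖f z‖ := norm_pos_iff.2 hz
      have h2 := Real.log_le_sub_one_of_pos (x := (‖f z‖ / a) ^ q) (by positivity)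
      rw [Real.log_rpow (by positivity), Real.log_div hx.ne' ha0.ne',
        Real.div_rpow hx.le ha0.le] at h2
      have h3 : Real.log ‖f z‖ - Real.log a ≤ (‖f z‖ ^ q / a ^ q - 1) / q := by
        rw [le_div_iff₀ hq]
        linarith
      have h4 : (‖f z‖ ^ q / a ^ q - 1) / q = (a ^ q * q)⁻¹ * ‖f z‖ ^ q - 1 / q := by
        field_simp
      rw [smul_eq_mul]
      linarith
  have hmono := Real.circleAverage_mono hLi
    ((circleIntegrable_const (Real.log a - 1 / q) 0 1).add (hqi.const_smul (a := (a ^ q * q)⁻¹))) hle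
  have e1 : Real.circleAverage (fun z => (Real.log a - 1 / q) + (a ^ q * q)⁻¹ • ‖f z‖ ^ q) 0 1 =
      (Real.log a - 1 / q) + (a ^ q * q)⁻¹ * Real.circleAverage (fun z => ‖f z‖ ^ q) 0 1 := by
    rw [Real.circleAverage_fun_add (f₂ := fun z => (a ^ q * q)⁻¹ • ‖f z‖ ^ q)
      (circleIntegrable_const _ 0 1) hqi.const_smul, Real.circleAverage_const, Real.circleAverage_fun_smul, smul_eq_mul]
  have hmono' : Real.circleAverage L 0 1 ≤ (Real.log a - 1 / q) +
      (a ^ q * q)⁻¹ * Real.circleAverage (fun z => ‖f z‖ ^ q) 0 1 := e1 ▸ hmono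
  have h5 := log_norm_le_circleAverage hf h0
  rw [Real.circleAverage_congr_codiscreteWithin hcod one_ne_zero] at h5
  have h6 : 1 / q ≤ (a ^ q * q)⁻¹ * Real.circleAverage (fun z => ‖f z‖ ^ q) 0 1 := by linarith
  rw [inv_mul_eq_div, le_div_iff₀ (by positivity)] at h6
  calc a ^ q = 1 / q * (a ^ q * q) := by field_simp
    _ ≤ _ := h6

theorem enorm_rpow_le_lintegral_circle {f : ℂ → ℂ}
    (hf : AnalyticOnNhd ℂ f (Metric.closedBall 0 1)) {q : ℝ} (hq : 0 < q) :
    ENNReal.ofReal (2 * Real.pi) * ‖f 0‖ₑ ^ q ≤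
      ∫⁻ θ in Set.Ioc 0 (2 * Real.pi), ‖f (circleMap 0 1 θ)‖ₑ ^ q := by
  have h := norm_rpow_le_circleAverage hf hq
  have hcont : ContinuousOn (fun z => ‖f z‖ ^ q) (Metric.sphere 0 1) :=
    ((hf.continuousOn.mono Metric.sphere_subset_closedBall).norm).rpow_const
      fun _ _ => Or.inr hq.le
  have hqi : CircleIntegrable (fun z => ‖f z‖ ^ q) 0 1 := hcont.circleIntegrable zero_le_one
  rw [Real.circleAverage_def, smul_eq_mul,
    intervalIntegral.integral_of_le Real.two_pi_pos.le] at h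
  have hi := (intervalIntegrable_iff_integrableOn_Ioc_of_le Real.two_pi_pos.le).1 hqi
  have e : ∀ x : ℂ, ‖x‖ₑ ^ q = ENNReal.ofReal (‖x‖ ^ q) := fun x => by
    rw [← ofReal_norm, ENNReal.ofReal_rpow_of_nonneg (norm_nonneg _) hq.le]
  simp_rw [e]
  rw [← ofReal_integral_eq_lintegral_ofReal hi (ae_of_all _ fun _ => by positivity),
    ← ENNReal.ofReal_mul Real.two_pi_pos.le]
  refine ENNReal.ofReal_le_ofReal ?_
  have := mul_le_mul_of_nonneg_left h Real.two_pi_pos.le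
  rwa [← mul_assoc, mul_inv_cancel₀ Real.two_pi_pos.ne', one_mul] at this

theorem measurePreserving_circle_smul {n : ℕ} {u : ℂ} (hu : ‖u‖ = 1) :
    MeasurePreserving (fun ζ : Fin n → ℂ => u • ζ) := by
  have h1 : MeasurePreserving (fun x : ℂ => u * x) := by
    let a : Circle := ⟨u, by simpa [Submonoid.unitSphere] using hu⟩
    have := (rotation a).measurePreserving
    exact this
  exact volume_preserving_pi fun _ : Fin n => h1

/-- The sub-mean value property of `|f|^q` over sets that are circular about `z`. -/
theorem enorm_rpow_mul_volume_le {U S : Set (CSpace d)} (hU : IsOpen U) (hS : MeasurableSet S)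
    {f : CSpace d → ℂ} (hf : DifferentiableOn ℂ f U) {z : CSpace d}
    (hcirc : ∀ u : ℂ, ‖u‖ = 1 → ∀ ζ, u • ζ ∈ S ↔ ζ ∈ S)
    (hSU : ∀ ζ ∈ S, ∀ u : ℂ, ‖u‖ ≤ 1 → z + u • ζ ∈ U) {q : ℝ} (hq : 0 < q) :
    ‖f z‖ₑ ^ q * volume S ≤ ∫⁻ ζ in S, ‖f (z + ζ)‖ₑ ^ q := by
  classical
  set F : CSpace d → ℝ≥0∞ := fun w => ‖U.indicator f w‖ₑ ^ q with hF
  have hfm : Measurable (U.indicator f) := by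
    rw [← Set.piecewise_eq_indicator]
    exact hf.continuousOn.measurable_piecewise continuousOn_const hU.measurableSet
  have hFm : Measurable F := hfm.enorm.pow_const q
  have hFU : ∀ w ∈ U, F w = ‖f w‖ₑ ^ q := fun w hw => by simp [hF, hw]
  -- One-variable inequality on the disc u ↦ z + uζ. It is then integrated over ζ ∈ S; after
  -- Tonelli, the rotation invariance of `S` removes the angle.
  have hpt : ∀ ζ ∈ S, ENNReal.ofReal (2 * Real.pi) * ‖f z‖ₑ ^ q ≤
      ∫⁻ θ in Set.Ioc 0 (2 * Real.pi), F (z + circleMap 0 1 θ • ζ) := by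
    intro ζ hζ
    set g : ℂ → ℂ := fun u => f (z + u • ζ) with hg
    have hopen : IsOpen {u : ℂ | z + u • ζ ∈ U} := hU.preimage (by fun_prop)
    have hgd : DifferentiableOn ℂ g {u : ℂ | z + u • ζ ∈ U} := by
      refine hf.comp (t := U) ?_ fun u hu => hu
      exact Differentiable.differentiableOn (by fun_prop)
    have hga : AnalyticOnNhd ℂ g (Metric.closedBall 0 1) :=
      (hgd.analyticOnNhd hopen).mono fun u hu => hSU ζ hζ u (by simpa using hu)
    have := enorm_rpow_le_lintegral_circle hga hq
    simp only [hg, zero_smul, add_zero] at this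
    refine this.trans (le_of_eq (lintegral_congr fun θ => ?_))
    rw [hFU _ (hSU ζ hζ _ (by simp))]
  have hjoint : Measurable fun p : CSpace d × ℝ => F (z + circleMap 0 1 p.2 • p.1) := by
    refine hFm.comp ?_
    have : Continuous fun p : CSpace d × ℝ => z + circleMap 0 1 p.2 • p.1 :=
      continuous_const.add (((continuous_circleMap 0 1).comp continuous_snd).smul continuous_fst)
    exact this.measurable
  have hrot : ∀ θ : ℝ, ∫⁻ ζ in S, F (z + circleMap 0 1 θ • ζ) = ∫⁻ ζ in S, F (z + ζ) := by
    intro θ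
    have hu : ‖circleMap 0 1 θ‖ = 1 := by simp
    have hmp := measurePreserving_circle_smul (n := d + 1) hu
    have hm : Measurable fun ζ : CSpace d => S.indicator (fun ζ => F (z + ζ)) ζ :=
      Measurable.indicator (by fun_prop) hS
    rw [← lintegral_indicator hS, ← lintegral_indicator hS, ← hmp.lintegral_comp hm]
    refine lintegral_congr fun ζ => ?_
    by_cases hζ : ζ ∈ S
    · rw [Set.indicator_of_mem hζ, Set.indicator_of_mem ((hcirc _ hu ζ).2 hζ)]
    · rw [Set.indicator_of_notMem hζ, Set.indicator_of_notMem (mt (hcirc _ hu ζ).1 hζ)]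
  have hpi : ENNReal.ofReal (2 * Real.pi) ≠ 0 := by
    simp [Real.pi_pos]
  have hmain : ENNReal.ofReal (2 * Real.pi) * (‖f z‖ₑ ^ q * volume S) ≤
      ENNReal.ofReal (2 * Real.pi) * ∫⁻ ζ in S, F (z + ζ) := by
    calc ENNReal.ofReal (2 * Real.pi) * (‖f z‖ₑ ^ q * volume S)
        = ∫⁻ _ζ in S, ENNReal.ofReal (2 * Real.pi) * ‖f z‖ₑ ^ q := by
          rw [setLIntegral_const, mul_assoc]
      _ ≤ ∫⁻ ζ in S, ∫⁻ θ in Set.Ioc 0 (2 * Real.pi), F (z + circleMap 0 1 θ • ζ) :=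
          setLIntegral_mono' hS hpt
      _ = ∫⁻ θ in Set.Ioc 0 (2 * Real.pi), ∫⁻ ζ in S, F (z + circleMap 0 1 θ • ζ) :=
          lintegral_lintegral_swap hjoint.aemeasurable
      _ = ∫⁻ θ in Set.Ioc 0 (2 * Real.pi), ∫⁻ ζ in S, F (z + ζ) := by
          simp_rw [hrot]
      _ = ENNReal.ofReal (2 * Real.pi) * ∫⁻ ζ in S, F (z + ζ) := by
          rw [setLIntegral_const, Real.volume_Ioc, sub_zero, mul_comm]
  have h2 := (ENNReal.mul_le_mul_iff_right hpi ENNReal.ofReal_ne_top).1 hmain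
  refine h2.trans (le_of_eq (setLIntegral_congr_fun hS fun ζ hζ => ?_))
  exact hFU _ (by simpa using hSU ζ hζ 1 (by simp))

/-! ### Cells: affine polydiscs adapted to the tube. -/

/-- The affine image of a polydisc of radius `ε` about `𝐢` under the automorphism of the tube that
sends `𝐢` to `z`. -/
def cell (z : CSpace d) (ε : ℝ) : Set (CSpace d) :=
  {w | (∀ i : Fin d, ‖w i.castSucc - z i.castSucc‖ < ε * √(rho z)) ∧
    ‖w (Fin.last d) - z (Fin.last d) -
      2 * ∑ i : Fin d, ((z i.castSucc).im : ℂ) * (w i.castSucc - z i.castSucc)‖ < ε * rho z}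

/-- The exponent `n + α + 1` of the weighted Bergman kernel. -/
noncomputable def kernelExp (d : ℕ) (α : ℝ) : ℝ := (d + 1 : ℕ) + α + 1

theorem kernelExp_eq (α : ℝ) : kernelExp d α = α + d + 2 := by
  simp [kernelExp]
  ring

theorem kernelExp_pos {α : ℝ} (hα : -1 < α) : 0 < kernelExp d α := by
  rw [kernelExp_eq]
  have : (0 : ℝ) ≤ d := Nat.cast_nonneg d
  linarith

theorem measurableSet_cell_prod (ε : ℝ) :
    MeasurableSet {p : CSpace d × CSpace d | p.2 ∈ cell p.1 ε} := by
  have hr : Continuous fun p : CSpace d × CSpace d => rho p.1 := continuous_rho.comp continuous_fst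
  have e : {p : CSpace d × CSpace d | p.2 ∈ cell p.1 ε} =
      (⋂ i : Fin d, {p : CSpace d × CSpace d |
        ‖p.2 i.castSucc - p.1 i.castSucc‖ < ε * √(rho p.1)}) ∩
      {p : CSpace d × CSpace d | ‖p.2 (Fin.last d) - p.1 (Fin.last d) -
        2 * ∑ i : Fin d, ((p.1 i.castSucc).im : ℂ) * (p.2 i.castSucc - p.1 i.castSucc)‖ <
          ε * rho p.1} := by
    ext p
    simp [cell]
  rw [e]
  refine MeasurableSet.inter (MeasurableSet.iInter fun i => ?_) ?_
  · exact (isOpen_lt (by fun_prop) (by fun_prop)).measurableSet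
  · exact (isOpen_lt (by fun_prop) (by fun_prop)).measurableSet

theorem measurableSet_cell (z : CSpace d) (ε : ℝ) : MeasurableSet (cell z ε) :=
  (measurableSet_cell_prod ε).preimage (measurable_const.prodMk measurable_id)

/-- The exact Taylor expansion of the quadratic function ρ at z. Its linear part is the imaginary
part of the complex-linear form that `cell` bounds. -/
theorem rho_eq_of_cell (z w : CSpace d) :
    rho w = rho z + (w (Fin.last d) - z (Fin.last d) -
      2 * ∑ i : Fin d, ((z i.castSucc).im : ℂ) * (w i.castSucc - z i.castSucc)).im -
      ∑ i : Fin d, (w i.castSucc - z i.castSucc).im ^ 2 := by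
  have h2 : (2 : ℂ) = ((2 : ℝ) : ℂ) := by norm_num
  have hs : ∑ i : Fin d, (w i.castSucc - z i.castSucc).im ^ 2 =
      ∑ i : Fin d, (w i.castSucc).im ^ 2 + ∑ i : Fin d, (z i.castSucc).im ^ 2 -
        2 * ∑ i : Fin d, (w i.castSucc).im * (z i.castSucc).im := by
    rw [Finset.mul_sum, ← Finset.sum_add_distrib, ← Finset.sum_sub_distrib]
    refine Finset.sum_congr rfl fun i _ => ?_
    rw [Complex.sub_im]
    ring
  have hi : (∑ i : Fin d, ((z i.castSucc).im : ℂ) * (w i.castSucc - z i.castSucc)).im =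
      ∑ i : Fin d, (w i.castSucc).im * (z i.castSucc).im - ∑ i : Fin d, (z i.castSucc).im ^ 2 := by
    rw [Complex.im_sum, ← Finset.sum_sub_distrib]
    refine Finset.sum_congr rfl fun i _ => ?_
    rw [Complex.im_ofReal_mul, Complex.sub_im]
    ring
  rw [hs, h2, Complex.sub_im, Complex.im_ofReal_mul, hi]
  simp only [rho, Complex.sub_im]
  ring

theorem rho_bounds_of_mem_cell {z w : CSpace d} {ε : ℝ} (hz : z ∈ tube d) (hε : 0 < ε)
    (hε' : 4 * (d + 1) * ε ≤ 1) (hw : w ∈ cell z ε) : rho z / 2 ≤ rho w ∧ rho w ≤ 2 * rho z := by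
  have hρ := mem_tube_iff.1 hz
  obtain ⟨h1, h2⟩ := hw
  have hd : (0 : ℝ) ≤ d := Nat.cast_nonneg d
  have hs : ∑ i : Fin d, (w i.castSucc - z i.castSucc).im ^ 2 ≤ d * (ε ^ 2 * rho z) := by
    calc ∑ i : Fin d, (w i.castSucc - z i.castSucc).im ^ 2
        ≤ ∑ _i : Fin d, ε ^ 2 * rho z := by
          refine Finset.sum_le_sum fun i _ => ?_
          have h3 := (Complex.abs_im_le_norm (w i.castSucc - z i.castSucc)).trans (h1 i).le
          calc (w i.castSucc - z i.castSucc).im ^ 2 = |(w i.castSucc - z i.castSucc).im| ^ 2 :=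
                (sq_abs _).symm
            _ ≤ (ε * √(rho z)) ^ 2 := pow_le_pow_left₀ (abs_nonneg _) h3 2
            _ = ε ^ 2 * rho z := by rw [mul_pow, Real.sq_sqrt hρ.le]
      _ = d * (ε ^ 2 * rho z) := by simp
  have hs0 : 0 ≤ ∑ i : Fin d, (w i.castSucc - z i.castSucc).im ^ 2 :=
    Finset.sum_nonneg fun _ _ => sq_nonneg _
  have h4 := abs_le.1 ((Complex.abs_im_le_norm _).trans h2.le)
  -- In units of ρ(z), the linear term is at most ε and the quadratic one at most d ε².
  have h5 : ε + d * ε ^ 2 ≤ 1 / 2 := by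
    have : ε ≤ 1 := by nlinarith
    nlinarith [mul_le_mul_of_nonneg_left this (mul_nonneg hd hε.le)]
  have h6 := mul_le_mul_of_nonneg_right h5 hρ.le
  rw [rho_eq_of_cell z w]
  constructor
  · nlinarith [h4.1]
  · nlinarith [h4.2, mul_nonneg (mul_nonneg hd (sq_nonneg ε)) hρ.le]

theorem cell_subset_tube {z : CSpace d} {ε : ℝ} (hz : z ∈ tube d) (hε : 0 < ε)
    (hε' : 4 * (d + 1) * ε ≤ 1) : cell z ε ⊆ tube d := fun w hw => by
  have := (rho_bounds_of_mem_cell hz hε hε' hw).1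
  have hρ := mem_tube_iff.1 hz
  rw [mem_tube_iff]
  linarith

/-- A cell is given by bounds on complex-linear forms in w - z, so its translate to 0 is balanced.
This yields both the circular symmetry used for mean values and the stability along segments from z.
-/
theorem add_smul_mem_cell {z ζ : CSpace d} {ε : ℝ} (h : z + ζ ∈ cell z ε) {u : ℂ}
    (hu : ‖u‖ ≤ 1) : z + u • ζ ∈ cell z ε := by
  obtain ⟨h1, h2⟩ := h
  simp only [Pi.add_apply, add_sub_cancel_left] at h1 h2
  refine ⟨fun i => ?_, ?_⟩
  · simp only [Pi.add_apply, Pi.smul_apply, add_sub_cancel_left, norm_smul]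
    exact lt_of_le_of_lt (mul_le_of_le_one_left (norm_nonneg _) hu) (h1 i)
  · simp only [Pi.add_apply, Pi.smul_apply, add_sub_cancel_left, smul_eq_mul]
    have : u * ζ (Fin.last d) - 2 * ∑ i : Fin d, ((z i.castSucc).im : ℂ) * (u * ζ i.castSucc) =
        u * (ζ (Fin.last d) - 2 * ∑ i : Fin d, ((z i.castSucc).im : ℂ) * ζ i.castSucc) := by
      rw [mul_sub, Finset.mul_sum, Finset.mul_sum, Finset.mul_sum]
      congr 1
      refine Finset.sum_congr rfl fun i _ => ?_
      ring
    rw [this, norm_mul]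
    exact lt_of_le_of_lt (mul_le_of_le_one_left (norm_nonneg _) hu) h2

/-- A cell is a sheared polydisc: `d` discs of squared radius ε² ρ(z) and one of squared radius ε²
ρ(z)². -/
theorem volume_cell {z : CSpace d} (hz : z ∈ tube d) {ε : ℝ} (hε : 0 < ε) :
    volume (cell z ε) = ENNReal.ofReal ((ε ^ 2 * Real.pi) ^ (d + 1) * rho z ^ ((d : ℝ) + 2)) := by
  have hρ := mem_tube_iff.1 hz
  set g : Fin d → ℂ → ℝ≥0∞ := fun i =>
    (Metric.ball (z i.castSucc) (ε * √(rho z))).indicator 1 with hg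
  set g' : ℂ → ℝ≥0∞ := (Metric.ball (z (Fin.last d)) (ε * rho z)).indicator 1 with hg'
  set h : (Fin d → ℂ) → ℂ := fun x =>
    -(2 * ∑ i : Fin d, ((z i.castSucc).im : ℂ) * (x i - z i.castSucc)) with hh
  have key := lintegral_shear_prod g
    (fun i => Measurable.indicator measurable_one Metric.isOpen_ball.measurableSet)
    g' (Measurable.indicator measurable_one Metric.isOpen_ball.measurableSet) h (by fun_prop)
  have h1 : ∀ w : CSpace d, (∏ i : Fin d, g i (w i.castSucc)) *
      g' (w (Fin.last d) + h fun i => w i.castSucc) = (cell z ε).indicator 1 w := by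
    intro w
    have hlast : (w (Fin.last d) + h fun i => w i.castSucc) ∈
        Metric.ball (z (Fin.last d)) (ε * rho z) ↔ ‖w (Fin.last d) - z (Fin.last d) -
      2 * ∑ i : Fin d, ((z i.castSucc).im : ℂ) * (w i.castSucc - z i.castSucc)‖ < ε * rho z := by
      rw [mem_ball_iff_norm]
      have : w (Fin.last d) + h (fun i => w i.castSucc) - z (Fin.last d) =
        w (Fin.last d) - z (Fin.last d) -
        2 * ∑ i : Fin d, ((z i.castSucc).im : ℂ) * (w i.castSucc - z i.castSucc) := by
        rw [hh]
        ring
      rw [this]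
    have hfirst : ∀ i : Fin d, w i.castSucc ∈ Metric.ball (z i.castSucc) (ε * √(rho z)) ↔
      ‖w i.castSucc - z i.castSucc‖ < ε * √(rho z) := fun i => mem_ball_iff_norm
    by_cases hw : w ∈ cell z ε
    · rw [Set.indicator_of_mem hw, hg', Set.indicator_of_mem (hlast.2 hw.2)]
      simp only [Pi.one_apply, mul_one]
      refine Finset.prod_eq_one fun i _ => ?_
      rw [hg]
      simp only
      rw [Set.indicator_of_mem ((hfirst i).2 (hw.1 i)), Pi.one_apply]
    · rw [Set.indicator_of_notMem hw]
      by_cases hl : (w (Fin.last d) + h fun i => w i.castSucc) ∈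
        Metric.ball (z (Fin.last d)) (ε * rho z)
      · have : ∃ i : Fin d, w i.castSucc ∉ Metric.ball (z i.castSucc) (ε * √(rho z)) := by
          by_contra hcon
          push Not at hcon
          exact hw ⟨fun i => (hfirst i).1 (hcon i), hlast.1 hl⟩
        obtain ⟨i, hi⟩ := this
        rw [Finset.prod_eq_zero (Finset.mem_univ i), zero_mul]
        exact Set.indicator_of_notMem hi _
      · rw [hg', Set.indicator_of_notMem hl, mul_zero]
  simp_rw [h1] at key
  rw [lintegral_indicator_one (measurableSet_cell z ε)] at key
  rw [key]
  have h2 : ∀ i, ∫⁻ ζ, g i ζ = ENNReal.ofReal (ε ^ 2 * Real.pi * rho z) := by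
    intro i
    rw [hg]
    simp only
    rw [lintegral_indicator_one Metric.isOpen_ball.measurableSet, Complex.volume_ball,
      ← ENNReal.ofReal_pow (by positivity), mul_pow, Real.sq_sqrt hρ.le,
      ← ENNReal.ofReal_coe_nnreal, ← ENNReal.ofReal_mul (by positivity), NNReal.coe_real_pi]
    congr 1
    ring
  have h3 : ∫⁻ ζ, g' ζ = ENNReal.ofReal (ε ^ 2 * Real.pi * rho z ^ 2) := by
    rw [hg', lintegral_indicator_one Metric.isOpen_ball.measurableSet, Complex.volume_ball,
      ← ENNReal.ofReal_pow (by positivity), mul_pow,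
      ← ENNReal.ofReal_coe_nnreal, ← ENNReal.ofReal_mul (by positivity), NNReal.coe_real_pi]
    congr 1
    ring
  simp_rw [h2]
  rw [h3, Finset.prod_const, Finset.card_univ, Fintype.card_fin,
    ← ENNReal.ofReal_pow (by positivity), ← ENNReal.ofReal_mul (by positivity)]
  congr 1
  have : rho z ^ ((d : ℝ) + 2) = rho z ^ (d + 2) := by
    rw [← Real.rpow_natCast]
    congr 1
    push_cast
    ring
  rw [this]
  ring

/-- The weighted sub-mean value property over cells. -/
theorem exists_enorm_rpow_le_lintegral_cell (α : ℝ) {ε : ℝ} (hε : 0 < ε)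
    (hε' : 4 * (d + 1) * ε ≤ 1) :
    ∃ C : ℝ, 0 < C ∧ ∀ (q : ℝ), 0 < q → ∀ (f : CSpace d → ℂ), DifferentiableOn ℂ f (tube d) →
      ∀ z ∈ tube d, ‖f z‖ₑ ^ q ≤ ENNReal.ofReal (C * rho z ^ (-kernelExp d α)) *
        ∫⁻ w in cell z ε, ‖f w‖ₑ ^ q ∂weightedVolume d α := by
  set V : ℝ := (ε ^ 2 * Real.pi) ^ (d + 1) with hV
  have hV0 : 0 < V := by positivity
  refine ⟨2 ^ |α| / V, by positivity, fun q hq f hf z hz => ?_⟩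
  have hρ := mem_tube_iff.1 hz
  set S : Set (CSpace d) := (fun ζ => z + ζ) ⁻¹' cell z ε with hS
  have hSm : MeasurableSet S := (measurableSet_cell z ε).preimage (measurable_const_add z)
  have hmp : MeasurePreserving (fun ζ : CSpace d => z + ζ) := measurePreserving_add_left volume z
  have hvol : volume S = volume (cell z ε) :=
    hmp.measure_preimage (measurableSet_cell z ε).nullMeasurableSet
  have hmean := enorm_rpow_mul_volume_le isOpen_tube hSm hf (z := z)
    (fun u hu ζ => ⟨fun h => by
        have h2 := add_smul_mem_cell (z := z) (ζ := u • ζ) h (u := u⁻¹) (by simp [hu])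
        have hu0 : u ≠ 0 := fun h0 => by simp [h0] at hu
        rwa [smul_smul, inv_mul_cancel₀ hu0, one_smul] at h2,
      fun h => add_smul_mem_cell h hu.le⟩)
    (fun ζ hζ u hu => cell_subset_tube hz hε hε' (add_smul_mem_cell hζ hu)) hq
  have htrans : ∫⁻ ζ in S, ‖f (z + ζ)‖ₑ ^ q = ∫⁻ w in cell z ε, ‖f w‖ₑ ^ q :=
    hmp.setLIntegral_comp_preimage_emb (measurableEmbedding_addLeft z)
      (fun w => ‖f w‖ₑ ^ q) (cell z ε)
  rw [htrans, hvol, volume_cell hz hε] at hmean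
  -- ρ(w) and ρ(z) agree up to a factor 2 on the cell; the absolute value covers both signs of α.
  have hweight : ∀ w ∈ cell z ε, ENNReal.ofReal (2 ^ (-|α|) * rho z ^ α) ≤
      ENNReal.ofReal (rho w ^ α) := by
    intro w hw
    obtain ⟨hl, hu⟩ := rho_bounds_of_mem_cell hz hε hε' hw
    have hρw : 0 < rho w := by linarith
    refine ENNReal.ofReal_le_ofReal ?_
    rcases le_total 0 α with h | h
    · rw [abs_of_nonneg h, Real.rpow_neg zero_le_two, ← Real.inv_rpow zero_le_two,
        ← Real.mul_rpow (by norm_num) hρ.le]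
      exact Real.rpow_le_rpow (by positivity) (by linarith) h
    · rw [abs_of_nonpos h, neg_neg, ← Real.mul_rpow (by norm_num) hρ.le]
      exact Real.rpow_le_rpow_of_nonpos hρw hu h
  have hint : ENNReal.ofReal (2 ^ (-|α|) * rho z ^ α) * ∫⁻ w in cell z ε, ‖f w‖ₑ ^ q ≤
      ∫⁻ w in cell z ε, ‖f w‖ₑ ^ q ∂weightedVolume d α := by
    rw [← lintegral_indicator (μ := weightedVolume d α) (measurableSet_cell z ε),
      lintegral_weightedVolume]
    have e : ∀ w, ENNReal.ofReal (rho w ^ α) * (cell z ε).indicator (fun w => ‖f w‖ₑ ^ q) w =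
        (cell z ε).indicator (fun w => ENNReal.ofReal (rho w ^ α) * ‖f w‖ₑ ^ q) w := by
      intro w
      by_cases hw : w ∈ cell z ε
      · simp [hw]
      · simp [hw]
    simp_rw [e]
    rw [lintegral_indicator (measurableSet_cell z ε), Measure.restrict_restrict
      (measurableSet_cell z ε), Set.inter_eq_left.2 (cell_subset_tube hz hε hε'),
      ← lintegral_const_mul' _ _ ENNReal.ofReal_ne_top]
    exact setLIntegral_mono' (measurableSet_cell z ε) fun w hw =>
      mul_le_mul_left (hweight w hw) _
  refine le_trans ?_ (mul_le_mul_right hint _)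
  rw [← mul_assoc, ← ENNReal.ofReal_mul (by positivity)]
  have hc : 2 ^ |α| / V * rho z ^ (-kernelExp d α) * (2 ^ (-|α|) * rho z ^ α) =
      (V * rho z ^ ((d : ℝ) + 2))⁻¹ := by
    have : -kernelExp d α = -α + -((d : ℝ) + 2) := by
      rw [kernelExp_eq]
      ring
    rw [this, Real.rpow_add hρ, Real.rpow_neg zero_le_two, Real.rpow_neg hρ.le,
      Real.rpow_neg hρ.le]
    have h1 : (0 : ℝ) < 2 ^ |α| := by positivity
    have h2 : 0 < rho z ^ α := by positivity
    field_simp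
  have hpos : 0 < V * rho z ^ ((d : ℝ) + 2) := by positivity
  rw [hc, ENNReal.ofReal_inv_of_pos hpos, mul_comm, ← div_eq_mul_inv]
  rw [ENNReal.le_div_iff_mul_le (Or.inl (by simpa using hpos)) (Or.inl ENNReal.ofReal_ne_top)]
  exact hmean

/-! ### The Bergman metric in coordinates. -/

/-- The partial derivatives of `ρ` with respect to the imaginary parts of the coordinates. -/
def rhoGrad (z : CSpace d) (j : Fin (d + 1)) : ℝ :=
  if j = Fin.last d then 1 else -2 * (z j).im

theorem rhoGrad_last (z : CSpace d) : rhoGrad z (Fin.last d) = 1 := if_pos rfl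

theorem rhoGrad_castSucc (z : CSpace d) (i : Fin d) :
    rhoGrad z i.castSucc = -2 * (z i.castSucc).im := if_neg (Fin.castSucc_ne_last i)

/-- The imaginary part of the `j`-th coordinate as a real-linear form. -/
noncomputable def imCoord (j : Fin (d + 1)) : CSpace d →L[ℝ] ℝ :=
  Complex.imCLM.comp (ContinuousLinearMap.proj j)

@[simp] theorem imCoord_apply (j : Fin (d + 1)) (v : CSpace d) : imCoord j v = (v j).im := rfl

theorem hasFDerivAt_im (z : CSpace d) (j : Fin (d + 1)) :
    HasFDerivAt (fun ζ : CSpace d => (ζ j).im) (imCoord j) z := (imCoord j).hasFDerivAt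

theorem hasFDerivAt_rho (z : CSpace d) :
    HasFDerivAt rho (∑ j, rhoGrad z j • imCoord j) z := by
  have h : HasFDerivAt (rho (d := d)) (imCoord (Fin.last d) - ∑ i : Fin d,
      (2 * (z i.castSucc).im ^ 1) • imCoord i.castSucc) z :=
    (hasFDerivAt_im z _).sub (HasFDerivAt.fun_sum fun i _ => by
      simpa using (hasFDerivAt_im z i.castSucc).pow 2)
  convert h using 1
  ext v
  simp [Fin.sum_univ_castSucc, rhoGrad_last, rhoGrad_castSucc, sub_eq_neg_add]

theorem hasFDerivAt_rhoGrad (z : CSpace d) (j : Fin (d + 1)) :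
    HasFDerivAt (fun ζ : CSpace d => rhoGrad ζ j)
      (if j = Fin.last d then 0 else (-2 : ℝ) • imCoord j) z := by
  unfold rhoGrad
  split_ifs
  · exact hasFDerivAt_const _ _
  · exact (hasFDerivAt_im z j).const_mul (-2)

theorem fderiv_ofReal_apply {g : CSpace d → ℝ} {g' : CSpace d →L[ℝ] ℝ} {z : CSpace d}
    (h : HasFDerivAt g g' z) (v : CSpace d) :
    fderiv ℝ (fun ζ => (g ζ : ℂ)) z v = (g' v : ℂ) := by
  have h1 : HasFDerivAt (fun ζ => (g ζ : ℂ)) (Complex.ofRealCLM.comp g') z :=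
    Complex.ofRealCLM.hasFDerivAt.comp z h
  rw [h1.fderiv]
  rfl

theorem fderiv_ofReal_mul_I_apply {g : CSpace d → ℝ} {g' : CSpace d →L[ℝ] ℝ} {z : CSpace d}
    (h : HasFDerivAt g g' z) (v : CSpace d) :
    fderiv ℝ (fun ζ => Complex.I * (g ζ : ℂ)) z v = Complex.I * (g' v : ℂ) := by
  have h1 : HasFDerivAt (fun ζ => (g ζ : ℂ)) (Complex.ofRealCLM.comp g') z :=
    Complex.ofRealCLM.hasFDerivAt.comp z h
  rw [(h1.const_mul Complex.I).fderiv]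
  rfl

theorem imCoord_single (i j : Fin (d + 1)) (a : ℂ) :
    imCoord j (Pi.single i a) = if i = j then a.im else 0 := by
  rcases eq_or_ne i j with rfl | h
  · simp
  · simp [h]

/-- The constant in the Bergman kernel. -/
noncomputable def kernelConst (d : ℕ) (α : ℝ) : ℝ :=
  Real.Gamma ((d + 1 : ℕ) + α + 1) /
      (2 ^ (d + 2) * Real.pi ^ (d + 1) * Real.Gamma (α + 1))

theorem kernelConst_pos {α : ℝ} (hα : -1 < α) : 0 < kernelConst d α := by
  have h1 : 0 < Real.Gamma ((d + 1 : ℕ) + α + 1) :=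
    Real.Gamma_pos_of_pos (by push_cast; have : (0 : ℝ) ≤ d := Nat.cast_nonneg d; linarith)
  have h2 : 0 < Real.Gamma (α + 1) := Real.Gamma_pos_of_pos (by linarith)
  have := Real.pi_pos
  unfold kernelConst
  positivity

theorem bergmanKernel_eq (α : ℝ) (z w : CSpace d) :
    bergmanKernel α z w = (kernelConst d α : ℂ) * rhoPair z w ^ ((-kernelExp d α : ℝ) : ℂ) := by
  rw [bergmanKernel, kernelConst, kernelExp, div_eq_mul_inv, Complex.ofReal_neg, Complex.cpow_neg]

theorem norm_bergmanKernel {α : ℝ} (hα : -1 < α) (z w : CSpace d) :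
    ‖bergmanKernel α z w‖ = kernelConst d α * ‖rhoPair z w‖ ^ (-kernelExp d α) := by
  rw [bergmanKernel_eq, norm_mul, Complex.norm_cpow_real, Complex.norm_real,
    Real.norm_of_nonneg (kernelConst_pos hα).le]

theorem bergmanKernel_self {α : ℝ} {z : CSpace d} (hz : z ∈ tube d) :
    bergmanKernel α z z = ((kernelConst d α * rho z ^ (-kernelExp d α) : ℝ) : ℂ) := by
  rw [bergmanKernel_eq, rhoPair_self, ← Complex.ofReal_cpow (mem_tube_iff.1 hz).le,
    Complex.ofReal_mul]

theorem log_bergmanKernel_zero {z : CSpace d} (hz : z ∈ tube d) :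
    Real.log (bergmanKernel 0 z z).re =
      Real.log (kernelConst d 0) - ((d : ℝ) + 2) * Real.log (rho z) := by
  have hρ := mem_tube_iff.1 hz
  rw [bergmanKernel_self hz, Complex.ofReal_re, Real.log_mul
    (kernelConst_pos (by norm_num)).ne' (by positivity), Real.log_rpow hρ, kernelExp_eq]
  ring

/-- On the diagonal log K₀ equals a constant minus (d + 2) log ρ, a function of Im z alone. On such
functions ∂/∂z_j is -(i/2) ∂/∂y_j. -/
theorem dz_log_bergmanKernel {z : CSpace d} (hz : z ∈ tube d) (j : Fin (d + 1)) :
    dz j (fun ζ => ((Real.log (bergmanKernel 0 ζ ζ).re : ℝ) : ℂ)) z =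
      Complex.I * ((((d : ℝ) + 2) / 2 * (rhoGrad z j * (rho z)⁻¹) : ℝ) : ℂ) := by
  have hρ := mem_tube_iff.1 hz
  have heq : (fun ζ : CSpace d => ((Real.log (bergmanKernel 0 ζ ζ).re : ℝ) : ℂ)) =ᶠ[nhds z]
      fun ζ => ((Real.log (kernelConst d 0) - ((d : ℝ) + 2) * Real.log (rho ζ) : ℝ) : ℂ) := by
    filter_upwards [isOpen_tube.mem_nhds hz] with ζ hζ
    rw [log_bergmanKernel_zero hζ]
  have hd := (((hasFDerivAt_rho z).log hρ.ne').const_mul ((d : ℝ) + 2)).const_sub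
    (Real.log (kernelConst d 0))
  rw [dz, heq.fderiv_eq, fderiv_ofReal_apply hd, fderiv_ofReal_apply hd]
  simp only [neg_apply, smul_apply,
    sum_apply, imCoord_single, smul_eq_mul]
  simp
  ring

/-- Since ∂/∂z̄_i acts as (i/2) ∂/∂y_i, the matrix is a quarter of the Hessian of -log ρ in y: a
rank-one part from the gradient of ρ, and a diagonal part from its constant second derivatives -2 in
the first `d` directions. -/
theorem bergmanMatrix_apply {z : CSpace d} (hz : z ∈ tube d) (i j : Fin (d + 1)) :
    bergmanMatrix z i j = (((rhoGrad z i * rhoGrad z j / rho z ^ 2 +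
      if i = j ∧ j ≠ Fin.last d then 2 / rho z else 0) / 4 : ℝ) : ℂ) := by
  have hρ := mem_tube_iff.1 hz
  have heq : (dz j fun ζ : CSpace d => ((Real.log (bergmanKernel 0 ζ ζ).re : ℝ) : ℂ)) =ᶠ[nhds z]
      fun ζ => Complex.I * ((((d : ℝ) + 2) / 2 * (rhoGrad ζ j * (rho ζ)⁻¹) : ℝ) : ℂ) := by
    filter_upwards [isOpen_tube.mem_nhds hz] with ζ hζ
    rw [dz_log_bergmanKernel hζ]
  have hd := ((hasFDerivAt_rhoGrad z j).mul
    ((hasDerivAt_inv hρ.ne').comp_hasFDerivAt z (hasFDerivAt_rho z))).const_mul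
    (((d : ℝ) + 2) / 2)
  rw [bergmanMatrix, Matrix.of_apply, dzbar, heq.fderiv_eq]
  erw [fderiv_ofReal_mul_I_apply hd, fderiv_ofReal_mul_I_apply hd]
  have h0 : ∀ a : ℂ, (∑ k, rhoGrad z k • imCoord k) (Pi.single i a) = rhoGrad z i * a.im := by
    intro a
    simp only [sum_apply, smul_apply, imCoord_single,
      smul_eq_mul]
    simp
  have h1 : ∀ a : ℂ, (if j = Fin.last d then (0 : CSpace d →L[ℝ] ℝ) else (-2 : ℝ) • imCoord j)
      (Pi.single i a) = if i = j ∧ j ≠ Fin.last d then -2 * a.im else 0 := by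
    intro a
    split_ifs with h2 h3 h3
    · exact absurd h2 h3.2
    · rfl
    · simp [h3.1]
    · have : i ≠ j := fun h => h3 ⟨h, h2⟩
      simp [this]
  simp only [smul_apply, add_apply, h0, h1, smul_eq_mul]
  have hd0 : (d : ℂ) + 2 ≠ 0 := by
    exact_mod_cast (by positivity : (d : ℝ) + 2 ≠ 0)
  have hρ' : (rho z : ℂ) ≠ 0 := by exact_mod_cast hρ.ne'
  by_cases h : i = j ∧ j ≠ Fin.last d
  · rw [if_pos h, if_pos h, if_pos h]
    simp only [Function.comp_apply, Complex.one_im, Complex.I_im]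
    push_cast
    field_simp
    ring_nf
    rw [Complex.I_sq]
    ring
  · rw [if_neg h, if_neg h, if_neg h]
    simp only [Function.comp_apply, Complex.one_im, Complex.I_im]
    push_cast
    field_simp
    ring_nf
    rw [Complex.I_sq]
    ring

/-- The Bergman quadratic form in coordinates. -/
theorem bergmanForm_eq {z : CSpace d} (hz : z ∈ tube d) (v : CSpace d) :
    (star v ⬝ᵥ (bergmanMatrix z *ᵥ v)).re = (∑ i : Fin d, ‖v i.castSucc‖ ^ 2) / (2 * rho z) +
      ‖v (Fin.last d) / 2 - ∑ i : Fin d, ((z i.castSucc).im : ℂ) * v i.castSucc‖ ^ 2 /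
        rho z ^ 2 := by
  have hρ := mem_tube_iff.1 hz
  set κ : ℂ := v (Fin.last d) / 2 - ∑ i : Fin d, ((z i.castSucc).im : ℂ) * v i.castSucc with hκ
  -- The gradient of ρ paired with `v`: the rank-one part of the matrix becomes |2κ|² / (4ρ²).
  have hsum : ∑ j, (rhoGrad z j : ℂ) * v j = 2 * κ := by
    rw [Fin.sum_univ_castSucc, hκ, rhoGrad_last]
    simp only [rhoGrad_castSucc]
    rw [mul_sub, Finset.mul_sum, sub_eq_neg_add, ← Finset.sum_neg_distrib]
    congr 1
    · refine Finset.sum_congr rfl fun i _ => ?_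
      push_cast
      ring
    · push_cast
      ring
  have hdiag : ∑ j, (if j ≠ Fin.last d then star (v j) * v j else 0) =
      ((∑ i : Fin d, ‖v i.castSucc‖ ^ 2 : ℝ) : ℂ) := by
    rw [Fin.sum_univ_castSucc]
    simp [Complex.conj_mul']
  have hrow : ∀ i, (bergmanMatrix z *ᵥ v) i = (rhoGrad z i : ℂ) * (2 * κ) / (4 * rho z ^ 2) +
      (if i ≠ Fin.last d then v i else 0) / (2 * rho z) := by
    intro i
    rw [← hsum, Matrix.mulVec, dotProduct, Finset.mul_sum, Finset.sum_div]
    have : (if i ≠ Fin.last d then v i else 0) / (2 * (rho z : ℂ)) =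
        ∑ j, if i = j then (if j ≠ Fin.last d then v j else 0) / (2 * (rho z : ℂ)) else 0 := by
      simp
    rw [this, ← Finset.sum_add_distrib]
    refine Finset.sum_congr rfl fun j _ => ?_
    rw [bergmanMatrix_apply hz]
    have hρ' : (rho z : ℂ) ≠ 0 := by exact_mod_cast hρ.ne'
    by_cases h1 : i = j
    · by_cases h2 : j = Fin.last d
      · simp only [h1, h2, ne_eq, not_true_eq_false, and_false, if_false, if_true]
        push_cast
        field_simp
        ring
      · simp only [h1, h2, ne_eq, not_false_eq_true, and_true, if_true]
        push_cast
        field_simp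
        ring
    · simp only [h1, false_and, if_false]
      push_cast
      field_simp
      ring
  have htot : star v ⬝ᵥ (bergmanMatrix z *ᵥ v) =
      star (2 * κ) * (2 * κ) / (4 * rho z ^ 2) +
        (∑ j, (if j ≠ Fin.last d then star (v j) * v j else 0)) / (2 * rho z) := by
    rw [dotProduct, ← hsum, star_sum, Finset.sum_mul, Finset.sum_div, Finset.sum_div,
      ← Finset.sum_add_distrib, hsum]
    refine Finset.sum_congr rfl fun j _ => ?_
    rw [hrow, Pi.star_apply, star_mul']
    have : star (rhoGrad z j : ℂ) = rhoGrad z j := Complex.conj_ofReal _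
    rw [this]
    split_ifs <;> ring
  have hreal : star v ⬝ᵥ (bergmanMatrix z *ᵥ v) =
      (((∑ i : Fin d, ‖v i.castSucc‖ ^ 2) / (2 * rho z) + ‖κ‖ ^ 2 / rho z ^ 2 : ℝ) : ℂ) := by
    rw [htot, hdiag]
    have : star (2 * κ) * (2 * κ) = 4 * ((‖κ‖ ^ 2 : ℝ) : ℂ) := by
      have h := Complex.conj_mul' (2 * κ)
      rw [Complex.star_def, h, norm_mul]
      push_cast
      simp
      ring
    rw [this]
    push_cast
    rw [mul_div_mul_left _ _ (by norm_num : (4 : ℂ) ≠ 0)]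
    ring
  rw [hreal, Complex.ofReal_re]

/-! ### Bergman balls between cells and sublevel sets of |ρ(z,·)|. -/

theorem curveLength_nonneg (γ : ℝ → CSpace d) : 0 ≤ curveLength γ :=
  intervalIntegral.integral_nonneg zero_le_one fun _ _ => Real.sqrt_nonneg _

theorem hasDerivAt_segment (z η : CSpace d) (t : ℝ) :
    HasDerivAt (fun s : ℝ => z + s • η) η t := by
  simpa using ((hasDerivAt_id t).smul_const η).const_add z

theorem segment_mem_tube {z w : CSpace d} (hz : z ∈ tube d) (hw : w ∈ tube d) {t : ℝ}
    (ht : t ∈ Set.Icc (0 : ℝ) 1) : z + t • (w - z) ∈ tube d :=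
  convex_tube.add_smul_sub_mem hz hw ht

theorem contDiff_segment (z η : CSpace d) :
    ContDiff ℝ (⊤ : ℕ∞) fun s : ℝ => z + s • η :=
  contDiff_const.add (contDiff_id.smul contDiff_const)

/-- The lengths of the smooth curves in the tube from `z` to `w`. -/
def curveLengths (z w : CSpace d) : Set ℝ :=
  {l | ∃ γ : ℝ → CSpace d, ContDiffOn ℝ (⊤ : ℕ∞) γ (Set.Icc 0 1) ∧
    (∀ t ∈ Set.Icc (0 : ℝ) 1, γ t ∈ tube d) ∧ γ 0 = z ∧ γ 1 = w ∧ l = curveLength γ}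

theorem bergmanDist_eq (z w : CSpace d) : bergmanDist z w = sInf (curveLengths z w) := rfl

theorem curveLength_segment_mem {z w : CSpace d} (hz : z ∈ tube d) (hw : w ∈ tube d) :
    curveLength (fun t : ℝ => z + t • (w - z)) ∈ curveLengths z w := by
  refine Set.mem_ofPred_eq.symm.mp ?_
  exact ⟨_, (contDiff_segment z (w - z)).contDiffOn, fun t ht => segment_mem_tube hz hw ht,
    by simp, by simp, rfl⟩

theorem bergmanDist_le_of_segment {z w : CSpace d} (hz : z ∈ tube d) (hw : w ∈ tube d) {M : ℝ}
    (hM : 0 ≤ M) (h : ∀ t ∈ Set.Icc (0 : ℝ) 1,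
      (star (w - z) ⬝ᵥ (bergmanMatrix (z + t • (w - z)) *ᵥ (w - z))).re ≤ M ^ 2) :
    bergmanDist z w ≤ M := by
  set γ : ℝ → CSpace d := fun t => z + t • (w - z) with hγ
  have hlen : curveLength γ ≤ M := by
    have hb : ∀ t ∈ Set.uIoc (0 : ℝ) 1, ‖Real.sqrt (star (derivWithin γ (Set.Icc 0 1) t) ⬝ᵥ
      (bergmanMatrix (γ t) *ᵥ derivWithin γ (Set.Icc 0 1) t)).re‖ ≤ M := by
      intro t ht
      rw [Set.uIoc_of_le zero_le_one] at ht
      have ht' : t ∈ Set.Icc (0 : ℝ) 1 := ⟨ht.1.le, ht.2⟩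
      rw [(hasDerivAt_segment z (w - z) t).hasDerivWithinAt.derivWithin
        (uniqueDiffOn_Icc zero_lt_one t ht'), Real.norm_of_nonneg (Real.sqrt_nonneg _)]
      exact Real.sqrt_le_iff.2 ⟨hM, h t ht'⟩
    have := intervalIntegral.norm_integral_le_of_norm_le_const hb
    rw [sub_zero, abs_one, mul_one] at this
    exact (le_abs_self _).trans this
  rw [bergmanDist_eq]
  refine (csInf_le ⟨0, ?_⟩ (curveLength_segment_mem hz hw)).trans hlen
  rintro l ⟨γ', -, -, -, -, rfl⟩
  exact curveLength_nonneg γ'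

/-- The segment stays in the cell, where ρ ≥ ρ(z)/2. The coordinates other than the last contribute
at most d ε² and the last form at most 3 ε². -/
theorem bergmanForm_le_of_mem_cell {z η : CSpace d} {ε : ℝ} (hz : z ∈ tube d) (hε : 0 < ε)
    (hε' : 4 * (d + 1) * ε ≤ 1) (hη : z + η ∈ cell z ε) {s : ℝ} (hs : s ∈ Set.Icc (0 : ℝ) 1) :
    (star η ⬝ᵥ (bergmanMatrix (z + s • η) *ᵥ η)).re ≤ ((d + 3) * ε) ^ 2 := by
  have hρ := mem_tube_iff.1 hz
  have hd : (0 : ℝ) ≤ d := Nat.cast_nonneg d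
  have hmem : z + s • η ∈ cell z ε := by
    have := add_smul_mem_cell hη (u := (s : ℂ)) (by
      rw [Complex.norm_real, Real.norm_of_nonneg hs.1]
      exact hs.2)
    rwa [Complex.coe_smul] at this
  have hρs := (rho_bounds_of_mem_cell hz hε hε' hmem).1
  rw [bergmanForm_eq (cell_subset_tube hz hε hε' hmem)]
  set R := rho (z + s • η) with hR
  obtain ⟨h1, h2⟩ := hη
  simp only [Pi.add_apply, add_sub_cancel_left] at h1 h2
  have hsq : ∀ i : Fin d, ‖η i.castSucc‖ ^ 2 ≤ ε ^ 2 * rho z := fun i => by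
    calc ‖η i.castSucc‖ ^ 2 ≤ (ε * √(rho z)) ^ 2 :=
          pow_le_pow_left₀ (norm_nonneg _) (h1 i).le 2
      _ = ε ^ 2 * rho z := by rw [mul_pow, Real.sq_sqrt hρ.le]
  have hS : ∑ i : Fin d, ‖η i.castSucc‖ ^ 2 ≤ d * (ε ^ 2 * rho z) := by
    calc _ ≤ ∑ _i : Fin d, ε ^ 2 * rho z := Finset.sum_le_sum fun i _ => hsq i
      _ = _ := by simp
  -- Moving the base point from z to z + sη changes the form only by a term quadratic in the first
  -- coordinates of η, hence of size ε² ρ(z).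
  have hκ : η (Fin.last d) / 2 - ∑ i : Fin d, (((z + s • η) i.castSucc).im : ℂ) * η i.castSucc =
      (1 / 2 : ℝ) * (η (Fin.last d) - 2 * ∑ i : Fin d, ((z i.castSucc).im : ℂ) * η i.castSucc) -
        (s : ℂ) * ∑ i : Fin d, ((η i.castSucc).im : ℂ) * η i.castSucc := by
    have : ∑ i : Fin d, (((z + s • η) i.castSucc).im : ℂ) * η i.castSucc =
        ∑ i : Fin d, ((z i.castSucc).im : ℂ) * η i.castSucc +
          (s : ℂ) * ∑ i : Fin d, ((η i.castSucc).im : ℂ) * η i.castSucc := by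
      rw [Finset.mul_sum, ← Finset.sum_add_distrib]
      refine Finset.sum_congr rfl fun i _ => ?_
      simp only [Pi.add_apply, Pi.smul_apply, Complex.add_im, Complex.smul_im, smul_eq_mul]
      push_cast
      ring
    rw [this]
    push_cast
    ring
  have hT : ‖∑ i : Fin d, ((η i.castSucc).im : ℂ) * η i.castSucc‖ ≤ d * (ε ^ 2 * rho z) := by
    refine (norm_sum_le _ _).trans ?_
    calc _ ≤ ∑ _i : Fin d, ε ^ 2 * rho z := by
          refine Finset.sum_le_sum fun i _ => le_trans ?_ (hsq i)
          rw [norm_mul, Complex.norm_real, Real.norm_eq_abs, pow_two]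
          exact mul_le_mul_of_nonneg_right (Complex.abs_im_le_norm _) (norm_nonneg _)
      _ = _ := by simp
  have hκn : ‖η (Fin.last d) / 2 - ∑ i : Fin d, (((z + s • η) i.castSucc).im : ℂ) *
      η i.castSucc‖ ≤ 3 / 4 * ε * rho z := by
    rw [hκ]
    refine (norm_sub_le _ _).trans ?_
    rw [norm_mul, norm_mul, Complex.norm_real, Complex.norm_real, Real.norm_of_nonneg hs.1,
      Real.norm_of_nonneg (by norm_num)]
    have h3 : s * ‖∑ i : Fin d, ((η i.castSucc).im : ℂ) * η i.castSucc‖ ≤ d * (ε ^ 2 * rho z) :=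
      (mul_le_of_le_one_left (norm_nonneg _) hs.2).trans hT
    have h4 : d * (ε ^ 2 * rho z) ≤ 1 / 4 * ε * rho z := by
      have : d * ε ≤ 1 / 4 := by nlinarith
      nlinarith [mul_le_mul_of_nonneg_right this (mul_nonneg hε.le hρ.le)]
    linarith
  have hA : (∑ i : Fin d, ‖η i.castSucc‖ ^ 2) / (2 * R) ≤ d * ε ^ 2 := by
    rw [div_le_iff₀ (by linarith)]
    nlinarith [mul_nonneg hd (sq_nonneg ε)]
  have hB : ‖η (Fin.last d) / 2 - ∑ i : Fin d, (((z + s • η) i.castSucc).im : ℂ) *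
      η i.castSucc‖ ^ 2 / R ^ 2 ≤ 3 * ε ^ 2 := by
    rw [div_le_iff₀ (by have : 0 < R := by linarith
                        positivity)]
    have h5 := pow_le_pow_left₀ (norm_nonneg _) hκn 2
    have h6 : (rho z / 2) ^ 2 ≤ R ^ 2 := pow_le_pow_left₀ (by positivity) hρs 2
    nlinarith [mul_nonneg (sq_nonneg ε) (sq_nonneg (rho z)),
      mul_le_mul_of_nonneg_left h6 (sq_nonneg ε)]
  nlinarith [sq_nonneg ε, mul_nonneg hd (sq_nonneg ε), mul_nonneg (mul_nonneg hd hd) (sq_nonneg ε)]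

/-- Small cells are contained in Bergman balls of a given radius, and symmetrically. -/
theorem exists_cell_subset_bergmanBall (d : ℕ) {r : ℝ} (hr : 0 < r) :
    ∃ ε : ℝ, 0 < ε ∧ 4 * (d + 1) * ε ≤ 1 ∧ ∀ z ∈ tube d, ∀ w ∈ cell z ε,
      w ∈ bergmanBall z r ∧ z ∈ bergmanBall w r := by
  set ε : ℝ := min (1 / (4 * (d + 1))) (r / (2 * (d + 3))) with hεdef
  have hd : (0 : ℝ) ≤ d := Nat.cast_nonneg d
  have hε : 0 < ε := lt_min (by positivity) (by positivity)
  have hε' : 4 * (d + 1) * ε ≤ 1 := by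
    have := min_le_left (1 / (4 * ((d : ℝ) + 1))) (r / (2 * (d + 3)))
    rw [le_div_iff₀ (by positivity)] at this
    linarith
  have hεr : (d + 3) * ε < r := by
    have := min_le_right (1 / (4 * ((d : ℝ) + 1))) (r / (2 * (d + 3)))
    rw [le_div_iff₀ (by positivity)] at this
    nlinarith
  refine ⟨ε, hε, hε', fun z hz w hw => ?_⟩
  have hwt := cell_subset_tube hz hε hε' hw
  have hw' : z + (w - z) ∈ cell z ε := by rwa [add_sub_cancel]
  refine ⟨⟨hwt, lt_of_le_of_lt ?_ hεr⟩, ⟨hz, lt_of_le_of_lt ?_ hεr⟩⟩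
  · exact bergmanDist_le_of_segment hz hwt (by positivity) fun t ht =>
      bergmanForm_le_of_mem_cell hz hε hε' hw' ht
  -- The quadratic form is even, so the reversed segment satisfies the same bound with parameter 1 -
  -- t.
  · refine bergmanDist_le_of_segment hwt hz (by positivity) fun t ht => ?_
    have h := bergmanForm_le_of_mem_cell hz hε hε' hw' (s := 1 - t)
      ⟨by linarith [ht.2], by linarith [ht.1]⟩
    have e1 : z + (1 - t) • (w - z) = w + t • (z - w) := by
      rw [sub_smul, one_smul, smul_sub, smul_sub]
      abel
    rw [e1] at h
    have e2 : z - w = -(w - z) := (neg_sub w z).symm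
    have e3 : w + t • -(w - z) = w + t • (z - w) := by rw [e2]
    rw [e2, e3, Matrix.mulVec_neg, star_neg, neg_dotProduct_neg]
    exact h

/-- Writing γ̄ = γ - 2i Im γ regroups the derivative into the form κ of `bergmanForm_eq` and a
pairing with z' - γ', both of which the metric and |ρ(z,γ)| control. -/
theorem hasDerivAt_rhoPair_curve (z : CSpace d) {γ : ℝ → CSpace d} {v : CSpace d} {t : ℝ}
    (h : HasDerivAt γ v t) :
    HasDerivAt (fun s => rhoPair z (γ s))
      (Complex.I * star (v (Fin.last d) / 2 -
          ∑ i : Fin d, ((γ t i.castSucc).im : ℂ) * v i.castSucc) -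
        (1 / 2) * ∑ i : Fin d, (z i.castSucc - γ t i.castSucc) * star (v i.castSucc)) t := by
  have hc : ∀ j, HasDerivAt (fun s => star (γ s j)) (star (v j)) t := fun j =>
    (hasDerivAt_pi.1 h j).star
  have h1 : HasDerivAt (fun s => rhoPair z (γ s)) ((1 / 4) *
      (∑ i : Fin d, ((2 : ℕ) : ℂ) * (z i.castSucc - star (γ t i.castSucc)) ^ (2 - 1) *
        (-star (v i.castSucc)) - 2 * Complex.I * (-star (v (Fin.last d))))) t := by
    unfold rhoPair
    refine HasDerivAt.const_mul _ (HasDerivAt.sub (HasDerivAt.fun_sum fun i _ => ?_) ?_)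
    · exact ((hc i.castSucc).const_sub _).pow 2
    · exact ((hc (Fin.last d)).const_sub _).const_mul _
  convert h1 using 1
  have hstar : star (v (Fin.last d) / 2 - ∑ i : Fin d, ((γ t i.castSucc).im : ℂ) * v i.castSucc) =
      star (v (Fin.last d)) / 2 - ∑ i : Fin d, ((γ t i.castSucc).im : ℂ) * star (v i.castSucc) := by
    rw [star_sub, star_sum]
    congr 1
    · simp
    · refine Finset.sum_congr rfl fun i _ => ?_
      simp
  rw [hstar]
  have hterm : ∑ i : Fin d, ((2 : ℕ) : ℂ) * (z i.castSucc - star (γ t i.castSucc)) ^ (2 - 1) *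
        (-star (v i.castSucc)) =
      (-2) * ∑ i : Fin d, (z i.castSucc - γ t i.castSucc) * star (v i.castSucc) -
        4 * Complex.I * ∑ i : Fin d, ((γ t i.castSucc).im : ℂ) * star (v i.castSucc) := by
    rw [Finset.mul_sum, Finset.mul_sum, ← Finset.sum_sub_distrib]
    refine Finset.sum_congr rfl fun i _ => ?_
    have : star (γ t i.castSucc) = γ t i.castSucc - 2 * Complex.I * ((γ t i.castSucc).im : ℂ) := by
      have := Complex.sub_conj (γ t i.castSucc)
      rw [Complex.star_def]
      push_cast at this
      linear_combination -this
    rw [this]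
    push_cast
    ring
  rw [hterm]
  ring

/-- The function `log ρ(z, ·)` is Lipschitz for the Bergman metric. -/
theorem norm_deriv_rhoPair_le {w : CSpace d} (hw : w ∈ tube d) {z : CSpace d} (hz : z ∈ tube d)
    (v : CSpace d) :
    ‖Complex.I * star (v (Fin.last d) / 2 - ∑ i : Fin d, ((w i.castSucc).im : ℂ) * v i.castSucc) -
        (1 / 2) * ∑ i : Fin d, (z i.castSucc - w i.castSucc) * star (v i.castSucc)‖ ≤
      3 * √(star v ⬝ᵥ (bergmanMatrix w *ᵥ v)).re * ‖rhoPair z w‖ := by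
  have hρ := mem_tube_iff.1 hw
  rw [bergmanForm_eq hw]
  set κ := v (Fin.last d) / 2 - ∑ i : Fin d, ((w i.castSucc).im : ℂ) * v i.castSucc
  set S := ∑ i : Fin d, ‖v i.castSucc‖ ^ 2 with hS
  set P := ∑ i : Fin d, ‖z i.castSucc - w i.castSucc‖ ^ 2 with hP
  have hS0 : 0 ≤ S := Finset.sum_nonneg fun _ _ => by positivity
  have hP0 : 0 ≤ P := Finset.sum_nonneg fun _ _ => by positivity
  set b := √(S / (2 * rho w) + ‖κ‖ ^ 2 / rho w ^ 2) with hb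
  have hb0 : 0 ≤ b := Real.sqrt_nonneg _
  have hbsq : b ^ 2 = S / (2 * rho w) + ‖κ‖ ^ 2 / rho w ^ 2 := Real.sq_sqrt (by positivity)
  have hκb : ‖κ‖ ≤ rho w * b := by
    refine le_of_sq_le_sq ?_ (by positivity)
    rw [mul_pow, hbsq, mul_add, mul_div_cancel₀ _ (by positivity)]
    exact le_add_of_nonneg_left (by positivity)
  have hSb : √S ≤ √(2 * rho w) * b := by
    refine le_of_sq_le_sq ?_ (by positivity)
    rw [mul_pow, hbsq, Real.sq_sqrt hS0, Real.sq_sqrt (by positivity), mul_add,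
      mul_div_cancel₀ _ (by positivity)]
    exact le_add_of_nonneg_right (by positivity)
  have hsum : ‖∑ i : Fin d, (z i.castSucc - w i.castSucc) * star (v i.castSucc)‖ ≤ √P * √S := by
    refine (norm_sum_le _ _).trans ?_
    refine le_trans (le_of_eq ?_) (Real.sum_mul_le_sqrt_mul_sqrt Finset.univ
      (fun i : Fin d => ‖z i.castSucc - w i.castSucc‖) fun i => ‖v i.castSucc‖)
    refine Finset.sum_congr rfl fun i _ => ?_
    rw [norm_mul, norm_star]
  have hN : P + 2 * rho w ≤ 4 * ‖rhoPair z w‖ := by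
    have h := Complex.re_le_norm (rhoPair z w)
    rw [rhoPair_re] at h
    have := mem_tube_iff.1 hz
    linarith
  -- Arithmetic–geometric mean applied to P + 2ρ(w) ≤ 4 |ρ(z,w)|. The constant 3 is then 2 from κ
  -- plus half of 2 from the sum.
  have hPρ : √P * √(2 * rho w) ≤ 2 * ‖rhoPair z w‖ := by
    have h1 := Real.sq_sqrt hP0
    have h2 := Real.sq_sqrt (by positivity : 0 ≤ 2 * rho w)
    nlinarith [sq_nonneg (√P - √(2 * rho w))]
  refine (norm_sub_le _ _).trans ?_
  rw [norm_mul, norm_mul, Complex.norm_I, norm_star, one_mul]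
  have h3 : √P * √S ≤ 2 * ‖rhoPair z w‖ * b := by
    calc √P * √S ≤ √P * (√(2 * rho w) * b) := mul_le_mul_of_nonneg_left hSb (Real.sqrt_nonneg _)
      _ = √P * √(2 * rho w) * b := by ring
      _ ≤ _ := mul_le_mul_of_nonneg_right hPρ hb0
  have h4 : rho w * b ≤ 2 * ‖rhoPair z w‖ * b :=
    mul_le_mul_of_nonneg_right (by linarith) hb0
  have h5 : ‖(1 / 2 : ℂ)‖ = 1 / 2 := by norm_num
  rw [h5]
  nlinarith [hsum, norm_nonneg (rhoPair z w)]

/-- The logarithmic derivative of ρ(γ(0), γ(t)) is at most three times the Bergman speed. Integrate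
it from the initial value ρ(γ(0)); the real part of the logarithm is the log of the modulus. -/
theorem norm_rhoPair_le_exp_curveLength {γ : ℝ → CSpace d}
    (hγ : ContDiffOn ℝ (⊤ : ℕ∞) γ (Set.Icc 0 1)) (hmem : ∀ t ∈ Set.Icc (0 : ℝ) 1, γ t ∈ tube d) :
    ‖rhoPair (γ 0) (γ 1)‖ ≤ Real.exp (3 * curveLength γ) * rho (γ 0) := by
  have h0 : γ 0 ∈ tube d := hmem 0 ⟨le_rfl, zero_le_one⟩
  have h1 : γ 1 ∈ tube d := hmem 1 ⟨zero_le_one, le_rfl⟩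
  set z := γ 0
  set v : ℝ → CSpace d := fun t => derivWithin γ (Set.Icc 0 1) t with hv
  have hγc : ContinuousOn γ (Set.Icc 0 1) := hγ.continuousOn
  have hvc : ContinuousOn v (Set.Icc 0 1) :=
    hγ.continuousOn_derivWithin (uniqueDiffOn_Icc zero_lt_one) (by simp)
  have hγi : ∀ j, ContinuousOn (fun t => γ t j) (Set.Icc 0 1) := fun j =>
    (continuous_apply j).comp_continuousOn hγc
  have hvi : ∀ j, ContinuousOn (fun t => v t j) (Set.Icc 0 1) := fun j =>
    (continuous_apply j).comp_continuousOn hvc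
  have him : ∀ j, ContinuousOn (fun t => ((γ t j).im : ℂ)) (Set.Icc 0 1) := fun j =>
    (Complex.continuous_ofReal.comp Complex.continuous_im).comp_continuousOn (hγi j)
  have hρc : ContinuousOn (fun t => rho (γ t)) (Set.Icc 0 1) := continuous_rho.comp_continuousOn hγc
  have hpc : ContinuousOn (fun t => rhoPair z (γ t)) (Set.Icc 0 1) :=
    (continuous_rhoPair_right z).comp_continuousOn hγc
  set D : ℝ → ℂ := fun t => Complex.I * star (v t (Fin.last d) / 2 -
      ∑ i : Fin d, ((γ t i.castSucc).im : ℂ) * v t i.castSucc) -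
    (1 / 2) * ∑ i : Fin d, (z i.castSucc - γ t i.castSucc) * star (v t i.castSucc) with hD
  have hDc : ContinuousOn D (Set.Icc 0 1) := by
    refine ContinuousOn.sub (continuousOn_const.mul (ContinuousOn.star
      (((hvi _).div_const 2).sub (continuousOn_finsetSum _ fun i _ => (him _).mul (hvi _)))))
      (continuousOn_const.mul (continuousOn_finsetSum _ fun i _ =>
        (continuousOn_const.sub (hγi _)).mul (hvi _).star))
  have hg'c : ContinuousOn (fun t => D t / rhoPair z (γ t)) (Set.Icc 0 1) :=
    hDc.div hpc fun t ht => rhoPair_ne_zero h0 (hmem t ht)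
  set b : ℝ → ℝ := fun t => √(star (v t) ⬝ᵥ (bergmanMatrix (γ t) *ᵥ v t)).re with hb
  have hbc : ContinuousOn b (Set.Icc 0 1) := by
    have : ContinuousOn (fun t => √((∑ i : Fin d, ‖v t i.castSucc‖ ^ 2) / (2 * rho (γ t)) +
      ‖v t (Fin.last d) / 2 - ∑ i : Fin d, ((γ t i.castSucc).im : ℂ) * v t i.castSucc‖ ^ 2 /
        rho (γ t) ^ 2)) (Set.Icc 0 1) := by
      refine Real.continuous_sqrt.comp_continuousOn (ContinuousOn.add (ContinuousOn.div
        (continuousOn_finsetSum _ fun i _ => (hvi _).norm.pow 2) (continuousOn_const.mul hρc)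
        fun t ht => ?_) (ContinuousOn.div (ContinuousOn.pow (ContinuousOn.norm
          (((hvi _).div_const 2).sub (continuousOn_finsetSum _ fun i _ => (him _).mul (hvi _))))
          2) (hρc.pow 2) fun t ht => ?_))
      · have := mem_tube_iff.1 (hmem t ht)
        positivity
      · have := mem_tube_iff.1 (hmem t ht)
        positivity
    refine this.congr fun t ht => ?_
    simp only [hb]
    rw [bergmanForm_eq (hmem t ht)]
  have hftc := intervalIntegral.integral_eq_sub_of_hasDerivAt_of_le zero_le_one
    (f := fun t => Complex.log (rhoPair z (γ t))) (f' := fun t => D t / rhoPair z (γ t))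
    (hpc.clog fun t ht => rhoPair_mem_slitPlane h0 (hmem t ht))
    (fun t ht => by
      have ht' : t ∈ Set.Icc (0 : ℝ) 1 := Set.Ioo_subset_Icc_self ht
      have hd : HasDerivAt γ (v t) t := by
        have := (hγ.differentiableOn (by simp) t ht').hasDerivWithinAt
        exact this.hasDerivAt (Icc_mem_nhds ht.1 ht.2)
      exact (hasDerivAt_rhoPair_curve z hd).clog_real (rhoPair_mem_slitPlane h0 (hmem t ht')))
    (hg'c.intervalIntegrable_of_Icc zero_le_one)
  have hle := intervalIntegral.norm_integral_le_of_norm_le (μ := volume) zero_le_one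
    (f := fun t => D t / rhoPair z (γ t)) (g := fun t => 3 * b t)
    (Filter.Eventually.of_forall fun t ht => by
      have ht' : t ∈ Set.Icc (0 : ℝ) 1 := ⟨ht.1.le, ht.2⟩
      rw [norm_div, div_le_iff₀ (norm_rhoPair_pos h0 (hmem t ht'))]
      exact norm_deriv_rhoPair_le (hmem t ht') h0 (v t))
    ((continuousOn_const.mul hbc).intervalIntegrable_of_Icc zero_le_one)
  rw [hftc, intervalIntegral.integral_const_mul] at hle
  have hlen : ∫ t in (0 : ℝ)..1, b t = curveLength γ := rfl
  rw [hlen] at hle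
  have hre := (Complex.re_le_norm _).trans hle
  rw [Complex.sub_re, Complex.log_re, Complex.log_re] at hre
  have hz : ‖rhoPair z (γ 0)‖ = rho z := by
    rw [rhoPair_self, Complex.norm_real, Real.norm_of_nonneg (mem_tube_iff.1 h0).le]
  rw [hz] at hre
  rw [← Real.exp_log (norm_rhoPair_pos h0 h1), ← Real.exp_log (mem_tube_iff.1 h0), ← Real.exp_add]
  refine Real.exp_le_exp.2 ?_
  linarith

theorem norm_rhoPair_le_of_mem_bergmanBall {z w : CSpace d} {r : ℝ} (hz : z ∈ tube d)
    (hw : w ∈ bergmanBall z r) : ‖rhoPair z w‖ ≤ Real.exp (3 * r) * rho z := by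
  obtain ⟨hwt, hdist⟩ := hw
  rw [bergmanDist_eq] at hdist
  obtain ⟨l, ⟨γ, hγ, hmem, h0, h1, rfl⟩, hl⟩ :=
    -- The segment shows that the set of lengths is nonempty; the infimum of the empty set would be
    -- the default 0.
    exists_lt_of_csInf_lt ⟨_, curveLength_segment_mem hz hwt⟩ hdist
  have h := norm_rhoPair_le_exp_curveLength hγ hmem
  rw [h0, h1] at h
  refine h.trans (mul_le_mul_of_nonneg_right (Real.exp_le_exp.2 (by linarith))
    (mem_tube_iff.1 hz).le)

/-! ### Measures of Bergman balls and the averaging condition. -/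

/-- A Chebyshev-type bound for the measure of a Bergman ball. -/
theorem measure_bergmanBall_le (ν : Measure (CSpace d)) {z : CSpace d} (hz : z ∈ tube d) (r : ℝ)
    {m : ℝ} (hm : 0 ≤ m) :
    ν (bergmanBall z r) ≤ ENNReal.ofReal ((Real.exp (3 * r) * rho z) ^ m) *
      ∫⁻ w in tube d, ENNReal.ofReal (‖rhoPair z w‖ ^ (-m)) ∂ν := by
  have hρ := mem_tube_iff.1 hz
  set R := Real.exp (3 * r) * rho z with hR
  have hR0 : 0 < R := by positivity
  -- A measurable superset of the ball; measurability of the ball itself is never needed.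
  set T : Set (CSpace d) := tube d ∩ {w | ‖rhoPair z w‖ ≤ R} with hT
  have hTm : MeasurableSet T := measurableSet_tube.inter
    (isClosed_le (continuous_rhoPair_right z).norm continuous_const).measurableSet
  have hsub : bergmanBall z r ⊆ T := fun w hw =>
    ⟨hw.1, norm_rhoPair_le_of_mem_bergmanBall hz hw⟩
  have h1 : ENNReal.ofReal (R ^ (-m)) * ν T ≤
      ∫⁻ w in tube d, ENNReal.ofReal (‖rhoPair z w‖ ^ (-m)) ∂ν := by
    calc ENNReal.ofReal (R ^ (-m)) * ν T = ∫⁻ _w in T, ENNReal.ofReal (R ^ (-m)) ∂ν := by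
          rw [setLIntegral_const]
      _ ≤ ∫⁻ w in T, ENNReal.ofReal (‖rhoPair z w‖ ^ (-m)) ∂ν :=
          setLIntegral_mono' hTm fun w hw => ENNReal.ofReal_le_ofReal
            (Real.rpow_le_rpow_of_nonpos (norm_rhoPair_pos hz hw.1) hw.2 (by linarith))
      _ ≤ _ := lintegral_mono_set Set.inter_subset_left
  calc ν (bergmanBall z r) ≤ ν T := measure_mono hsub
    _ = ENNReal.ofReal (R ^ m) * (ENNReal.ofReal (R ^ (-m)) * ν T) := by
        rw [← mul_assoc, ← ENNReal.ofReal_mul (by positivity), ← Real.rpow_add hR0]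
        simp
    _ ≤ _ := mul_le_mul_right h1 _

/-- Chebyshev and Forelli–Rudin. Any exponent above `kernelExp d α` would serve; twice it is taken.
-/
theorem exists_weightedVolume_bergmanBall_le {α : ℝ} (hα : -1 < α) (r : ℝ) :
    ∃ C : ℝ, 0 ≤ C ∧ ∀ z ∈ tube d,
      weightedVolume d α (bergmanBall z r) ≤ ENNReal.ofReal (C * rho z ^ kernelExp d α) := by
  have hL := kernelExp_pos (d := d) hα
  obtain ⟨C, hC, h⟩ := exists_lintegral_weightedVolume_le (d := d) (α := α) (β := 0)
    (s := 2 * kernelExp d α) (by linarith) (by rw [kernelExp_eq] at *; linarith)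
  refine ⟨Real.exp (3 * r) ^ (2 * kernelExp d α) * C, by positivity, fun z hz => ?_⟩
  have hρ := mem_tube_iff.1 hz
  refine (measure_bergmanBall_le _ hz r (m := 2 * kernelExp d α) (by linarith)).trans ?_
  have h1 := (setLIntegral_le_lintegral (μ := weightedVolume d α) (tube d)
    (fun w => ENNReal.ofReal (‖rhoPair z w‖ ^ (-(2 * kernelExp d α))))).trans
    (by simpa using h z hz)
  refine (mul_le_mul_right h1 _).trans (le_of_eq ?_)
  rw [← ENNReal.ofReal_mul (by positivity), Real.mul_rpow (by positivity) hρ.le]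
  congr 1
  have e : α + d + 2 - 2 * kernelExp d α = kernelExp d α - 2 * kernelExp d α := by
    rw [kernelExp_eq]
  rw [e, Real.rpow_sub hρ]
  field_simp

/-- The sub-mean value inequality for the constant function 1 bounds the volume of a cell inside the
ball from below. -/
theorem exists_le_weightedVolume_bergmanBall (α : ℝ) {r : ℝ} (hr : 0 < r) :
    ∃ c : ℝ, 0 < c ∧ ∀ z ∈ tube d,
      ENNReal.ofReal (c * rho z ^ kernelExp d α) ≤ weightedVolume d α (bergmanBall z r) := by
  obtain ⟨ε, hε, hε', hcell⟩ := exists_cell_subset_bergmanBall d hr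
  obtain ⟨C, hC, h⟩ := exists_enorm_rpow_le_lintegral_cell α hε hε'
  refine ⟨C⁻¹, by positivity, fun z hz => ?_⟩
  have hρ := mem_tube_iff.1 hz
  have h1 := h 1 one_pos (fun _ => 1) (differentiableOn_const _) z hz
  simp only [enorm_one, ENNReal.one_rpow, lintegral_const, one_mul, Measure.restrict_apply,
    MeasurableSet.univ, Set.univ_inter] at h1
  have h2 : weightedVolume d α (cell z ε) ≤ weightedVolume d α (bergmanBall z r) :=
    measure_mono fun w hw => (hcell z hz w hw).1
  calc ENNReal.ofReal (C⁻¹ * rho z ^ kernelExp d α)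
      ≤ ENNReal.ofReal (C⁻¹ * rho z ^ kernelExp d α) *
        (ENNReal.ofReal (C * rho z ^ (-kernelExp d α)) * weightedVolume d α (cell z ε)) :=
        le_mul_of_one_le_right' h1
    _ = weightedVolume d α (cell z ε) := by
        rw [← mul_assoc, ← ENNReal.ofReal_mul (by positivity), Real.rpow_neg hρ.le]
        have : C⁻¹ * rho z ^ kernelExp d α * (C * (rho z ^ kernelExp d α)⁻¹) = 1 := by
          have : 0 < rho z ^ kernelExp d α := by positivity
          field_simp
        rw [this, ENNReal.ofReal_one, one_mul]
    _ ≤ _ := h2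

/-- The two volume bounds replace the denominator by ρ(z)^L, the form in which condition 3 is used
and proved. -/
theorem boundedOnTube_averaging_iff {α r : ℝ} (hα : -1 < α) (hr : 0 < r)
    (μ : Measure (CSpace d)) :
    BoundedOnTube (averaging α r μ) ↔ ∃ C : ℝ, 0 < C ∧ ∀ z ∈ tube d,
      μ (bergmanBall z r) ≤ ENNReal.ofReal (C * rho z ^ kernelExp d α) := by
  obtain ⟨C₁, hC₁, h₁⟩ := exists_weightedVolume_bergmanBall_le (d := d) hα r
  obtain ⟨c, hc, h₂⟩ := exists_le_weightedVolume_bergmanBall (d := d) α hr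
  constructor
  · rintro ⟨C, hC, h⟩
    refine ⟨C * (C₁ + 1), by positivity, fun z hz => ?_⟩
    have hρ := mem_tube_iff.1 hz
    have hV0 : weightedVolume d α (bergmanBall z r) ≠ 0 := by
      refine (lt_of_lt_of_le ?_ (h₂ z hz)).ne'
      rw [ENNReal.ofReal_pos]
      positivity
    have hVt : weightedVolume d α (bergmanBall z r) ≠ ∞ :=
      ((h₁ z hz).trans_lt ENNReal.ofReal_lt_top).ne
    have h3 := (ENNReal.div_le_iff hV0 hVt).1 (h z hz)
    refine h3.trans ((mul_le_mul_right (h₁ z hz) _).trans ?_)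
    rw [← ENNReal.ofReal_mul hC.le]
    refine ENNReal.ofReal_le_ofReal ?_
    have : 0 < rho z ^ kernelExp d α := by positivity
    nlinarith [mul_pos hC this]
  · rintro ⟨C, hC, h⟩
    refine ⟨C / c, by positivity, fun z hz => ?_⟩
    have hρ := mem_tube_iff.1 hz
    refine ENNReal.div_le_of_le_mul ((h z hz).trans ?_)
    refine le_trans (le_of_eq ?_) (mul_le_mul_right (h₂ z hz) _)
    rw [← ENNReal.ofReal_mul (by positivity)]
    congr 1
    field_simp

/-! ### Berezin transform, averages and Carleson measures. -/

theorem enorm_normalizedKernel_sq {α : ℝ} (hα : -1 < α) {z w : CSpace d} (hz : z ∈ tube d) :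
    ‖normalizedKernel α z w‖ₑ ^ 2 = ENNReal.ofReal (kernelConst d α * rho z ^ kernelExp d α) *
      ENNReal.ofReal (‖rhoPair z w‖ ^ (-(2 * kernelExp d α))) := by
  have hρ := mem_tube_iff.1 hz
  have hκ := kernelConst_pos (d := d) hα
  rw [← ofReal_norm, ← ENNReal.ofReal_pow (norm_nonneg _), ← ENNReal.ofReal_mul (by positivity)]
  congr 1
  rw [normalizedKernel, norm_div, norm_bergmanKernel hα, bergmanKernel_self hz, Complex.ofReal_re,
    Complex.norm_real, Real.norm_of_nonneg (Real.sqrt_nonneg _), div_pow,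
    Real.sq_sqrt (by positivity), mul_pow, ← Real.rpow_mul_natCast (norm_nonneg _),
    Real.rpow_neg hρ.le]
  have e : -kernelExp d α * ((2 : ℕ) : ℝ) = -(2 * kernelExp d α) := by
    push_cast
    ring
  rw [e]
  have : 0 < rho z ^ kernelExp d α := by positivity
  field_simp

theorem berezin_eq {α : ℝ} (hα : -1 < α) (μ : Measure (CSpace d)) {z : CSpace d}
    (hz : z ∈ tube d) :
    berezin α μ z = ENNReal.ofReal (kernelConst d α * rho z ^ kernelExp d α) *
      ∫⁻ w in tube d, ENNReal.ofReal (‖rhoPair z w‖ ^ (-(2 * kernelExp d α))) ∂μ := by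
  rw [berezin, ← lintegral_const_mul' _ _ ENNReal.ofReal_ne_top]
  exact lintegral_congr fun w => enorm_normalizedKernel_sq hα hz

theorem averaging_bounded_of_berezin_bounded {α r : ℝ} (hα : -1 < α) (hr : 0 < r)
    {μ : Measure (CSpace d)} (h : BoundedOnTube (berezin α μ)) :
    BoundedOnTube (averaging α r μ) := by
  rw [boundedOnTube_averaging_iff hα hr]
  obtain ⟨C, hC, h⟩ := h
  have hL := kernelExp_pos (d := d) hα
  have hκ := kernelConst_pos (d := d) hα
  refine ⟨Real.exp (3 * r) ^ (2 * kernelExp d α) * (kernelConst d α)⁻¹ * C, by positivity,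
    fun z hz => ?_⟩
  have hρ := mem_tube_iff.1 hz
  have h1 := h z hz
  rw [berezin_eq hα μ hz] at h1
  refine (measure_bergmanBall_le μ hz r (m := 2 * kernelExp d α) (by linarith)).trans ?_
  have e : ENNReal.ofReal ((Real.exp (3 * r) * rho z) ^ (2 * kernelExp d α)) =
      ENNReal.ofReal (Real.exp (3 * r) ^ (2 * kernelExp d α) * (kernelConst d α)⁻¹ *
        rho z ^ kernelExp d α) *
      ENNReal.ofReal (kernelConst d α * rho z ^ kernelExp d α) := by
    rw [← ENNReal.ofReal_mul (by positivity), Real.mul_rpow (by positivity) hρ.le, two_mul,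
      Real.rpow_add hρ]
    congr 1
    field_simp
  rw [e, mul_assoc]
  refine (mul_le_mul_right h1 _).trans (le_of_eq ?_)
  rw [← ENNReal.ofReal_mul (by positivity)]
  congr 1
  ring

theorem bergmanNorm_rpow (α : ℝ) {q : ℝ} (hq : 0 < q) (f : CSpace d → ℂ) :
    bergmanNorm α q f ^ q = ∫⁻ w, ‖f w‖ₑ ^ q ∂weightedVolume d α := by
  rw [bergmanNorm, eLpNorm_eq_lintegral_rpow_enorm_toReal (by simpa using hq) ENNReal.ofReal_ne_top,
    ENNReal.toReal_ofReal hq.le, ← ENNReal.rpow_mul, one_div_mul_cancel hq.ne', ENNReal.rpow_one]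

/-- The `MPlus` density is positive on the tube and makes μ finite, so μ is recovered from a finite
measure by the inverse density. This licenses Tonelli for μ. -/
theorem MPlus.sFinite_restrict {μ : Measure (CSpace d)} (hμ : MPlus μ) :
    SFinite (μ.restrict (tube d)) := by
  obtain ⟨t, ht, hfin⟩ := hμ
  set f : CSpace d → ℝ≥0∞ := fun z => ENNReal.ofReal (‖rhoPair z (basePoint d)‖ ^ (-t)) with hf
  have hfm : Measurable f :=
    ((continuous_rhoPair_left _).norm.measurable.pow_const _).ennreal_ofReal
  have h1 : ((μ.restrict (tube d)).withDensity f).withDensity f⁻¹ = μ.restrict (tube d) := by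
    refine withDensity_inv_same hfm ?_ (ae_of_all _ fun _ => ENNReal.ofReal_ne_top)
    filter_upwards [ae_restrict_mem measurableSet_tube] with z hz
    have := norm_rhoPair_pos hz (basePoint_mem (d := d))
    simp only [hf, ne_eq, ENNReal.ofReal_eq_zero, not_le]
    positivity
  have : IsFiniteMeasure ((μ.restrict (tube d)).withDensity f) :=
    isFiniteMeasure_withDensity hfin.ne
  rw [← h1]
  infer_instance

theorem measurable_indicator_tube {f : CSpace d → ℂ} (hf : ContinuousOn f (tube d)) :
    Measurable ((tube d).indicator f) := by
  classical
  rw [← Set.piecewise_eq_indicator]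
  exact hf.measurable_piecewise continuousOn_const measurableSet_tube

/-- Integrate the sub-mean value inequality in μ and exchange integrals. For fixed w, the z whose
cell contains w lie in D(w,r), of μ-measure ≲ ρ(w)^L, and this cancels the factor ρ(z)^(-L),
comparable to ρ(w)^(-L). -/
theorem isCarleson_of_averaging_bounded {α r q : ℝ} (hα : -1 < α) (hr : 0 < r) (hq : 0 < q)
    {μ : Measure (CSpace d)} (hμ : MPlus μ) (h : BoundedOnTube (averaging α r μ)) :
    IsCarleson α q μ := by
  rw [boundedOnTube_averaging_iff hα hr] at h
  obtain ⟨C, hC, h⟩ := h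
  have hsf := hμ.sFinite_restrict
  have hL := kernelExp_pos (d := d) hα
  obtain ⟨ε, hε, hε', hcell⟩ := exists_cell_subset_bergmanBall d hr
  obtain ⟨C₁, hC₁, hmean⟩ := exists_enorm_rpow_le_lintegral_cell α hε hε'
  set L := kernelExp d α with hLdef
  refine ⟨C₁ * 2 ^ L * C, by positivity, fun f hf => ?_⟩
  rw [bergmanNorm_rpow α hq]
  set G : CSpace d → ℝ≥0∞ := fun w => ‖(tube d).indicator f w‖ₑ ^ q with hG
  have hGm : Measurable G := (measurable_indicator_tube hf.1.continuousOn).enorm.pow_const q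
  set c : CSpace d → ℝ≥0∞ := fun z => ENNReal.ofReal (C₁ * rho z ^ (-L)) with hc
  have hcm : Measurable c :=
    ((continuous_rho.measurable.pow_const _).const_mul _).ennreal_ofReal
  set E : Set (CSpace d × CSpace d) := {p | p.2 ∈ cell p.1 ε} with hE
  have hEm : MeasurableSet E := measurableSet_cell_prod ε
  set H : CSpace d → CSpace d → ℝ≥0∞ := fun z w => E.indicator (fun p => c p.1 * G p.2) (z, w)
    with hH
  have hHm : Measurable (Function.uncurry H) :=
    Measurable.indicator ((hcm.comp measurable_fst).mul (hGm.comp measurable_snd)) hEm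
  have hstep1 : ∀ z ∈ tube d, ‖f z‖ₑ ^ q ≤ ∫⁻ w, H z w ∂weightedVolume d α := by
    intro z hz
    refine (hmean q hq f hf.1 z hz).trans (le_of_eq ?_)
    rw [← lintegral_indicator (measurableSet_cell z ε), ← lintegral_const_mul' _ _
      ENNReal.ofReal_ne_top]
    refine lintegral_congr fun w => ?_
    by_cases hw : w ∈ cell z ε
    · have hw' : (z, w) ∈ E := hw
      have hwt : w ∈ tube d := cell_subset_tube hz hε hε' hw
      simp only [hH, hG, hc]
      rw [Set.indicator_of_mem hw, Set.indicator_of_mem hw']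
      simp only [Set.indicator_of_mem hwt, hLdef]
    · have hw' : (z, w) ∉ E := hw
      simp only [hH]
      rw [Set.indicator_of_notMem hw, Set.indicator_of_notMem hw', mul_zero]
  have hstep2 : ∀ w ∈ tube d, ∫⁻ z in tube d, H z w ∂μ ≤
      ENNReal.ofReal (C₁ * 2 ^ L * C) * ‖f w‖ₑ ^ q := by
    intro w hw
    have hρw := mem_tube_iff.1 hw
    set A : Set (CSpace d) := (fun z => (z, w)) ⁻¹' E with hA
    have hAm : MeasurableSet A := hEm.preimage (measurable_id.prodMk measurable_const)
    have hGw : G w = ‖f w‖ₑ ^ q := by simp only [hG, Set.indicator_of_mem hw]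
    have hsub : A ∩ tube d ⊆ bergmanBall w r := fun z hz => (hcell z hz.2 w hz.1).2
    have e : ∀ z, H z w = A.indicator (fun z => c z * G w) z := by
      intro z
      by_cases hz : z ∈ A
      · have hz' : (z, w) ∈ E := hz
        simp only [hH]
        rw [Set.indicator_of_mem hz, Set.indicator_of_mem hz']
      · have hz' : (z, w) ∉ E := hz
        simp only [hH]
        rw [Set.indicator_of_notMem hz, Set.indicator_of_notMem hz']
    simp_rw [e]
    rw [lintegral_indicator hAm, Measure.restrict_restrict hAm]
    calc ∫⁻ z in A ∩ tube d, c z * G w ∂μ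
        ≤ ∫⁻ _z in A ∩ tube d, ENNReal.ofReal (C₁ * (2 ^ L * rho w ^ (-L))) * G w ∂μ := by
          refine setLIntegral_mono' (hAm.inter measurableSet_tube) fun z hz => ?_
          refine mul_le_mul_left (ENNReal.ofReal_le_ofReal ?_) _
          have hb := (rho_bounds_of_mem_cell hz.2 hε hε' hz.1).2
          have hρz := mem_tube_iff.1 hz.2
          refine mul_le_mul_of_nonneg_left ?_ hC₁.le
          have : (2 : ℝ) ^ L * rho w ^ (-L) = (rho w / 2) ^ (-L) := by
            rw [Real.div_rpow hρw.le zero_le_two, Real.rpow_neg zero_le_two, div_inv_eq_mul,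
              mul_comm]
          rw [this]
          exact Real.rpow_le_rpow_of_nonpos (by positivity) (by linarith) (by linarith)
      _ = ENNReal.ofReal (C₁ * (2 ^ L * rho w ^ (-L))) * G w * μ (A ∩ tube d) := by
          rw [setLIntegral_const]
      _ ≤ ENNReal.ofReal (C₁ * (2 ^ L * rho w ^ (-L))) * G w *
            ENNReal.ofReal (C * rho w ^ L) :=
          mul_le_mul_right ((measure_mono hsub).trans (h w hw)) _
      _ = _ := by
          rw [mul_right_comm, ← ENNReal.ofReal_mul (by positivity), hGw]
          congr 2
          rw [Real.rpow_neg hρw.le]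
          have : 0 < rho w ^ L := by positivity
          field_simp
  calc ∫⁻ z in tube d, ‖f z‖ₑ ^ q ∂μ
      ≤ ∫⁻ z in tube d, ∫⁻ w, H z w ∂weightedVolume d α ∂μ :=
        setLIntegral_mono' measurableSet_tube hstep1
    _ = ∫⁻ w, ∫⁻ z in tube d, H z w ∂μ ∂weightedVolume d α :=
        lintegral_lintegral_swap hHm.aemeasurable
    _ ≤ ∫⁻ w, ENNReal.ofReal (C₁ * 2 ^ L * C) * ‖f w‖ₑ ^ q ∂weightedVolume d α := by
        refine lintegral_mono_ae ?_
        filter_upwards [ae_mem_tube α] with w hw using hstep2 w hw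
    _ = _ := lintegral_const_mul' _ _ ENNReal.ofReal_ne_top

/-- The holomorphic test function `ρ(·, z)^{-m}`. -/
noncomputable def powTest (z : CSpace d) (m : ℝ) (w : CSpace d) : ℂ :=
  rhoPair w z ^ ((-m : ℝ) : ℂ)

theorem norm_powTest (z : CSpace d) (m : ℝ) (w : CSpace d) :
    ‖powTest z m w‖ = ‖rhoPair z w‖ ^ (-m) := by
  rw [powTest, Complex.norm_cpow_real, norm_rhoPair_comm]

theorem enorm_powTest_rpow (z : CSpace d) (m : ℝ) {p : ℝ} (hp : 0 ≤ p) (w : CSpace d) :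
    ‖powTest z m w‖ₑ ^ p = ENNReal.ofReal (‖rhoPair z w‖ ^ (-(m * p))) := by
  rw [← ofReal_norm, norm_powTest, ENNReal.ofReal_rpow_of_nonneg (by positivity) hp,
    ← Real.rpow_mul (norm_nonneg _), neg_mul]

theorem differentiable_rhoPair_left (w : CSpace d) : Differentiable ℂ fun z => rhoPair z w := by
  unfold rhoPair
  fun_prop

theorem differentiableOn_powTest {z : CSpace d} (hz : z ∈ tube d) (m : ℝ) :
    DifferentiableOn ℂ (powTest z m) (tube d) :=
  (differentiable_rhoPair_left z).differentiableOn.cpow_const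
    fun _ hw => rhoPair_mem_slitPlane hw hz

theorem aestronglyMeasurable_of_continuousOn {α : ℝ} {f : CSpace d → ℂ}
    (hf : ContinuousOn f (tube d)) : AEStronglyMeasurable f (weightedVolume d α) :=
  (hf.aestronglyMeasurable measurableSet_tube).mono_ac (weightedVolume_absolutelyContinuous α)

theorem mem_bergmanSpace_of_lintegral_lt_top {α p : ℝ} (hp : 0 < p) {f : CSpace d → ℂ}
    (hf : DifferentiableOn ℂ f (tube d)) (hfin : ∫⁻ w, ‖f w‖ₑ ^ p ∂weightedVolume d α < ∞) :
    f ∈ bergmanSpace d α p := by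
  refine ⟨hf, aestronglyMeasurable_of_continuousOn hf.continuousOn, ?_⟩
  have h := bergmanNorm_rpow α hp f
  rw [← h] at hfin
  exact (ENNReal.rpow_lt_top_iff_of_pos hp).1 hfin

theorem exists_lintegral_powTest_le {α m p : ℝ} (hα : -1 < α) (hp : 0 < p)
    (hm : kernelExp d α < m * p) :
    ∃ C : ℝ, 0 ≤ C ∧ ∀ z ∈ tube d, powTest z m ∈ bergmanSpace d α p ∧
      ∫⁻ w, ‖powTest z m w‖ₑ ^ p ∂weightedVolume d α ≤
        ENNReal.ofReal (C * rho z ^ (kernelExp d α - m * p)) := by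
  obtain ⟨C, hC, h⟩ := exists_lintegral_weightedVolume_le (d := d) (α := α) (β := 0)
    (s := m * p) (by linarith) (by rw [kernelExp_eq] at hm; linarith)
  have key : ∀ z ∈ tube d, ∫⁻ w, ‖powTest z m w‖ₑ ^ p ∂weightedVolume d α ≤
      ENNReal.ofReal (C * rho z ^ (kernelExp d α - m * p)) := by
    intro z hz
    simp_rw [enorm_powTest_rpow z m hp.le]
    simpa [kernelExp_eq] using h z hz
  exact ⟨C, hC, fun z hz => ⟨mem_bergmanSpace_of_lintegral_lt_top hp
    (differentiableOn_powTest hz m) ((key z hz).trans_lt ENNReal.ofReal_lt_top), key z hz⟩⟩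

/-- With exponent 2L/q the q-th power of the test function is |ρ(z,w)|^(-2L), the Berezin integrand
up to the factor ρ(z)^L, whatever q is. -/
theorem berezin_bounded_of_isCarleson {α q : ℝ} (hα : -1 < α) (hq : 0 < q)
    {μ : Measure (CSpace d)} (h : IsCarleson α q μ) : BoundedOnTube (berezin α μ) := by
  obtain ⟨C, hC, h⟩ := h
  have hL := kernelExp_pos (d := d) hα
  have hκ := kernelConst_pos (d := d) hα
  have hm : 2 * kernelExp d α / q * q = 2 * kernelExp d α := by field_simp
  obtain ⟨C₁, hC₁, h₁⟩ := exists_lintegral_powTest_le (d := d) (m := 2 * kernelExp d α / q)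
    hα hq (by rw [hm]; linarith)
  refine ⟨kernelConst d α * C * (C₁ + 1), by positivity, fun z hz => ?_⟩
  have hρ := mem_tube_iff.1 hz
  obtain ⟨hmem, hint⟩ := h₁ z hz
  have h2 := h _ hmem
  rw [bergmanNorm_rpow α hq] at h2
  simp_rw [enorm_powTest_rpow z _ hq.le, hm] at h2 hint
  rw [berezin_eq hα μ hz]
  refine (mul_le_mul_right (h2.trans (mul_le_mul_right hint _)) _).trans ?_
  rw [← ENNReal.ofReal_mul hC.le, ← ENNReal.ofReal_mul (by positivity)]
  refine ENNReal.ofReal_le_ofReal ?_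
  have e : kernelExp d α - 2 * kernelExp d α = -kernelExp d α := by ring
  rw [e, Real.rpow_neg hρ.le]
  have : 0 < rho z ^ kernelExp d α := by positivity
  calc kernelConst d α * rho z ^ kernelExp d α * (C * (C₁ * (rho z ^ kernelExp d α)⁻¹)) =
      kernelConst d α * C * C₁ := by field_simp
    _ ≤ _ := mul_le_mul_of_nonneg_left (by linarith) (by positivity)

/-! ### Schur's test and the positive Bergman operator. -/

/-- **Schur's test** for a nonnegative kernel. -/
theorem lintegral_rpow_le_of_schur {X : Type*} [MeasurableSpace X] {ν : Measure X} [SFinite ν]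
    {p p' : ℝ} (hp : p'.HolderConjugate p) {K : X → X → ℝ≥0∞}
    (hK : Measurable (Function.uncurry K)) {h g : X → ℝ≥0∞} (hh : Measurable h)
    (hg : Measurable g) (h0 : ∀ᵐ x ∂ν, h x ≠ 0 ∧ h x ≠ ∞) {A B : ℝ≥0∞}
    (hA : ∀ᵐ z ∂ν, ∫⁻ w, K z w * h w ^ p' ∂ν ≤ A * h z ^ p')
    (hB : ∀ᵐ w ∂ν, ∫⁻ z, K z w * h z ^ p ∂ν ≤ B * h w ^ p) :
    ∫⁻ z, (∫⁻ w, K z w * g w ∂ν) ^ p ∂ν ≤ A ^ (p / p') * B * ∫⁻ w, g w ^ p ∂ν := by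
  have hp0 : 0 < p := hp.symm.pos
  have hp'0 : 0 < p' := hp.pos
  have hKz : ∀ z, Measurable (K z) := fun z => hK.of_uncurry_left
  have hpt : ∀ᵐ z ∂ν, (∫⁻ w, K z w * g w ∂ν) ^ p ≤
      A ^ (p / p') * ∫⁻ w, h z ^ p * (K z w * ((h w)⁻¹ ^ p * g w ^ p)) ∂ν := by
    filter_upwards [hA, h0] with z hz hz0
    -- Splitting K = K^(1/p') K^(1/p) and 1 = h h⁻¹ prepares Hölder's inequality; `hA` then bounds
    -- the first factor, and `hB` the second after Tonelli.
    have e1 : ∫⁻ w, K z w * g w ∂ν ≤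
        ∫⁻ w, ((fun w => K z w ^ (1 / p') * h w) *
          fun w => K z w ^ (1 / p) * ((h w)⁻¹ * g w)) w ∂ν := by
      refine lintegral_mono_ae ?_
      filter_upwards [h0] with w hw
      simp only [Pi.mul_apply]
      have h1 : K z w ^ (1 / p') * K z w ^ (1 / p) = K z w := by
        rw [← ENNReal.rpow_add_of_nonneg _ _ (by positivity) (by positivity), one_div, one_div,
          hp.inv_add_inv_eq_one, ENNReal.rpow_one]
      have h2 : h w * (h w)⁻¹ = 1 := ENNReal.mul_inv_cancel hw.1 hw.2
      refine le_of_eq ?_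
      calc K z w * g w = (K z w ^ (1 / p') * K z w ^ (1 / p)) * (h w * (h w)⁻¹) * g w := by
            rw [h1, h2, mul_one]
        _ = _ := by ring
    have e2 := ENNReal.lintegral_mul_le_Lp_mul_Lq ν hp
      (f := fun w => K z w ^ (1 / p') * h w) (g := fun w => K z w ^ (1 / p) * ((h w)⁻¹ * g w))
      (((hKz z).pow_const _).mul hh).aemeasurable
      (((hKz z).pow_const _).mul (hh.inv.mul hg)).aemeasurable
    have e3 : ∀ w, (K z w ^ (1 / p') * h w) ^ p' = K z w * h w ^ p' := fun w => by
      rw [ENNReal.mul_rpow_of_nonneg _ _ hp'0.le, ← ENNReal.rpow_mul,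
        one_div_mul_cancel hp'0.ne', ENNReal.rpow_one]
    have e4 : ∀ w, (K z w ^ (1 / p) * ((h w)⁻¹ * g w)) ^ p =
        K z w * ((h w)⁻¹ ^ p * g w ^ p) := fun w => by
      rw [ENNReal.mul_rpow_of_nonneg _ _ hp0.le, ENNReal.mul_rpow_of_nonneg _ _ hp0.le,
        ← ENNReal.rpow_mul, one_div_mul_cancel hp0.ne', ENNReal.rpow_one]
    simp_rw [e3, e4] at e2
    calc (∫⁻ w, K z w * g w ∂ν) ^ p
        ≤ ((A * h z ^ p') ^ (1 / p') *
          (∫⁻ w, K z w * ((h w)⁻¹ ^ p * g w ^ p) ∂ν) ^ (1 / p)) ^ p := by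
          refine ENNReal.rpow_le_rpow ((e1.trans e2).trans ?_) hp0.le
          exact mul_le_mul_left (ENNReal.rpow_le_rpow hz (by positivity)) _
      _ = A ^ (p / p') * (h z ^ p * ∫⁻ w, K z w * ((h w)⁻¹ ^ p * g w ^ p) ∂ν) := by
          have i1 : 1 / p' * p = p / p' := by ring
          have i2 : p' * (p / p') = p := by field_simp
          rw [ENNReal.mul_rpow_of_nonneg _ _ hp0.le, ← ENNReal.rpow_mul _ (1 / p) p,
            one_div_mul_cancel hp0.ne', ENNReal.rpow_one, ← ENNReal.rpow_mul, i1,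
            ENNReal.mul_rpow_of_nonneg _ _ (by positivity), ← ENNReal.rpow_mul, i2, mul_assoc]
      _ = _ := by
          have hm : Measurable fun w => K z w * ((h w)⁻¹ ^ p * g w ^ p) :=
            (hKz z).mul ((hh.inv.pow_const _).mul (hg.pow_const _))
          rw [lintegral_const_mul _ hm]
  have hjm : Measurable (Function.uncurry fun z w =>
      h z ^ p * (K z w * ((h w)⁻¹ ^ p * g w ^ p))) := by
    refine ((hh.pow_const p).comp measurable_fst).mul (hK.mul ?_)
    exact (((hh.inv.pow_const p).mul (hg.pow_const p))).comp measurable_snd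
  calc ∫⁻ z, (∫⁻ w, K z w * g w ∂ν) ^ p ∂ν
      ≤ ∫⁻ z, A ^ (p / p') * ∫⁻ w, h z ^ p * (K z w * ((h w)⁻¹ ^ p * g w ^ p)) ∂ν ∂ν :=
        lintegral_mono_ae hpt
    _ = A ^ (p / p') * ∫⁻ w, ∫⁻ z, h z ^ p * (K z w * ((h w)⁻¹ ^ p * g w ^ p)) ∂ν ∂ν := by
        rw [lintegral_const_mul _ hjm.lintegral_prod_right, lintegral_lintegral_swap
          hjm.aemeasurable]
    _ ≤ A ^ (p / p') * ∫⁻ w, B * g w ^ p ∂ν := by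
        refine mul_le_mul_right (lintegral_mono_ae ?_) _
        filter_upwards [hB, h0] with w hw hw0
        have hm : Measurable fun z => K z w * h z ^ p :=
          (hK.comp (measurable_id.prodMk measurable_const)).mul (hh.pow_const p)
        have e : ∀ z, h z ^ p * (K z w * ((h w)⁻¹ ^ p * g w ^ p)) =
            (K z w * h z ^ p) * ((h w)⁻¹ ^ p * g w ^ p) := fun z => by ring
        simp_rw [e]
        rw [lintegral_mul_const _ hm]
        calc (∫⁻ z, K z w * h z ^ p ∂ν) * ((h w)⁻¹ ^ p * g w ^ p)
            ≤ B * h w ^ p * ((h w)⁻¹ ^ p * g w ^ p) := mul_le_mul_left hw _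
          _ = B * (h w * (h w)⁻¹) ^ p * g w ^ p := by
              rw [ENNReal.mul_rpow_of_nonneg _ _ hp0.le]
              ring
          _ = B * g w ^ p := by
              rw [ENNReal.mul_inv_cancel hw0.1 hw0.2, ENNReal.one_rpow, mul_one]
    _ = _ := by rw [lintegral_const_mul _ (hg.pow_const p), mul_assoc]

/-- The positive Bergman operator is bounded on `L^p(V_α)` for `1 < p < ∞`. -/
theorem exists_lintegral_positive_bergman_le {α p : ℝ} (hα : -1 < α) (hp : 1 < p) :
    ∃ C : ℝ, 0 < C ∧ ∀ g : CSpace d → ℝ≥0∞, Measurable g →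
      ∫⁻ z, (∫⁻ w, ENNReal.ofReal (‖rhoPair z w‖ ^ (-kernelExp d α)) * g w
        ∂weightedVolume d α) ^ p ∂weightedVolume d α ≤
      ENNReal.ofReal C * ∫⁻ w, g w ^ p ∂weightedVolume d α := by
  have hpq := (Real.HolderConjugate.conjExponent hp).symm
  set p' := p.conjExponent with hp'
  have hp0 : 0 < p := by linarith
  have hp'0 : 0 < p' := hpq.pos
  -- The Schur weight is ρ^(-b). For s = p and s = p' the Forelli–Rudin estimate needs α - bs > -1
  -- and bs > 0, so b is taken positive and small.
  set b : ℝ := (α + 1) / (2 * (p + p')) with hb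
  have hb0 : 0 < b := div_pos (by linarith) (by positivity)
  have hbs : b * (p + p') < α + 1 := by
    rw [hb, div_mul_eq_mul_div, div_lt_iff₀ (by positivity)]
    nlinarith
  have key : ∀ s : ℝ, 0 < s → s ≤ p + p' → ∃ C : ℝ, 0 ≤ C ∧ ∀ z ∈ tube d,
      ∫⁻ w, ENNReal.ofReal (‖rhoPair z w‖ ^ (-kernelExp d α)) *
        ENNReal.ofReal (rho w ^ (-b)) ^ s ∂weightedVolume d α ≤
      ENNReal.ofReal C * ENNReal.ofReal (rho z ^ (-b)) ^ s := by
    intro s hs hsp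
    have hbs' : b * s ≤ b * (p + p') := mul_le_mul_of_nonneg_left hsp hb0.le
    have hbs0 : 0 < b * s := by positivity
    obtain ⟨C, hC, h⟩ := exists_lintegral_weightedVolume_le (d := d) (α := α) (β := -(b * s))
      (s := kernelExp d α) (by linarith) (by rw [kernelExp_eq]; linarith)
    have e : ∀ w ∈ tube d, ENNReal.ofReal (rho w ^ (-b)) ^ s =
        ENNReal.ofReal (rho w ^ (-(b * s))) := by
      intro w hw
      have hρ := mem_tube_iff.1 hw
      rw [ENNReal.ofReal_rpow_of_nonneg (by positivity) hs.le, ← Real.rpow_mul hρ.le, neg_mul]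
    refine ⟨C, hC, fun z hz => ?_⟩
    rw [e z hz, ← ENNReal.ofReal_mul hC]
    refine le_trans (le_of_eq (lintegral_congr_ae ?_)) ((h z hz).trans (le_of_eq ?_))
    · filter_upwards [ae_mem_tube α] with w hw
      have hρ := mem_tube_iff.1 hw
      rw [e w hw, ← ENNReal.ofReal_mul (by positivity), mul_comm]
    · congr 3
      rw [kernelExp_eq]
      ring
  obtain ⟨C₁, hC₁, h₁⟩ := key p' hp'0 (by linarith)
  obtain ⟨C₂, hC₂, h₂⟩ := key p hp0 (by linarith)
  refine ⟨(C₁ + 1) ^ (p / p') * (C₂ + 1), by positivity, fun g hg => ?_⟩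
  have hK : Measurable (Function.uncurry fun z w : CSpace d =>
      ENNReal.ofReal (‖rhoPair z w‖ ^ (-kernelExp d α))) :=
    ((continuous_rhoPair.norm.measurable).pow_const _).ennreal_ofReal
  have hh : Measurable fun w : CSpace d => ENNReal.ofReal (rho w ^ (-b)) :=
    (continuous_rho.measurable.pow_const _).ennreal_ofReal
  refine (lintegral_rpow_le_of_schur (A := ENNReal.ofReal C₁) (B := ENNReal.ofReal C₂) hpq hK hh
    hg ?_ ?_ ?_).trans ?_
  · filter_upwards [ae_mem_tube α] with w hw
    have hρ := mem_tube_iff.1 hw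
    refine ⟨?_, ENNReal.ofReal_ne_top⟩
    simp only [ne_eq, ENNReal.ofReal_eq_zero, not_le]
    positivity
  · filter_upwards [ae_mem_tube α] with z hz using h₁ z hz
  · filter_upwards [ae_mem_tube α] with w hw
    refine le_trans (le_of_eq (lintegral_congr fun z => ?_)) (h₂ w hw)
    rw [norm_rhoPair_comm]
  · refine mul_le_mul_left ?_ _
    rw [ENNReal.ofReal_rpow_of_nonneg hC₁ (by positivity), ← ENNReal.ofReal_mul (by positivity)]
    refine ENNReal.ofReal_le_ofReal (mul_le_mul ?_ (by linarith) hC₂ (by positivity))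
    exact Real.rpow_le_rpow hC₁ (by linarith) (by positivity)

/-! ### Holomorphy of Toeplitz integrals. -/

/-- The complex derivative of `ρ(·, w)` at `z`. -/
noncomputable def rhoPairDeriv (z w : CSpace d) : CSpace d →L[ℂ] ℂ :=
  (1 / 4 : ℂ) • ((∑ i : Fin d, (2 * (z i.castSucc - star (w i.castSucc))) •
    ContinuousLinearMap.proj (R := ℂ) (φ := fun _ : Fin (d + 1) => ℂ) i.castSucc) -
    (2 * Complex.I) • ContinuousLinearMap.proj (R := ℂ) (φ := fun _ : Fin (d + 1) => ℂ)
      (Fin.last d))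

theorem continuous_rhoPairDeriv_right (z : CSpace d) : Continuous fun w => rhoPairDeriv z w := by
  unfold rhoPairDeriv
  fun_prop

theorem hasFDerivAt_coord (z : CSpace d) (j : Fin (d + 1)) :
    HasFDerivAt (fun ζ : CSpace d => ζ j)
      (ContinuousLinearMap.proj (R := ℂ) (φ := fun _ : Fin (d + 1) => ℂ) j) z :=
  (ContinuousLinearMap.proj (R := ℂ) (φ := fun _ : Fin (d + 1) => ℂ) j).hasFDerivAt

theorem hasFDerivAt_rhoPair (z w : CSpace d) :
    HasFDerivAt (fun ζ => rhoPair ζ w) (rhoPairDeriv z w) z := by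
  unfold rhoPair rhoPairDeriv
  refine HasFDerivAt.const_mul (HasFDerivAt.sub (HasFDerivAt.fun_sum fun i _ => ?_) ?_) _
  · have h := ((hasFDerivAt_coord z i.castSucc).sub_const (star (w i.castSucc))).pow 2
    simpa using h
  · exact ((hasFDerivAt_coord z (Fin.last d)).sub_const _).const_mul _

theorem norm_rhoPairDeriv_le (z w : CSpace d) {M : ℝ} (hM : 0 ≤ M)
    (h : ∀ i : Fin d, ‖z i.castSucc - star (w i.castSucc)‖ ≤ M) :
    ‖rhoPairDeriv z w‖ ≤ d * M + 1 := by
  refine ContinuousLinearMap.opNorm_le_bound _ (by positivity) fun v => ?_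
  have hv : ∀ j, ‖v j‖ ≤ ‖v‖ := fun j => norm_le_pi_norm v j
  have e : rhoPairDeriv z w v = (1 / 4 : ℂ) *
      ((∑ i : Fin d, 2 * (z i.castSucc - star (w i.castSucc)) * v i.castSucc) -
        2 * Complex.I * v (Fin.last d)) := by
    simp [rhoPairDeriv]
  have h1 : ‖∑ i : Fin d, 2 * (z i.castSucc - star (w i.castSucc)) * v i.castSucc‖ ≤
      d * (2 * M * ‖v‖) := by
    refine (norm_sum_le _ _).trans ?_
    calc _ ≤ ∑ _i : Fin d, 2 * M * ‖v‖ := by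
          refine Finset.sum_le_sum fun i _ => ?_
          rw [norm_mul, norm_mul, Complex.norm_two]
          exact mul_le_mul (mul_le_mul_of_nonneg_left (h i) zero_le_two) (hv _) (norm_nonneg _)
            (by positivity)
      _ = _ := by simp
  have h2 : ‖2 * Complex.I * v (Fin.last d)‖ ≤ 2 * ‖v‖ := by
    rw [norm_mul, norm_mul, Complex.norm_I, Complex.norm_two, mul_one]
    exact mul_le_mul_of_nonneg_left (hv _) zero_le_two
  have h3 : ‖(1 / 4 : ℂ)‖ = 1 / 4 := by norm_num
  rw [e, norm_mul, h3]
  have h4 := (norm_sub_le (∑ i : Fin d, 2 * (z i.castSucc - star (w i.castSucc)) * v i.castSucc)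
    (2 * Complex.I * v (Fin.last d))).trans (add_le_add h1 h2)
  have h5 : 0 ≤ d * M * ‖v‖ := by positivity
  nlinarith [norm_nonneg v]

/-- The derivative of `ρ(·, w)` on a ball is controlled by the value at the centre, uniformly in
`w`. -/
theorem exists_norm_rhoPairDeriv_le {z₀ : CSpace d} (hz₀ : z₀ ∈ tube d) (M : ℝ) :
    ∃ C : ℝ, 0 < C ∧ ∀ z ∈ Metric.ball z₀ M, ∀ w ∈ tube d,
      ‖rhoPairDeriv z w‖ ≤ C * ‖rhoPair z₀ w‖ ∧
      ‖rhoPair z w - rhoPair z₀ w‖ ≤ C * ‖rhoPair z₀ w‖ * ‖z - z₀‖ := by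
  rcases le_or_gt M 0 with hM | hM
  · exact ⟨1, one_pos, fun z hz => by simp [Metric.ball_eq_empty.2 hM] at hz⟩
  obtain ⟨C, hC, h⟩ := exists_norm_rhoPair_sub_le hz₀
  refine ⟨(d * (M + 1) + 1) * C, by positivity, ?_⟩
  have key : ∀ z ∈ Metric.ball z₀ M, ∀ w ∈ tube d,
      ‖rhoPairDeriv z w‖ ≤ (d * (M + 1) + 1) * C * ‖rhoPair z₀ w‖ := by
    intro z hz w hw
    obtain ⟨h1, h2⟩ := h z w hw
    rw [mem_ball_iff_norm] at hz
    set N := ‖rhoPair z₀ w‖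
    have h3 := norm_rhoPairDeriv_le z w (M := (M + 1) * (C * N)) (by positivity) fun i => by
      have := h2 i
      nlinarith
    calc ‖rhoPairDeriv z w‖ ≤ d * ((M + 1) * (C * N)) + 1 := h3
      _ ≤ d * ((M + 1) * (C * N)) + C * N := by linarith
      _ = _ := by ring
  refine fun z hz w hw => ⟨key z hz w hw, ?_⟩
  exact (convex_ball z₀ M).norm_image_sub_le_of_norm_hasFDerivWithin_le
    (f := fun ζ => rhoPair ζ w) (fun x _ => (hasFDerivAt_rhoPair x w).hasFDerivWithinAt)
    (fun x hx => key x hx w hw) (Metric.mem_ball_self hM) hz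

/-- It makes the base point in the `MPlus` condition immaterial: any point of the tube can replace
𝐢, at the cost of a constant. -/
theorem exists_norm_rhoPair_le_mul {z₀ : CSpace d} (hz₀ : z₀ ∈ tube d) (z : CSpace d) :
    ∃ C : ℝ, 0 < C ∧ ∀ w ∈ tube d, ‖rhoPair z w‖ ≤ C * ‖rhoPair z₀ w‖ := by
  obtain ⟨C, hC, h⟩ := exists_norm_rhoPairDeriv_le hz₀ (‖z - z₀‖ + 1)
  refine ⟨C * ‖z - z₀‖ + 1, by positivity, fun w hw => ?_⟩
  have h1 := (h z (by rw [mem_ball_iff_norm]; linarith) w hw).2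
  have h2 := norm_le_norm_add_norm_sub' (rhoPair z w) (rhoPair z₀ w)
  nlinarith

theorem hasFDerivAt_bergmanKernel {α : ℝ} {z w : CSpace d} (hz : z ∈ tube d) (hw : w ∈ tube d) :
    HasFDerivAt (fun ζ => bergmanKernel α ζ w)
      (((kernelConst d α : ℂ) * (((-kernelExp d α : ℝ) : ℂ) *
        rhoPair z w ^ (((-kernelExp d α : ℝ) : ℂ) - 1))) • rhoPairDeriv z w) z := by
  have h1 := (Complex.hasStrictDerivAt_cpow_const (c := ((-kernelExp d α : ℝ) : ℂ))
    (rhoPair_mem_slitPlane hz hw)).hasDerivAt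
  have h2 := (h1.comp_hasFDerivAt z (hasFDerivAt_rhoPair z w)).const_mul (kernelConst d α : ℂ)
  rw [smul_smul] at h2
  refine h2.congr_of_eventuallyEq (Filter.Eventually.of_forall fun ζ => ?_)
  exact bergmanKernel_eq α ζ w

theorem continuousOn_bergmanKernel_right {α : ℝ} {z : CSpace d} (hz : z ∈ tube d) :
    ContinuousOn (fun w => bergmanKernel α z w) (tube d) := by
  simp_rw [bergmanKernel_eq]
  exact continuousOn_const.mul ((continuous_rhoPair_right z).continuousOn.cpow_const
    fun w hw => rhoPair_mem_slitPlane hz hw)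

/-- Integrals against the Bergman kernel are holomorphic. -/
theorem differentiableOn_toeplitz {α : ℝ} (hα : -1 < α) {μ : Measure (CSpace d)} {f : CSpace d → ℂ}
    (hf : ContinuousOn f (tube d))
    (hint : ∀ z ∈ tube d, IntegrableOn (fun w => bergmanKernel α z w * f w) (tube d) μ) :
    DifferentiableOn ℂ (toeplitz α μ f) (tube d) := by
  intro z₀ hz₀
  have hL := kernelExp_pos (d := d) hα
  have hκ := kernelConst_pos (d := d) hα
  set L := kernelExp d α
  obtain ⟨C, hC, h⟩ := exists_norm_rhoPairDeriv_le hz₀ 1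
  obtain ⟨δ₁, hδ₁, hball⟩ := Metric.isOpen_iff.1 isOpen_tube z₀ hz₀
  -- The last bound keeps |ρ(z,w)| ≥ |ρ(z₀,w)|/2 for all w at once, so the derivative of the kernel
  -- is dominated by a multiple of |K_α(z₀,w)|.
  set δ := min (min 1 δ₁) (1 / (2 * C)) with hδ
  have hδ0 : 0 < δ := lt_min (lt_min one_pos hδ₁) (by positivity)
  have hsub : Metric.ball z₀ δ ⊆ tube d := (Metric.ball_subset_ball
    ((min_le_left _ _).trans (min_le_right _ _))).trans hball
  set F' : CSpace d → CSpace d → (CSpace d →L[ℂ] ℂ) := fun z w =>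
    f w • (((kernelConst d α : ℂ) * (((-L : ℝ) : ℂ) *
        rhoPair z w ^ (((-L : ℝ) : ℂ) - 1))) • rhoPairDeriv z w) with hF'
  have hFd : HasFDerivAt (toeplitz α μ f) (∫ w in tube d, F' z₀ w ∂μ) z₀ := by
    refine hasFDerivAt_integral_of_dominated_of_fderiv_le (F := fun z w => bergmanKernel α z w * f w)
      (bound := fun w => L * 2 ^ (L + 1) * C * ‖bergmanKernel α z₀ w * f w‖)
      (Metric.ball_mem_nhds z₀ hδ0) ?_ (hint z₀ hz₀) ?_ ?_
      ((hint z₀ hz₀).norm.const_mul _) ?_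
    · filter_upwards [isOpen_tube.mem_nhds hz₀] with z hz using (hint z hz).aestronglyMeasurable
    · refine ContinuousOn.aestronglyMeasurable ?_ measurableSet_tube
      refine hf.smul (ContinuousOn.smul (continuousOn_const.mul (continuousOn_const.mul
        ((continuous_rhoPair_right z₀).continuousOn.cpow_const
          fun w hw => rhoPair_mem_slitPlane hz₀ hw)))
        (continuous_rhoPairDeriv_right z₀).continuousOn)
    · filter_upwards [ae_restrict_mem measurableSet_tube] with w hw z hz
      obtain ⟨hd1, hd2⟩ := h z (Metric.ball_subset_ball
        ((min_le_left _ _).trans (min_le_left _ _)) hz) w hw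
      have hzt := hsub hz
      have hN0 := norm_rhoPair_pos hz₀ hw
      have hN := norm_rhoPair_pos hzt hw
      rw [mem_ball_iff_norm] at hz
      have hle : ‖rhoPair z₀ w‖ / 2 ≤ ‖rhoPair z w‖ := by
        have h1 : C * ‖z - z₀‖ ≤ 1 / 2 := by
          have h2 : ‖z - z₀‖ ≤ 1 / (2 * C) := hz.le.trans (min_le_right _ _)
          rw [le_div_iff₀ (by positivity)] at h2
          linarith
        have h3 := norm_le_norm_add_norm_sub' (rhoPair z₀ w) (rhoPair z w)
        rw [norm_sub_rev] at h3
        nlinarith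
      simp only [hF']
      have e : ((-L : ℝ) : ℂ) - 1 = ((-(L + 1) : ℝ) : ℂ) := by
        push_cast
        ring
      rw [norm_smul, norm_smul, norm_mul, norm_mul, e, Complex.norm_cpow_real, Complex.norm_real,
        Complex.norm_real, norm_neg, Real.norm_of_nonneg hκ.le, Real.norm_of_nonneg hL.le,
        norm_mul, norm_bergmanKernel hα]
      have h4 : ‖rhoPair z w‖ ^ (-(L + 1)) ≤ 2 ^ (L + 1) * ‖rhoPair z₀ w‖ ^ (-(L + 1)) := by
        have : (2 : ℝ) ^ (L + 1) * ‖rhoPair z₀ w‖ ^ (-(L + 1)) =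
            (‖rhoPair z₀ w‖ / 2) ^ (-(L + 1)) := by
          rw [Real.div_rpow hN0.le zero_le_two, Real.rpow_neg zero_le_two, div_inv_eq_mul, mul_comm]
        rw [this]
        exact Real.rpow_le_rpow_of_nonpos (by positivity) hle (by linarith)
      have h5 : ‖rhoPair z₀ w‖ ^ (-(L + 1)) * ‖rhoPair z₀ w‖ = ‖rhoPair z₀ w‖ ^ (-L) := by
        nth_rewrite 2 [← Real.rpow_one ‖rhoPair z₀ w‖]
        rw [← Real.rpow_add hN0]
        congr 1
        ring
      calc ‖f w‖ * (kernelConst d α * (L * ‖rhoPair z w‖ ^ (-(L + 1))) * ‖rhoPairDeriv z w‖)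
          ≤ ‖f w‖ * (kernelConst d α * (L * (2 ^ (L + 1) * ‖rhoPair z₀ w‖ ^ (-(L + 1)))) *
            (C * ‖rhoPair z₀ w‖)) := by gcongr
        _ = L * 2 ^ (L + 1) * C * (kernelConst d α *
            (‖rhoPair z₀ w‖ ^ (-(L + 1)) * ‖rhoPair z₀ w‖) * ‖f w‖) := by ring
        _ = _ := by rw [h5]
    · filter_upwards [ae_restrict_mem measurableSet_tube] with w hw z hz
      exact (hasFDerivAt_bergmanKernel (hsub hz) hw).mul_const (f w)
  exact hFd.differentiableAt.differentiableWithinAt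

/-! ### From Carleson measures to bounded Toeplitz operators. -/

/-- The product of the kernel `ρ(·, ζ)^{-(n+α+1)}` with a function of `A^p_α` is in `A^1_α`. -/
theorem powTest_mul_mem_bergmanSpace_one {α p : ℝ} (hα : -1 < α) (hp : 1 < p) {ζ : CSpace d}
    (hζ : ζ ∈ tube d) {f : CSpace d → ℂ} (hf : f ∈ bergmanSpace d α p) :
    (fun w => powTest ζ (kernelExp d α) w * f w) ∈ bergmanSpace d α 1 := by
  have hL := kernelExp_pos (d := d) hα
  have hpq := (Real.HolderConjugate.conjExponent hp).symm
  set p' := p.conjExponent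
  have hp'1 : 1 < p' := hpq.lt
  obtain ⟨C, -, h⟩ := exists_lintegral_powTest_le (d := d) (m := kernelExp d α) hα hpq.pos
    (by nlinarith)
  obtain ⟨hmem, -⟩ := h ζ hζ
  have hfin : ∀ {s : ℝ} (_ : 0 < s) {g : CSpace d → ℂ}, g ∈ bergmanSpace d α s →
      (∫⁻ w, ‖g w‖ₑ ^ s ∂weightedVolume d α) ^ (1 / s) < ∞ := by
    intro s hs g hg
    rw [← bergmanNorm_rpow α hs]
    exact ENNReal.rpow_lt_top_of_nonneg (by positivity)
      (ENNReal.rpow_lt_top_of_nonneg hs.le hg.2.2.ne).ne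
  refine mem_bergmanSpace_of_lintegral_lt_top one_pos
    ((differentiableOn_powTest hζ _).mul hf.1) ?_
  simp only [ENNReal.rpow_one, enorm_mul]
  refine lt_of_le_of_lt (ENNReal.lintegral_mul_le_Lp_mul_Lq (weightedVolume d α) hpq
    (f := fun w => ‖powTest ζ (kernelExp d α) w‖ₑ) (g := fun w => ‖f w‖ₑ)
    hmem.2.1.enorm hf.2.1.enorm) ?_
  exact ENNReal.mul_lt_top (hfin hpq.pos hmem) (hfin (by linarith) hf)

theorem enorm_bergmanKernel_eq {α : ℝ} (hα : -1 < α) (z w : CSpace d) :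
    ‖bergmanKernel α z w‖ₑ = ENNReal.ofReal (kernelConst d α) *
      ‖powTest z (kernelExp d α) w‖ₑ := by
  have hκ := kernelConst_pos (d := d) hα
  rw [← ofReal_norm, ← ofReal_norm, ← ENNReal.ofReal_mul hκ.le, norm_powTest,
    norm_bergmanKernel hα]

theorem integrableOn_bergmanKernel_mul {α : ℝ} (hα : -1 < α) {μ : Measure (CSpace d)}
    {z : CSpace d} (hz : z ∈ tube d) {f : CSpace d → ℂ} (hf : ContinuousOn f (tube d))
    (hfin : ∫⁻ w in tube d, ‖powTest z (kernelExp d α) w‖ₑ * ‖f w‖ₑ ∂μ < ∞) :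
    IntegrableOn (fun w => bergmanKernel α z w * f w) (tube d) μ := by
  refine ⟨((continuousOn_bergmanKernel_right hz).mul hf).aestronglyMeasurable
    measurableSet_tube, ?_⟩
  simp only [HasFiniteIntegral, enorm_mul, enorm_bergmanKernel_eq hα, mul_assoc]
  rw [lintegral_const_mul' _ _ ENNReal.ofReal_ne_top]
  exact ENNReal.mul_lt_top ENNReal.ofReal_lt_top hfin

theorem enorm_toeplitz_le {α : ℝ} (hα : -1 < α) (μ : Measure (CSpace d)) (z : CSpace d)
    (f : CSpace d → ℂ) :
    ‖toeplitz α μ f z‖ₑ ≤ ENNReal.ofReal (kernelConst d α) *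
      ∫⁻ w in tube d, ‖powTest z (kernelExp d α) w‖ₑ * ‖f w‖ₑ ∂μ := by
  refine (enorm_integral_le_lintegral_enorm _).trans (le_of_eq ?_)
  simp only [enorm_mul, enorm_bergmanKernel_eq hα, mul_assoc]
  exact lintegral_const_mul' _ _ ENNReal.ofReal_ne_top

/-- Applied to the A¹ function `powTest z (kernelExp d α) * f`, the Carleson inequality bounds |T_μ
f(z)| by the positive Bergman operator on |f|. In particular the domain is the whole space, so
density is trivial. -/
theorem toeplitzBounded_of_isCarleson_one {α p : ℝ} (hα : -1 < α) (hp : 1 < p)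
    {μ : Measure (CSpace d)} (h : IsCarleson α 1 μ) : ToeplitzBounded α p μ := by
  have hp0 : 0 < p := by linarith
  obtain ⟨C, hC, hcar⟩ := h
  obtain ⟨C₁, hC₁, hproj⟩ := exists_lintegral_positive_bergman_le (d := d) hα hp
  have hκ := kernelConst_pos (d := d) hα
  have hle : ∀ f ∈ bergmanSpace d α p, ∀ z ∈ tube d,
      ∫⁻ w in tube d, ‖powTest z (kernelExp d α) w‖ₑ * ‖f w‖ₑ ∂μ ≤ ENNReal.ofReal C *
        ∫⁻ w, ‖powTest z (kernelExp d α) w‖ₑ * ‖f w‖ₑ ∂weightedVolume d α := by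
    intro f hf z hz
    have := hcar _ (powTest_mul_mem_bergmanSpace_one hα hp hz hf)
    rw [bergmanNorm_rpow α one_pos] at this
    simpa only [ENNReal.rpow_one, enorm_mul] using this
  have hfin : ∀ f ∈ bergmanSpace d α p, ∀ z ∈ tube d,
      ∫⁻ w, ‖powTest z (kernelExp d α) w‖ₑ * ‖f w‖ₑ ∂weightedVolume d α < ∞ := by
    intro f hf z hz
    have := (powTest_mul_mem_bergmanSpace_one hα hp hz hf).2.2
    rw [← ENNReal.rpow_one (eLpNorm _ _ _), ← bergmanNorm, bergmanNorm_rpow α one_pos] at this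
    simpa only [ENNReal.rpow_one, enorm_mul] using this
  have hdom : ∀ f ∈ bergmanSpace d α p, f ∈ toeplitzDomain α p μ := fun f hf =>
    ⟨hf, fun z hz => integrableOn_bergmanKernel_mul hα hz hf.1.continuousOn
      ((hle f hf z hz).trans_lt (ENNReal.mul_lt_top ENNReal.ofReal_lt_top (hfin f hf z hz)))⟩
  refine ⟨fun f hf ε hε => ⟨f, hdom f hf, ?_⟩, ((kernelConst d α * C) ^ p * C₁) ^ (1 / p),
    by positivity, fun f hf => ?_⟩
  · simpa [bergmanNorm] using hε
  have hpt : ∀ z ∈ tube d, ‖toeplitz α μ f z‖ₑ ≤ ENNReal.ofReal (kernelConst d α * C) *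
      ∫⁻ w, ENNReal.ofReal (‖rhoPair z w‖ ^ (-kernelExp d α)) * ‖(tube d).indicator f w‖ₑ
        ∂weightedVolume d α := by
    intro z hz
    refine (enorm_toeplitz_le hα μ z f).trans ((mul_le_mul_right (hle f hf.1 z hz) _).trans
      (le_of_eq ?_))
    rw [← mul_assoc, ← ENNReal.ofReal_mul hκ.le]
    congr 1
    refine lintegral_congr_ae ?_
    filter_upwards [ae_mem_tube α] with w hw
    rw [Set.indicator_of_mem hw, ← ofReal_norm (powTest _ _ _), norm_powTest]
  have hgm : Measurable fun w : CSpace d => ‖(tube d).indicator f w‖ₑ :=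
    (measurable_indicator_tube hf.1.1.continuousOn).enorm
  have hnorm : ∫⁻ z, ‖toeplitz α μ f z‖ₑ ^ p ∂weightedVolume d α ≤
      ENNReal.ofReal ((kernelConst d α * C) ^ p * C₁) * bergmanNorm α p f ^ p := by
    calc ∫⁻ z, ‖toeplitz α μ f z‖ₑ ^ p ∂weightedVolume d α
        ≤ ∫⁻ z, ENNReal.ofReal (kernelConst d α * C) ^ p *
          (∫⁻ w, ENNReal.ofReal (‖rhoPair z w‖ ^ (-kernelExp d α)) *
            ‖(tube d).indicator f w‖ₑ ∂weightedVolume d α) ^ p ∂weightedVolume d α := by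
          refine lintegral_mono_ae ?_
          filter_upwards [ae_mem_tube α] with z hz
          rw [← ENNReal.mul_rpow_of_nonneg _ _ hp0.le]
          exact ENNReal.rpow_le_rpow (hpt z hz) hp0.le
      _ ≤ ENNReal.ofReal (kernelConst d α * C) ^ p * (ENNReal.ofReal C₁ *
          ∫⁻ w, ‖(tube d).indicator f w‖ₑ ^ p ∂weightedVolume d α) := by
          rw [lintegral_const_mul' _ _
            (ENNReal.rpow_lt_top_of_nonneg hp0.le ENNReal.ofReal_ne_top).ne]
          exact mul_le_mul_right (hproj _ hgm) _
      _ = _ := by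
          rw [← mul_assoc, ENNReal.ofReal_rpow_of_nonneg (by positivity) hp0.le,
            ← ENNReal.ofReal_mul (by positivity), bergmanNorm_rpow α hp0]
          congr 1
          refine lintegral_congr_ae ?_
          filter_upwards [ae_mem_tube α] with w hw
          rw [Set.indicator_of_mem hw]
  have hmem : toeplitz α μ f ∈ bergmanSpace d α p := by
    refine mem_bergmanSpace_of_lintegral_lt_top hp0
      (differentiableOn_toeplitz hα hf.1.1.continuousOn hf.2) (hnorm.trans_lt ?_)
    exact ENNReal.mul_lt_top ENNReal.ofReal_lt_top
      (ENNReal.rpow_lt_top_of_nonneg hp0.le hf.1.2.2.ne)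
  refine ⟨hmem, ?_⟩
  rw [← bergmanNorm_rpow α hp0] at hnorm
  have := ENNReal.rpow_le_rpow hnorm (z := 1 / p) (by positivity)
  rwa [ENNReal.mul_rpow_of_nonneg _ _ (by positivity), ← ENNReal.rpow_mul, ← ENNReal.rpow_mul,
    mul_one_div_cancel hp0.ne', ENNReal.rpow_one, ENNReal.rpow_one,
    ENNReal.ofReal_rpow_of_nonneg (by positivity) (by positivity)] at this

/-! ### From bounded Toeplitz operators to averages. -/

theorem iteratedDeriv_affine_cpow (a b c : ℂ) (k : ℕ) {τ : ℂ}
    (hτ : a + b * τ ∈ Complex.slitPlane) :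
    iteratedDeriv k (fun x : ℂ => (a + b * x) ^ c) τ =
      (∏ j ∈ Finset.range k, (c - j)) * b ^ k * (a + b * τ) ^ (c - k) := by
  induction k generalizing τ with
  | zero => simp
  | succ k ih =>
    have hopen : IsOpen {x : ℂ | a + b * x ∈ Complex.slitPlane} :=
      Complex.isOpen_slitPlane.preimage (by fun_prop)
    have hev : iteratedDeriv k (fun x : ℂ => (a + b * x) ^ c) =ᶠ[nhds τ]
        fun x => (∏ j ∈ Finset.range k, (c - j)) * b ^ k * (a + b * x) ^ (c - k) := by
      filter_upwards [hopen.mem_nhds hτ] with x hx using ih hx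
    have h1 : HasDerivAt (fun x : ℂ => a + b * x) b τ := by
      simpa using ((hasDerivAt_id τ).const_mul b).const_add a
    have h2 := (h1.cpow_const (c := c - k) hτ).const_mul
      ((∏ j ∈ Finset.range k, (c - j)) * b ^ k)
    rw [iteratedDeriv_succ, hev.deriv_eq, h2.deriv, Finset.prod_range_succ, pow_succ]
    have e : c - (k : ℂ) - 1 = c - ((k + 1 : ℕ) : ℂ) := by
      push_cast
      ring
    rw [e]
    ring

/-- The unit vector in the direction of the last coordinate. -/
noncomputable def lastUnit (d : ℕ) : CSpace d := Pi.single (Fin.last d) 1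

theorem rhoPair_add_smul_lastUnit (z w : CSpace d) (τ : ℂ) :
    rhoPair (z + τ • lastUnit d) w = rhoPair z w + -(Complex.I / 2) * τ := by
  simp [rhoPair, lastUnit, (Fin.castSucc_lt_last _).ne]
  ring

theorem rho_add_smul_lastUnit (z : CSpace d) (τ : ℂ) :
    rho (z + τ • lastUnit d) = rho z + τ.im := by
  simp [rho, lastUnit, (Fin.castSucc_lt_last _).ne]
  ring

theorem half_rho_le_of_norm_le {z : CSpace d} {τ : ℂ} (hτ : ‖τ‖ ≤ rho z / 2) :
    rho z / 2 ≤ rho (z + τ • lastUnit d) := by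
  rw [rho_add_smul_lastUnit]
  have := (abs_le.1 ((Complex.abs_im_le_norm τ).trans hτ)).1
  linarith

theorem add_smul_lastUnit_mem_tube {z : CSpace d} (hz : z ∈ tube d) {τ : ℂ}
    (hτ : ‖τ‖ ≤ rho z / 2) : z + τ • lastUnit d ∈ tube d := by
  rw [mem_tube_iff] at *
  linarith [half_rho_le_of_norm_le hτ]

/-- Cauchy's formula for the k-th derivative, ρ(z + τe, w) being affine in τ with slope -i/2. On the
disc of radius ρ(z)/2 at least half of ρ(z) survives, so the power stays holomorphic. -/
theorem circleIntegral_rhoPair_cpow {z w : CSpace d} (hz : z ∈ tube d) (hw : w ∈ tube d) (c : ℂ)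
    (k : ℕ) :
    (∮ τ in C(0, rho z / 2), (1 / τ ^ (k + 1)) • rhoPair (z + τ • lastUnit d) w ^ c) =
      (2 * Real.pi * Complex.I / k.factorial) * ((∏ j ∈ Finset.range k, (c - j)) *
        (-(Complex.I / 2)) ^ k) * rhoPair z w ^ (c - k) := by
  have hρ := mem_tube_iff.1 hz
  have hs : ∀ τ ∈ Metric.closedBall (0 : ℂ) (rho z / 2),
      rhoPair z w + -(Complex.I / 2) * τ ∈ Complex.slitPlane := by
    intro τ hτ
    rw [← rhoPair_add_smul_lastUnit]
    exact rhoPair_mem_slitPlane (add_smul_lastUnit_mem_tube hz (by simpa using hτ)) hw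
  have hd : DifferentiableOn ℂ (fun τ => (rhoPair z w + -(Complex.I / 2) * τ) ^ c)
      (Metric.closedBall 0 (rho z / 2)) := by
    refine DifferentiableOn.cpow_const ?_ hs
    fun_prop
  have h := hd.circleIntegral_one_div_sub_center_pow_smul (by positivity) k
  have h0 := hs 0 (Metric.mem_closedBall_self (by positivity))
  rw [iteratedDeriv_affine_cpow _ _ _ _ h0] at h
  simp only [sub_zero, mul_zero, add_zero] at h
  simp_rw [rhoPair_add_smul_lastUnit]
  rw [h, smul_eq_mul]
  ring

theorem norm_powTest_le {z w : CSpace d} (hz : z ∈ tube d) (hw : w ∈ tube d) {m : ℝ}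
    (hm : 0 ≤ m) : ‖powTest z m w‖ ≤ (rho z / 2) ^ (-m) := by
  have hρ := mem_tube_iff.1 hz
  rw [norm_powTest]
  exact Real.rpow_le_rpow_of_nonpos (by positivity) (by linarith [rho_le_left (z := z) hw])
    (by linarith)

/-- The excess factor |ρ(z,w)|^(-(m-t)) is bounded for fixed z; the remaining power -t is integrable
by `hμ` after moving the base point. -/
theorem integrableOn_powTest {μ : Measure (CSpace d)} {t m : ℝ} (ht : 0 < t) (htm : t ≤ m)
    (hμ : ∫⁻ z in tube d, ENNReal.ofReal (‖rhoPair z (basePoint d)‖ ^ (-t)) ∂μ < ∞)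
    {z : CSpace d} (hz : z ∈ tube d) : IntegrableOn (powTest z m) (tube d) μ := by
  have hρ := mem_tube_iff.1 hz
  obtain ⟨C, hC, h⟩ := exists_norm_rhoPair_le_mul hz (basePoint d)
  refine ⟨(differentiableOn_powTest hz m).continuousOn.aestronglyMeasurable
    measurableSet_tube, ?_⟩
  have hle : ∀ w ∈ tube d, ‖powTest z m w‖ₑ ≤ ENNReal.ofReal ((rho z / 2) ^ (-(m - t)) * C ^ t) *
      ENNReal.ofReal (‖rhoPair w (basePoint d)‖ ^ (-t)) := by
    intro w hw
    rw [← ofReal_norm, ← ENNReal.ofReal_mul (by positivity)]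
    refine ENNReal.ofReal_le_ofReal ?_
    have hN := norm_rhoPair_pos hz hw
    have hB := norm_rhoPair_pos basePoint_mem hw
    have h1 := norm_powTest_le hz hw (sub_nonneg.2 htm)
    rw [norm_powTest] at h1
    have h2 : ‖rhoPair z w‖ ^ (-t) ≤ C ^ t * ‖rhoPair (basePoint d) w‖ ^ (-t) := by
      have e : C ^ t * ‖rhoPair (basePoint d) w‖ ^ (-t) =
          (‖rhoPair (basePoint d) w‖ / C) ^ (-t) := by
        rw [Real.div_rpow hB.le hC.le, Real.rpow_neg hC.le, div_inv_eq_mul, mul_comm]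
      rw [e]
      refine Real.rpow_le_rpow_of_nonpos (by positivity) ?_ (by linarith)
      rw [div_le_iff₀ hC, mul_comm]
      exact h w hw
    rw [norm_powTest, norm_rhoPair_comm w]
    calc ‖rhoPair z w‖ ^ (-m) = ‖rhoPair z w‖ ^ (-(m - t)) * ‖rhoPair z w‖ ^ (-t) := by
          rw [← Real.rpow_add hN]
          congr 1
          ring
      _ ≤ (rho z / 2) ^ (-(m - t)) * (C ^ t * ‖rhoPair (basePoint d) w‖ ^ (-t)) := by gcongr
      _ = _ := by ring
  refine lt_of_le_of_lt (setLIntegral_mono' measurableSet_tube hle) ?_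
  rw [lintegral_const_mul' _ _ ENNReal.ofReal_ne_top]
  exact ENNReal.mul_lt_top ENNReal.ofReal_lt_top hμ

theorem norm_bergmanKernel_le {α : ℝ} (hα : -1 < α) {z w : CSpace d} (hz : z ∈ tube d)
    (hw : w ∈ tube d) :
    ‖bergmanKernel α z w‖ ≤ kernelConst d α * (rho z / 2) ^ (-kernelExp d α) := by
  have := norm_powTest_le hz hw (kernelExp_pos (d := d) hα).le
  rw [norm_powTest] at this
  rw [norm_bergmanKernel hα]
  exact mul_le_mul_of_nonneg_left this (kernelConst_pos hα).le

/-- For fixed ζ the kernel K_α(ζ,·) is bounded on the tube, so μ-integrability of the test function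
suffices. -/
theorem powTest_mem_toeplitzDomain {α p m : ℝ} (hα : -1 < α) {μ : Measure (CSpace d)}
    {z : CSpace d} (hmem : powTest z m ∈ bergmanSpace d α p)
    (hint : IntegrableOn (powTest z m) (tube d) μ) : powTest z m ∈ toeplitzDomain α p μ := by
  refine ⟨hmem, fun ζ hζ => ?_⟩
  refine Integrable.mono' (hint.norm.const_mul
    (kernelConst d α * (rho ζ / 2) ^ (-kernelExp d α)))
    (((continuousOn_bergmanKernel_right hζ).mul hmem.1.continuousOn).aestronglyMeasurable
      measurableSet_tube) ?_
  filter_upwards [ae_restrict_mem measurableSet_tube] with w hw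
  rw [norm_mul]
  exact mul_le_mul_of_nonneg_right (norm_bergmanKernel_le hα hζ hw) (norm_nonneg _)

/-- Point evaluation: the sub-mean value inequality with the cell enlarged to the whole space. Here
ε is the largest admissible radius. -/
theorem exists_enorm_le_mul_bergmanNorm (α : ℝ) {p : ℝ} (hp : 0 < p) :
    ∃ C : ℝ, 0 < C ∧ ∀ f ∈ bergmanSpace d α p, ∀ z ∈ tube d,
      ‖f z‖ₑ ≤ ENNReal.ofReal (C * rho z ^ (-(kernelExp d α / p))) * bergmanNorm α p f := by
  obtain ⟨C, hC, h⟩ := exists_enorm_rpow_le_lintegral_cell (d := d) α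
    (ε := 1 / (4 * (d + 1))) (by positivity) (by field_simp; rfl)
  refine ⟨C ^ (1 / p), by positivity, fun f hf z hz => ?_⟩
  have hρ := mem_tube_iff.1 hz
  have h1 := (h p hp f hf.1 z hz).trans
    (mul_le_mul_right (setLIntegral_le_lintegral _ _) _)
  rw [← bergmanNorm_rpow α hp] at h1
  have h2 := ENNReal.rpow_le_rpow h1 (z := 1 / p) (by positivity)
  rw [ENNReal.mul_rpow_of_nonneg _ _ (by positivity), ← ENNReal.rpow_mul, ← ENNReal.rpow_mul,
    mul_one_div_cancel hp.ne', ENNReal.rpow_one, ENNReal.rpow_one,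
    ENNReal.ofReal_rpow_of_nonneg (by positivity) (by positivity),
    Real.mul_rpow hC.le (by positivity), ← Real.rpow_mul hρ.le] at h2
  have e : -kernelExp d α * (1 / p) = -(kernelExp d α / p) := by ring
  rwa [e] at h2

/-- Off the branch cut conjugation commutes with the principal power, so the two factors are
conjugate. This positivity allows a signless integral to be read off T_μ. -/
theorem rhoPair_cpow_mul_powTest {z w : CSpace d} (hz : z ∈ tube d) (hw : w ∈ tube d) (m : ℝ) :
    rhoPair z w ^ ((-m : ℝ) : ℂ) * powTest z m w = ((‖rhoPair z w‖ ^ (-(2 * m)) : ℝ) : ℂ) := by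
  have harg := Complex.slitPlane_arg_ne_pi (rhoPair_mem_slitPlane hz hw)
  rw [powTest, ← conj_rhoPair z w, Complex.conj_cpow _ _ harg, Complex.conj_ofReal,
    Complex.mul_conj, Complex.normSq_eq_norm_sq, Complex.norm_cpow_real,
    ← Real.rpow_mul_natCast (norm_nonneg _)]
  congr 2
  push_cast
  ring

/-- The Cauchy coefficient of order `k` of the Toeplitz transform of a test function along the
last coordinate is, up to a constant, an integral of Berezin type. -/
theorem circleIntegral_toeplitz_powTest {α : ℝ} (hα : -1 < α) {μ : Measure (CSpace d)}
    [SFinite (μ.restrict (tube d))] {z : CSpace d} (hz : z ∈ tube d) (k : ℕ)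
    (hint : IntegrableOn (powTest z (kernelExp d α + k)) (tube d) μ) :
    (∮ τ in C(0, rho z / 2), (1 / τ ^ (k + 1)) •
      toeplitz α μ (powTest z (kernelExp d α + k)) (z + τ • lastUnit d)) =
    (kernelConst d α * ((2 * Real.pi * Complex.I / k.factorial) *
      ((∏ j ∈ Finset.range k, (((-kernelExp d α : ℝ) : ℂ) - j)) * (-(Complex.I / 2)) ^ k))) *
      ((∫ w in tube d, ‖rhoPair z w‖ ^ (-(2 * (kernelExp d α + k))) ∂μ : ℝ) : ℂ) := by
  have hρ := mem_tube_iff.1 hz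
  have hκ := kernelConst_pos (d := d) hα
  set L := kernelExp d α with hLdef
  set m := L + k with hm
  set R := rho z / 2 with hR
  have hR0 : 0 < R := by positivity
  have hpi : (0 : ℝ) ≤ 2 * Real.pi := by positivity
  set Φ : ℝ → CSpace d → ℂ := fun θ w => deriv (circleMap 0 R) θ •
    ((1 / circleMap 0 R θ ^ (k + 1)) •
      (bergmanKernel α (z + circleMap 0 R θ • lastUnit d) w * powTest z m w)) with hΦ
  have hnorm : ∀ θ, ‖circleMap 0 R θ‖ = R := fun θ => by
    rw [norm_circleMap_zero, abs_of_pos hR0]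
  have hin : ∀ θ, z + circleMap 0 R θ • lastUnit d ∈ tube d := fun θ =>
    add_smul_lastUnit_mem_tube hz (hnorm θ).le
  -- On the circle the kernel is uniformly bounded, so a constant multiple of |`powTest z m`|
  -- dominates and Fubini applies.
  have hI : Integrable (Function.uncurry Φ)
      ((volume.restrict (Set.Ioc 0 (2 * Real.pi))).prod (μ.restrict (tube d))) := by
    have hb : Integrable (fun q : ℝ × CSpace d => R * (1 / R ^ (k + 1)) *
        (kernelConst d α * (R / 2) ^ (-L)) * ‖powTest z m q.2‖)
        ((volume.restrict (Set.Ioc 0 (2 * Real.pi))).prod (μ.restrict (tube d))) := by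
      have h0 : Integrable (powTest z m) (μ.restrict (tube d)) := hint
      exact (h0.norm.comp_snd (volume.restrict (Set.Ioc 0 (2 * Real.pi)))).const_mul _
    have hset : (volume.restrict (Set.Ioc 0 (2 * Real.pi))).prod (μ.restrict (tube d)) =
        ((volume : Measure ℝ).prod (μ.restrict (tube d))).restrict
          (Set.Ioc 0 (2 * Real.pi) ×ˢ tube d) := by
      rw [← Measure.prod_restrict, Measure.restrict_restrict measurableSet_tube, Set.inter_self]
    have hms : MeasurableSet (Set.Ioc 0 (2 * Real.pi) ×ˢ tube d) :=
      measurableSet_Ioc.prod measurableSet_tube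
    refine hb.mono' ?_ ?_
    · rw [hset]
      refine ContinuousOn.aestronglyMeasurable ?_ hms
      have hc : Continuous fun q : ℝ × CSpace d => circleMap 0 R q.1 :=
        (continuous_circleMap 0 R).comp continuous_fst
      have hne : ∀ θ, circleMap 0 R θ ≠ 0 := fun θ => by
        rw [← norm_pos_iff, hnorm]
        exact hR0
      have h1 : Continuous fun q : ℝ × CSpace d => deriv (circleMap 0 R) q.1 := by
        simp_rw [deriv_circleMap]
        exact hc.mul continuous_const
      have h2 : Continuous fun q : ℝ × CSpace d => 1 / circleMap 0 R q.1 ^ (k + 1) :=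
        continuous_const.div (hc.pow _) fun q => pow_ne_zero _ (hne q.1)
      have h3 : Continuous fun q : ℝ × CSpace d =>
          rhoPair (z + circleMap 0 R q.1 • lastUnit d) q.2 := by
        simp_rw [rhoPair_add_smul_lastUnit]
        exact ((continuous_rhoPair_right z).comp continuous_snd).add (continuous_const.mul hc)
      have h4 : ContinuousOn (fun q : ℝ × CSpace d =>
          bergmanKernel α (z + circleMap 0 R q.1 • lastUnit d) q.2)
          (Set.Ioc 0 (2 * Real.pi) ×ˢ tube d) := by
        simp_rw [bergmanKernel_eq]
        exact continuousOn_const.mul (h3.continuousOn.cpow_const fun q hq =>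
          rhoPair_mem_slitPlane (hin q.1) hq.2)
      have h5 : ContinuousOn (fun q : ℝ × CSpace d => powTest z m q.2)
          (Set.Ioc 0 (2 * Real.pi) ×ˢ tube d) :=
        (differentiableOn_powTest hz m).continuousOn.comp continuousOn_snd fun q hq => hq.2
      exact h1.continuousOn.smul (h2.continuousOn.smul (h4.mul h5))
    · rw [hset]
      filter_upwards [ae_restrict_mem hms] with q hq
      have h1 := norm_bergmanKernel_le hα (hin q.1) hq.2
      have h2 : (rho (z + circleMap 0 R q.1 • lastUnit d) / 2) ^ (-L) ≤ (R / 2) ^ (-L) :=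
        Real.rpow_le_rpow_of_nonpos (by positivity)
          (by linarith [half_rho_le_of_norm_le (z := z) (hnorm q.1).le])
          (by linarith [kernelExp_pos (d := d) hα])
      simp only [hΦ, Function.uncurry, norm_smul, norm_mul, norm_div, norm_pow, norm_one,
        deriv_circleMap, hnorm, Complex.norm_I, mul_one]
      rw [mul_assoc R, mul_assoc R, mul_assoc (1 / R ^ (k + 1))]
      gcongr
      exact h1.trans (mul_le_mul_of_nonneg_left h2 hκ.le)
  have e1 : (∮ τ in C(0, R), (1 / τ ^ (k + 1)) •
      toeplitz α μ (powTest z m) (z + τ • lastUnit d)) =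
      ∫ θ in Set.Ioc 0 (2 * Real.pi), ∫ w in tube d, Φ θ w ∂μ := by
    rw [circleIntegral, intervalIntegral.integral_of_le hpi]
    refine integral_congr_ae (Filter.Eventually.of_forall fun θ => ?_)
    simp only [hΦ, toeplitz]
    rw [integral_smul, integral_smul]
  -- The Cauchy integral raises the kernel exponent from L to L + k = m, matching the test function.
  have e2 : ∀ w ∈ tube d, ∫ θ in Set.Ioc 0 (2 * Real.pi), Φ θ w =
      (kernelConst d α * ((2 * Real.pi * Complex.I / k.factorial) *
      ((∏ j ∈ Finset.range k, (((-L : ℝ) : ℂ) - j)) * (-(Complex.I / 2)) ^ k))) *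
      ((‖rhoPair z w‖ ^ (-(2 * m)) : ℝ) : ℂ) := by
    intro w hw
    have h1 := circleIntegral_rhoPair_cpow hz hw ((-L : ℝ) : ℂ) k
    have h2 : ((-L : ℝ) : ℂ) - k = ((-m : ℝ) : ℂ) := by
      rw [hm]
      push_cast
      ring
    rw [h2, circleIntegral, intervalIntegral.integral_of_le hpi] at h1
    rw [← rhoPair_cpow_mul_powTest hz hw m]
    have h3 : ∀ θ, Φ θ w = (kernelConst d α * powTest z m w) * (deriv (circleMap 0 R) θ •
        ((1 / circleMap 0 R θ ^ (k + 1)) •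
          rhoPair (z + circleMap 0 R θ • lastUnit d) w ^ ((-L : ℝ) : ℂ))) := fun θ => by
      simp only [hΦ, smul_eq_mul, bergmanKernel_eq]
      ring
    simp_rw [h3]
    rw [integral_const_mul, h1]
    ring
  rw [e1, integral_integral_swap hI, setIntegral_congr_fun measurableSet_tube e2,
    integral_const_mul, integral_complex_ofReal]

theorem averaging_bounded_of_toeplitzBounded {α r p : ℝ} (hα : -1 < α) (hr : 0 < r) (hp : 1 < p)
    {μ : Measure (CSpace d)} (hμ : MPlus μ) (h : ToeplitzBounded α p μ) :
    BoundedOnTube (averaging α r μ) := by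
  have hp0 : 0 < p := by linarith
  have hsf := hμ.sFinite_restrict
  have hL := kernelExp_pos (d := d) hα
  have hκ := kernelConst_pos (d := d) hα
  obtain ⟨t, ht, hfin⟩ := hμ
  -- k ≥ t ensures m ≥ t, hence the test function is μ-integrable and lies in the domain of T_μ.
  obtain ⟨k, hk⟩ := exists_nat_ge t
  obtain ⟨-, C, hC, hT⟩ := h
  set L := kernelExp d α with hLdef
  set m := L + k with hm
  have hm0 : 0 < m := by positivity
  obtain ⟨C₁, hC₁, h₁⟩ := exists_lintegral_powTest_le (d := d) (m := m) hα hp0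
    (by rw [← hLdef]; nlinarith [show L ≤ m by rw [hm]; linarith [k.cast_nonneg (α := ℝ)]])
  obtain ⟨C₂, hC₂, h₂⟩ := exists_enorm_le_mul_bergmanNorm (d := d) α hp0
  set c : ℂ := kernelConst d α * ((2 * Real.pi * Complex.I / k.factorial) *
      ((∏ j ∈ Finset.range k, (((-L : ℝ) : ℂ) - j)) * (-(Complex.I / 2)) ^ k)) with hc
  have hc0 : c ≠ 0 := by
    have hprod : ∏ j ∈ Finset.range k, (((-L : ℝ) : ℂ) - j) ≠ 0 := by
      refine Finset.prod_ne_zero_iff.2 fun j _ => ?_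
      have : ((-L : ℝ) : ℂ) - j = ((-L - j : ℝ) : ℂ) := by push_cast; ring
      rw [this, Complex.ofReal_ne_zero]
      have : (0 : ℝ) ≤ j := j.cast_nonneg
      linarith
    have h2 : (k.factorial : ℂ) ≠ 0 := by exact_mod_cast k.factorial_ne_zero
    have h3 : (Real.pi : ℂ) ≠ 0 := by exact_mod_cast Real.pi_ne_zero
    have h4 : (kernelConst d α : ℂ) ≠ 0 := by exact_mod_cast hκ.ne'
    have h5 : -(Complex.I / 2) ≠ 0 := by simp
    exact mul_ne_zero h4 (mul_ne_zero (div_ne_zero (by simp [h3]) h2)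
      (mul_ne_zero hprod (pow_ne_zero _ h5)))
  set A := C₂ * 2 ^ (L / p) * (C * C₁ ^ (1 / p)) with hA
  have hA0 : 0 ≤ A := by positivity
  rw [boundedOnTube_averaging_iff hα hr]
  -- The summand 1 only makes the constant positive, as `A` may vanish.
  refine ⟨Real.exp (3 * r) ^ (2 * m) * (‖c‖⁻¹ * (2 * Real.pi * 2 ^ k * A)) + 1,
    by positivity, fun z hz => ?_⟩
  have hρ := mem_tube_iff.1 hz
  have hint : IntegrableOn (powTest z m) (tube d) μ :=
    integrableOn_powTest ht (by rw [hm]; linarith) hfin hz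
  obtain ⟨hmem, hnorm⟩ := h₁ z hz
  obtain ⟨hTmem, hTnorm⟩ := hT _ (powTest_mem_toeplitzDomain hα hmem hint)
  set F := toeplitz α μ (powTest z m) with hF
  have hFnorm : bergmanNorm α p F ≤
      ENNReal.ofReal (C * (C₁ ^ (1 / p) * rho z ^ (L / p - m))) := by
    have h3 : bergmanNorm α p (powTest z m) ≤
        ENNReal.ofReal (C₁ ^ (1 / p) * rho z ^ (L / p - m)) := by
      rw [← bergmanNorm_rpow α hp0] at hnorm
      have h4 := ENNReal.rpow_le_rpow hnorm (z := 1 / p) (by positivity)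
      rw [← ENNReal.rpow_mul, mul_one_div_cancel hp0.ne', ENNReal.rpow_one,
        ENNReal.ofReal_rpow_of_nonneg (by positivity) (by positivity),
        Real.mul_rpow hC₁ (by positivity), ← Real.rpow_mul hρ.le] at h4
      have e : (kernelExp d α - m * p) * (1 / p) = L / p - m := by
        rw [← hLdef]
        field_simp
      rwa [e] at h4
    rw [ENNReal.ofReal_mul hC.le]
    exact hTnorm.trans (mul_le_mul_right h3 _)
  have hpt : ∀ τ : ℂ, ‖τ‖ ≤ rho z / 2 → ‖F (z + τ • lastUnit d)‖ ≤ A * rho z ^ (-m) := by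
    intro τ hτ
    have hin := add_smul_lastUnit_mem_tube hz hτ
    have hhalf := half_rho_le_of_norm_le hτ
    have h3 := (h₂ F hTmem _ hin).trans (mul_le_mul_right hFnorm _)
    rw [← ENNReal.ofReal_mul (by have := mem_tube_iff.1 hin; positivity), ← ofReal_norm] at h3
    have h4 := (ENNReal.ofReal_le_ofReal_iff (by have := mem_tube_iff.1 hin; positivity)).1 h3
    have h5 : rho (z + τ • lastUnit d) ^ (-(kernelExp d α / p)) ≤
        2 ^ (L / p) * rho z ^ (-(L / p)) := by
      have : (2 : ℝ) ^ (L / p) * rho z ^ (-(L / p)) = (rho z / 2) ^ (-(L / p)) := by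
        rw [Real.div_rpow hρ.le zero_le_two, Real.rpow_neg zero_le_two, div_inv_eq_mul, mul_comm]
      rw [this]
      exact Real.rpow_le_rpow_of_nonpos (by positivity) hhalf
        (neg_nonpos.2 (by positivity))
    have h6 : rho z ^ (-(L / p)) * rho z ^ (L / p - m) = rho z ^ (-m) := by
      rw [← Real.rpow_add hρ]
      congr 1
      ring
    calc ‖F (z + τ • lastUnit d)‖ ≤ _ := h4
      _ ≤ C₂ * (2 ^ (L / p) * rho z ^ (-(L / p))) *
          (C * (C₁ ^ (1 / p) * rho z ^ (L / p - m))) := by gcongr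
      _ = A * (rho z ^ (-(L / p)) * rho z ^ (L / p - m)) := by rw [hA]; ring
      _ = _ := by rw [h6]
  have hcirc := circleIntegral_toeplitz_powTest hα hz k hint
  have hcle : ‖∮ τ in C(0, rho z / 2), (1 / τ ^ (k + 1)) • F (z + τ • lastUnit d)‖ ≤
      2 * Real.pi * (rho z / 2) * (1 / (rho z / 2) ^ (k + 1) * (A * rho z ^ (-m))) := by
    refine circleIntegral.norm_integral_le_of_norm_le_const (by positivity) fun τ hτ => ?_
    have hτ' : ‖τ‖ = rho z / 2 := by simpa using hτ
    rw [norm_smul, norm_div, norm_one, norm_pow, hτ']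
    exact mul_le_mul_of_nonneg_left (hpt τ hτ'.le) (by positivity)
  set J := ∫ w in tube d, ‖rhoPair z w‖ ^ (-(2 * m)) ∂μ with hJ
  have hJ0 : 0 ≤ J := integral_nonneg fun w => by positivity
  rw [hcirc, norm_mul, Complex.norm_real, Real.norm_of_nonneg hJ0] at hcle
  have hcpos : 0 < ‖c‖ := norm_pos_iff.2 hc0
  have hJle : J ≤ ‖c‖⁻¹ * (2 * Real.pi * 2 ^ k * A) * (rho z ^ (-m) / rho z ^ k) := by
    rw [mul_assoc, ← div_eq_inv_mul, le_div_iff₀ hcpos, mul_comm]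
    refine hcle.trans (le_of_eq ?_)
    rw [pow_succ, div_pow]
    field_simp
  -- One of the two factors |ρ(z,w)|^(-m) is bounded for fixed z, the other is integrable. Without
  -- this the Bochner integral `J` could be the default 0 and bound nothing.
  have hJint : Integrable (fun w => ‖rhoPair z w‖ ^ (-(2 * m))) (μ.restrict (tube d)) := by
    refine Integrable.mono' (hint.norm.const_mul ((rho z / 2) ^ (-m)))
      ((continuous_rhoPair_right z).norm.measurable.pow_const _).aestronglyMeasurable ?_
    filter_upwards [ae_restrict_mem measurableSet_tube] with w hw
    have hN := norm_rhoPair_pos hz hw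
    have h3 : ‖rhoPair z w‖ ^ (-(2 * m)) = ‖powTest z m w‖ * ‖powTest z m w‖ := by
      rw [norm_powTest, ← Real.rpow_add hN]
      congr 1
      ring
    rw [Real.norm_of_nonneg (by positivity), h3]
    exact mul_le_mul_of_nonneg_right (norm_powTest_le hz hw hm0.le) (norm_nonneg _)
  have hJl : ∫⁻ w in tube d, ENNReal.ofReal (‖rhoPair z w‖ ^ (-(2 * m))) ∂μ =
      ENNReal.ofReal J :=
    (ofReal_integral_eq_lintegral_ofReal hJint
      (Filter.Eventually.of_forall fun w => by positivity)).symm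
  refine (measure_bergmanBall_le μ hz r (m := 2 * m) (by positivity)).trans ?_
  rw [hJl, ← ENNReal.ofReal_mul (by positivity)]
  refine ENNReal.ofReal_le_ofReal ?_
  have h7 : rho z ^ (2 * m) * (rho z ^ (-m) / rho z ^ k) = rho z ^ L := by
    rw [← Real.rpow_natCast, ← Real.rpow_sub hρ, ← Real.rpow_add hρ]
    congr 1
    rw [hm]
    ring
  have hρL : 0 < rho z ^ L := by positivity
  calc (Real.exp (3 * r) * rho z) ^ (2 * m) * J
      ≤ (Real.exp (3 * r) * rho z) ^ (2 * m) *
        (‖c‖⁻¹ * (2 * Real.pi * 2 ^ k * A) * (rho z ^ (-m) / rho z ^ k)) := by gcongr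
    _ = Real.exp (3 * r) ^ (2 * m) * (‖c‖⁻¹ * (2 * Real.pi * 2 ^ k * A)) *
        (rho z ^ (2 * m) * (rho z ^ (-m) / rho z ^ k)) := by
        rw [Real.mul_rpow (by positivity) hρ.le]
        ring
    _ ≤ _ := by
        rw [h7]
        linarith

end TubeBergman

theorem theorem6p1 (d : ℕ) (r p q α : ℝ) (hr : 0 < r) (hp : 1 < p) (hq : 0 < q) (hα : -1 < α)
    (μ : MeasureTheory.Measure (TubeBergman.CSpace d)) (hμ : TubeBergman.MPlus μ) :
    List.TFAE
      [TubeBergman.ToeplitzBounded α p μ,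
       TubeBergman.BoundedOnTube (TubeBergman.berezin α μ),
       TubeBergman.BoundedOnTube (TubeBergman.averaging α r μ),
       TubeBergman.IsCarleson α q μ] := by
  tfae_have 1 → 3 := TubeBergman.averaging_bounded_of_toeplitzBounded hα hr hp hμ
  tfae_have 3 → 4 := TubeBergman.isCarleson_of_averaging_bounded hα hr hq hμ
  tfae_have 4 → 2 := TubeBergman.berezin_bounded_of_isCarleson hα hq
  tfae_have 2 → 3 := TubeBergman.averaging_bounded_of_berezin_bounded hα hr
  -- Condition 3 does not involve q, so it yields the Carleson property with exponent 1.
  tfae_have 3 → 1 := fun h => TubeBergman.toeplitzBounded_of_isCarleson_one hα hp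
    (TubeBergman.isCarleson_of_averaging_bounded hα hr one_pos hμ h)
  tfae_finish
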